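/- Let $n\ge 3$. A pencil of quadratic forms on an $n$-dimensional complex vector space $W$ is a two-dimensional space $\Phi$ of quadratic forms on $W$ (a line in $\mathbb P(\mathrm{Sym}^2W^*)$); it is nonsingular if it has a nondegenerate member and contains, up to scalars, exactly $n$ degenerate members. Let $\mathcal M_n^{\rm PQ}$ be the moduli space of nonsingular pencils, i.e. the geometric quotient by $\mathrm{PGL}(W)$ of the Zariski open set of nonsingular pencils in the Grassmannian $\mathrm{Gr}(1,\mathbb P(\mathrm{Sym}^2W^*))$, with its Zariski (quotient) topology and its regular functions (those whose pull-backs are regular). For an $n$-dimensional complex submanifold $M\subset\mathbb P^{n+2}$, the derivative at $x\in M$ of the Gauss map, which sends a point to its affine tangent space, defines the second fundamental form $II_{M,x}$, a linear system of quadratic forms on $T_xM$. Let $M^o$ be the set of all $x\in M$ such that $II_{M,x}$ is a nonsingular pencil, and let $\mu^M:M^o\to\mathcal M_n^{\rm PQ}$ be the map sending $x$ to the isomorphism class of $II_{M,x}$. (1) Let $X\subset\mathbb P^{n+2}$ be a nonsingular intersection of two quadric hypersurfaces (the common zero locus of two quadratic forms whose differentials are linearly independent at each of its points). Then $X^o$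 is Zariski open in $X$, the map $\mu^X:X^o\to\mathcal M_n^{\rm PQ}$ is a morphism, and it is dominant. (2) For any two nonsingular intersections $X,X'\subset\mathbb P^{n+2}$ of two quadric hypersurfaces there are nonempty Euclidean open subsets $M\subset X$ and $M'\subset X'$ with $M^o=M$ and $M'^o=M'$, and a biholomorphic map $f:M\to M'$, such that $\mu^M=\mu^{M'}\circ f$. (3) The question of Griffiths and Harris, whether a biholomorphic map $f:M\to M'$ of submanifolds of codimension two of $\mathbb P^{n+2}$ with $\mu^M=\mu^{M'}\circ f$ is always induced by a projective automorphism of $\mathbb P^{n+2}$, has a negative answer for every $n\ge3$: there are connected nonempty Euclidean open subsets $M$, $M'$ of nonsingular intersections of two quadric hypersurfaces in $\mathbb P^{n+2}$, with $M^o=M$ and $M'^o=M'$, and a biholomorphic map $f:M\to M'$ with $\mu^M=\mu^{M'}\circ f$, such that no projective automorphism $T$ of $\mathbb P^{n+2}$ satisfies $T|_M=f$. -/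

import Mathlib

open scoped LinearAlgebra.Projectivization Topology

namespace QuadricPencils

noncomputable section

/-! ### Pencils of quadratic forms and their moduli -/

section Pencils

variable {W W' W'' : Type*} [AddCommGroup W] [Module ℂ W] [AddCommGroup W'] [Module ℂ W']
  [AddCommGroup W''] [Module ℂ W'']

/-- The quadratic form `φ` has a nonzero vector orthogonal to the whole space. -/
def IsDegenerate (φ : QuadraticForm ℂ W) : Prop :=
  ∃ u : W, u ≠ 0 ∧ ∀ v : W, QuadraticMap.polar φ u v = 0

/-- The pull-back `T^* φ = φ ∘ T` of quadratic forms along a linear map, as a linear map in `φ`. -/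
def pullback (T : W' →ₗ[ℂ] W) : QuadraticForm ℂ W →ₗ[ℂ] QuadraticForm ℂ W' where
  toFun φ := φ.comp T
  map_add' _ _ := rfl
  map_smul' _ _ := rfl

/-- A nonsingular pencil of quadratic forms on `W`: a line in `ℙ(Sym² W^*)`, given by the
corresponding two-dimensional space `Φ` of quadratic forms, which has a nondegenerate member and
meets the locus of degenerate forms in exactly `dim W` distinct points. -/
structure IsNonsingularPencil (Φ : Submodule ℂ (QuadraticForm ℂ W)) : Prop where
  finrank_eq : Module.finrank ℂ Φ = 2
  nondegenerate : ∃ φ ∈ Φ, ¬ IsDegenerate φ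
  ncard_degenerate :
    {p : ℙ ℂ (QuadraticForm ℂ W) | p.rep ∈ Φ ∧ IsDegenerate p.rep}.ncard = Module.finrank ℂ W

theorem pullback_apply (T : W' →ₗ[ℂ] W) (φ : QuadraticForm ℂ W) (w : W') :
    pullback T φ w = φ (T w) := rfl

theorem pullback_injective (e : W' ≃ₗ[ℂ] W) :
    Function.Injective (pullback (e : W' →ₗ[ℂ] W)) := by
  intro φ ψ h
  ext w
  have := DFunLike.congr_fun h (e.symm w)
  simpa [pullback_apply] using this

theorem isDegenerate_pullback_iff (e : W' ≃ₗ[ℂ] W) (φ : QuadraticForm ℂ W) :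
    IsDegenerate (pullback (e : W' →ₗ[ℂ] W) φ) ↔ IsDegenerate φ := by
  have key : ∀ u v, QuadraticMap.polar (pullback (e : W' →ₗ[ℂ] W) φ) u v
      = QuadraticMap.polar φ (e u) (e v) := by
    intro u v
    simp [QuadraticMap.polar, pullback_apply]
  constructor
  · rintro ⟨u, hu, h⟩
    refine ⟨e u, by simpa using hu, fun v => ?_⟩
    have := h (e.symm v)
    rw [key] at this
    simpa using this
  · rintro ⟨u, hu, h⟩
    refine ⟨e.symm u, by simpa using hu, fun v => ?_⟩
    rw [key]
    simpa using h (e v)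

theorem isDegenerate_smul_iff (a : ℂˣ) (φ : QuadraticForm ℂ W) :
    IsDegenerate (a • φ) ↔ IsDegenerate φ := by
  have key : ∀ u v, QuadraticMap.polar (⇑(a • φ)) u v = (a : ℂ) * QuadraticMap.polar φ u v := by
    intro u v
    simp only [QuadraticMap.polar, Units.smul_def, FunLike.coe_smul, Pi.smul_apply, smul_eq_mul]
    ring
  simp only [IsDegenerate, key, mul_eq_zero, a.ne_zero, false_or]

/-- Nonsingularity of a pencil is invariant under linear isomorphisms. -/
theorem IsNonsingularPencil.map_pullback {Φ : Submodule ℂ (QuadraticForm ℂ W)}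
    (h : IsNonsingularPencil Φ) (e : W' ≃ₗ[ℂ] W) :
    IsNonsingularPencil (Φ.map (pullback (e : W' →ₗ[ℂ] W))) := by
  have hinj := pullback_injective e
  have hsurj : ∀ ψ, ∃ φ, pullback (e : W' →ₗ[ℂ] W) φ = ψ := fun ψ =>
    ⟨pullback (e.symm : W →ₗ[ℂ] W') ψ, by ext; simp [pullback_apply]⟩
  refine ⟨?_, ?_, ?_⟩
  · rw [← h.finrank_eq]
    exact (Submodule.equivMapOfInjective _ hinj Φ).finrank_eq.symm
  · obtain ⟨φ, hφ, hd⟩ := h.nondegenerate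
    exact ⟨_, Submodule.mem_map_of_mem hφ, by rwa [isDegenerate_pullback_iff]⟩
  · have hrep : ∀ q : ℙ ℂ (QuadraticForm ℂ W),
        ((Projectivization.map _ hinj q).rep ∈ Φ.map (pullback (e : W' →ₗ[ℂ] W)) ∧
          IsDegenerate (Projectivization.map _ hinj q).rep) ↔ (q.rep ∈ Φ ∧ IsDegenerate q.rep) := by
      intro q
      obtain ⟨a, ha⟩ := Projectivization.exists_smul_eq_mk_rep ℂ (pullback (e : W' →ₗ[ℂ] W) q.rep)
        (by simpa using hinj.ne q.rep_nonzero)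
      have hq : Projectivization.map _ hinj q = Projectivization.mk ℂ _
          (by simpa using hinj.ne q.rep_nonzero : pullback (e : W' →ₗ[ℂ] W) q.rep ≠ 0) := by
        conv_lhs => rw [← q.mk_rep]
        rfl
      rw [hq, ← ha, isDegenerate_smul_iff, isDegenerate_pullback_iff]
      refine and_congr_left fun _ => ?_
      rw [Units.smul_def, Submodule.smul_mem_iff _ a.ne_zero]
      exact ⟨fun ⟨φ, hφ, h⟩ => hinj h ▸ hφ, Submodule.mem_map_of_mem⟩
    rw [e.finrank_eq, ← h.ncard_degenerate,
      ← Set.ncard_image_of_injective _ (Projectivization.map_injective _ hinj)]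
    congr 1
    ext p
    constructor
    · intro hp
      obtain ⟨φ, hφ⟩ := hsurj p.rep
      have h0 : φ ≠ 0 := by
        rintro rfl
        exact p.rep_nonzero (by rw [← hφ, map_zero])
      have hpq : Projectivization.map _ hinj (Projectivization.mk ℂ φ h0) = p := by
        conv_rhs => rw [← p.mk_rep]
        simp only [Projectivization.map_mk, hφ]
      refine ⟨_, ?_, hpq⟩
      have := (hrep (Projectivization.mk ℂ φ h0)).1
      rw [hpq] at this
      exact this hp
    · rintro ⟨q, hq, rfl⟩
      exact (hrep q).2 hq

/-- Nonsingular pencils of quadratic forms on `ℂⁿ`. -/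
abbrev NonsingularPencil (n : ℕ) : Type :=
  {Φ : Submodule ℂ (QuadraticForm ℂ (Fin n → ℂ)) // IsNonsingularPencil Φ}

theorem map_pullback_map_pullback (Φ : Submodule ℂ (QuadraticForm ℂ W)) (S : W' →ₗ[ℂ] W)
    (T : W'' →ₗ[ℂ] W') :
    (Φ.map (pullback S)).map (pullback T) = Φ.map (pullback (S ∘ₗ T)) := by
  rw [← Submodule.map_comp]
  rfl

theorem map_pullback_id (Φ : Submodule ℂ (QuadraticForm ℂ W)) :
    Φ.map (pullback LinearMap.id) = Φ := by
  exact Submodule.map_id Φ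

/-- Projective equivalence of pencils: `Ψ = T^* Φ` for some `T ∈ GL(ℂⁿ)`. -/
def pencilSetoid (n : ℕ) : Setoid (NonsingularPencil n) where
  r Φ Ψ := ∃ T : (Fin n → ℂ) ≃ₗ[ℂ] (Fin n → ℂ),
    Ψ.1 = Φ.1.map (pullback (T : (Fin n → ℂ) →ₗ[ℂ] (Fin n → ℂ)))
  iseqv := by
    refine ⟨fun Φ => ⟨LinearEquiv.refl ℂ _, (map_pullback_id _).symm⟩, ?_, ?_⟩
    · rintro Φ Ψ ⟨T, hT⟩
      refine ⟨T.symm, ?_⟩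
      rw [hT, map_pullback_map_pullback, LinearEquiv.comp_coe, LinearEquiv.symm_trans_self]
      exact (map_pullback_id _).symm
    · rintro Φ Ψ Χ ⟨S, hS⟩ ⟨T, hT⟩
      refine ⟨T.trans S, ?_⟩
      rw [hT, hS, map_pullback_map_pullback, LinearEquiv.comp_coe]

/-- The moduli space of nonsingular pencils of quadratic forms on an `n`-dimensional complex vector
space: the orbit space of nonsingular pencils on `ℂⁿ` under `PGL`. -/
def PQ (n : ℕ) : Type := Quotient (pencilSetoid n)

/-- The class in the moduli space of a nonsingular pencil on any `n`-dimensional space, through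
an arbitrary linear identification of that space with `ℂⁿ`. -/
def pencilClass [FiniteDimensional ℂ W] {n : ℕ} (hn : Module.finrank ℂ W = n)
    (Φ : Submodule ℂ (QuadraticForm ℂ W)) (hΦ : IsNonsingularPencil Φ) : PQ n :=
  Quotient.mk (pencilSetoid n) ⟨Φ.map (pullback
    (LinearEquiv.ofFinrankEq (Fin n → ℂ) W (by rw [Module.finrank_fin_fun, hn]) : (Fin n → ℂ) →ₗ[ℂ] W)),
    hΦ.map_pullback _⟩

/-- The class of a pencil does not depend on the identification with `ℂⁿ`. -/
theorem pencilClass_eq [FiniteDimensional ℂ W] {n : ℕ} (hn : Module.finrank ℂ W = n)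
    (Φ : Submodule ℂ (QuadraticForm ℂ W)) (hΦ : IsNonsingularPencil Φ)
    (e : (Fin n → ℂ) ≃ₗ[ℂ] W) :
    pencilClass hn Φ hΦ = Quotient.mk (pencilSetoid n)
      ⟨Φ.map (pullback (e : (Fin n → ℂ) →ₗ[ℂ] W)), hΦ.map_pullback e⟩ := by
  refine Quotient.sound ⟨e.trans (LinearEquiv.ofFinrankEq (Fin n → ℂ) W (by rw [Module.finrank_fin_fun, hn])).symm, ?_⟩
  dsimp only
  rw [map_pullback_map_pullback]
  congr 2
  ext
  simp

end Pencils

/-! ### Zariski topologies and regular functions -/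

section Zariski

variable (E : Type*) [AddCommGroup E] [Module ℂ E]

/-- The algebra of polynomial functions on a finite-dimensional vector space. -/
def polynomialFunctions : Subalgebra ℂ (E → ℂ) :=
  Algebra.adjoin ℂ (Set.range fun l : Module.Dual ℂ E => (l : E → ℂ))

/-- The Zariski topology on a finite-dimensional vector space, with basic open sets `{P ≠ 0}`. -/
@[reducible] def zariski : TopologicalSpace E :=
  TopologicalSpace.generateFrom {U | ∃ P ∈ polynomialFunctions E, U = {x | P x ≠ 0}}

/-- The Zariski topology on a projective space, as the quotient of the punctured vector space. -/
@[reducible] def zariskiProj : TopologicalSpace (ℙ ℂ E) :=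
  TopologicalSpace.coinduced (Projectivization.mk' ℂ)
    (TopologicalSpace.induced Subtype.val (zariski E))

variable {E}

/-- With `α` mapped to a vector space by `ι`, the function `g` on `B ⊆ α` is locally, near every
point of `B` and for the Zariski topology, a quotient of two polynomial functions. -/
def IsLocallyFraction {α : Type*} (ι : α → E) (B : Set α) (g : α → ℂ) : Prop :=
  ∀ a ∈ B, ∃ P ∈ polynomialFunctions E, ∃ Q ∈ polynomialFunctions E,
    Q (ι a) ≠ 0 ∧ ∀ b ∈ B, Q (ι b) ≠ 0 → g b = P (ι b) / Q (ι b)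

/-- The pairs of quadratic forms on `ℂⁿ` that span a nonsingular pencil. -/
abbrev NonsingularPair (n : ℕ) : Type :=
  {p : QuadraticForm ℂ (Fin n → ℂ) × QuadraticForm ℂ (Fin n → ℂ) //
    IsNonsingularPencil (Submodule.span ℂ {p.1, p.2})}

/-- The class of the pencil spanned by a pair. -/
def pairClass (n : ℕ) (p : NonsingularPair n) : PQ n :=
  Quotient.mk (pencilSetoid n) ⟨Submodule.span ℂ {p.1.1, p.1.2}, p.2⟩

/-- The Zariski topology of the moduli space as a geometric quotient: the Grassmannian of pencils
has the quotient topology from pairs, and the moduli space has the quotient topology from the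
nonsingular pencils. -/
instance zariskiPQ (n : ℕ) : TopologicalSpace (PQ n) :=
  TopologicalSpace.coinduced (pairClass n)
    (TopologicalSpace.induced Subtype.val
      (zariski (QuadraticForm ℂ (Fin n → ℂ) × QuadraticForm ℂ (Fin n → ℂ))))

/-- Regular functions on a subset of the moduli space: functions whose pull-back to pairs (an
invariant function) is regular. -/
def IsRegularPQ {n : ℕ} (O : Set (PQ n)) (g : PQ n → ℂ) : Prop :=
  IsLocallyFraction (Subtype.val : NonsingularPair n → _) (pairClass n ⁻¹' O) (g ∘ pairClass n)

/-- The nonzero vectors on the lines that belong to `S`: the punctured affine cone over `S`. -/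
def cone (S : Set (ℙ ℂ E)) : Set E := {v | ∃ hv : v ≠ 0, Projectivization.mk ℂ v hv ∈ S}

/-- The point of `S` defined by a vector of its cone. -/
def cone.toProj {S : Set (ℙ ℂ E)} (v : cone S) : S :=
  ⟨Projectivization.mk ℂ (v : E) v.2.fst, v.2.snd⟩

/-- Regular functions on a subset `B` of `A ⊆ ℙ(E)`: functions whose pull-back to the affine cone
(a function that is homogeneous of degree zero) is regular. -/
def IsRegularProj {A : Set (ℙ ℂ E)} (B : Set A) (g : A → ℂ) : Prop :=
  IsLocallyFraction (Subtype.val : cone A → E) (cone.toProj ⁻¹' B) (g ∘ cone.toProj)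

/-- Morphisms from a locally closed subset `A` of projective space to the moduli space: continuous
maps for the Zariski topologies that pull regular functions back to regular functions. -/
structure IsMorphism {n : ℕ} {A : Set (ℙ ℂ E)} (f : A → PQ n) : Prop where
  continuous : ∀ O : Set (PQ n), IsOpen O →
    ∃ U : Set (ℙ ℂ E), IsOpen[zariskiProj E] U ∧ f ⁻¹' O = Subtype.val ⁻¹' U
  regular : ∀ (O : Set (PQ n)) (g : PQ n → ℂ), IsOpen O → IsRegularPQ O g →
    IsRegularProj (f ⁻¹' O) (g ∘ f)

end Zariski

/-! ### Second fundamental forms in projective space -/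

section SecondForm

variable {V : Type*} [NormedAddCommGroup V] [NormedSpace ℂ V]

/-- The Euclidean topology on projective space. -/
instance euclideanProj : TopologicalSpace (ℙ ℂ V) :=
  TopologicalSpace.coinduced (Projectivization.mk' ℂ) inferInstance

/-- The germ at `0` of a holomorphic arc in the affine cone over `S`. -/
structure IsArc (S : Set (ℙ ℂ V)) (c : ℂ → V) : Prop where
  analyticAt : AnalyticAt ℂ c 0
  mem_cone : ∀ᶠ t in 𝓝 0, c t ∈ cone S

/-- The affine tangent space at `v` of the cone over `S`. -/
def affineTangent (S : Set (ℙ ℂ V)) (v : V) : Submodule ℂ V :=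
  Submodule.span ℂ {u | ∃ c : ℂ → V, IsArc S c ∧ c 0 = v ∧ deriv c 0 = u}

/-- The tangent space `T_x S = T̂ / x̂`, where `T̂` is the affine tangent space (the value at `x` of
the Gauss map) and `x̂` is the line `x`.  The canonical identification is with `Hom(x̂, T̂ / x̂)`; the
chosen generator of `x̂` only matters up to a scalar. -/
abbrev TangentSpace (S : Set (ℙ ℂ V)) (x : ℙ ℂ V) : Type _ :=
  affineTangent S x.rep ⧸ x.submodule.comap (affineTangent S x.rep).subtype

/-- The germ at `0` of a holomorphic section along the arc `c` of the tangent spaces of the cone. -/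
structure IsTangentField (S : Set (ℙ ℂ V)) (c w : ℂ → V) : Prop where
  analyticAt : AnalyticAt ℂ w 0
  mem_tangent : ∀ᶠ t in 𝓝 0, w t ∈ affineTangent S (c t)

/-- The second fundamental form of `S` at `x`, as a linear system of quadratic forms on `T_x S`.
The derivative of the Gauss map `γ` at `x` in the direction `c'(0)` of an arc `c` through `x` is the
element `w(0) ↦ w'(0) mod T̂` of `Hom(T̂, V / T̂)`, the tangent space of the Grassmannian at `T̂ = γ(x)`,
where `w` runs through the sections of `γ` along `c`.  The members of the linear system are
the forms `φ` whose symmetric bilinear form `B_φ` is obtained from this derivative by composition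
with some linear form `l` on `V / T̂`. -/
def secondForm (S : Set (ℙ ℂ V)) (x : ℙ ℂ V) :
    Submodule ℂ (QuadraticForm ℂ (TangentSpace S x)) where
  carrier := {φ | ∃ l : Module.Dual ℂ V, (∀ u ∈ affineTangent S x.rep, l u = 0) ∧
    ∀ c w : ℂ → V, IsArc S c → c 0 = x.rep → IsTangentField S c w →
      ∀ u₀ w₀ : affineTangent S x.rep, (u₀ : V) = deriv c 0 → (w₀ : V) = w 0 →
        QuadraticMap.polar φ (Submodule.Quotient.mk u₀) (Submodule.Quotient.mk w₀) / 2
          = l (deriv w 0)}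
  add_mem' := by
    rintro φ ψ ⟨l, hl, h⟩ ⟨m, hm, k⟩
    refine ⟨l + m, fun u hu => by simp [hl u hu, hm u hu], ?_⟩
    intro c w hc h0 hw u₀ w₀ hu hw0
    rw [LinearMap.add_apply, ← h c w hc h0 hw u₀ w₀ hu hw0, ← k c w hc h0 hw u₀ w₀ hu hw0,
      ← add_div, FunLike.coe_add, QuadraticMap.polar_add]
  zero_mem' := ⟨0, by simp, by simp [QuadraticMap.polar]⟩
  smul_mem' := by
    rintro a φ ⟨l, hl, h⟩
    refine ⟨a • l, fun u hu => by simp [hl u hu], ?_⟩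
    intro c w hc h0 hw u₀ w₀ hu hw0
    rw [LinearMap.smul_apply, ← h c w hc h0 hw u₀ w₀ hu hw0, FunLike.coe_smul,
      QuadraticMap.polar_smul, smul_eq_mul, smul_eq_mul, mul_div_assoc]

variable [FiniteDimensional ℂ V]

/-- The set `S^o` of the points where `S` has dimension `n` and where the second fundamental form is
a nonsingular pencil. -/
def moduliDomain (n : ℕ) (S : Set (ℙ ℂ V)) : Set (ℙ ℂ V) :=
  {x | x ∈ S ∧ Module.finrank ℂ (TangentSpace S x) = n ∧ IsNonsingularPencil (secondForm S x)}

/-- The moduli map `μ^S : S^o → PQ n` of second fundamental forms. -/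
def moduliMap (n : ℕ) (S : Set (ℙ ℂ V)) (x : moduliDomain n S) : PQ n :=
  pencilClass x.2.2.1 (secondForm S x) x.2.2.2

end SecondForm

/-! ### Intersections of two quadrics and holomorphic maps -/

section Varieties

variable {V : Type*} [NormedAddCommGroup V] [NormedSpace ℂ V]

/-- `X` is a nonsingular intersection of two quadrics, smooth of codimension two: it is the zero
locus of two quadratic forms whose differentials are linearly independent at every point of `X`. -/
def IsNonsingularIntersection (X : Set (ℙ ℂ V)) : Prop :=
  ∃ q₁ q₂ : QuadraticForm ℂ V, X = {x | q₁ x.rep = 0 ∧ q₂ x.rep = 0} ∧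
    ∀ x ∈ X, LinearIndependent ℂ ![q₁.polarBilin x.rep, q₂.polarBilin x.rep]

/-- `M` is a relatively open subset of `X` for the Euclidean topology. -/
def IsEuclideanOpenIn (M X : Set (ℙ ℂ V)) : Prop :=
  ∃ U : Set (ℙ ℂ V), IsOpen U ∧ M = X ∩ U

/-- Holomorphic maps on a submanifold `M` of projective space: near every point the map is induced
by a holomorphic map between the ambient vector spaces. -/
def IsHolomorphic {M : Set (ℙ ℂ V)} (f : M → ℙ ℂ V) : Prop :=
  ∀ x : M, ∃ F : V → V, AnalyticAt ℂ F x.1.rep ∧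
    ∀ᶠ v in 𝓝 x.1.rep, ∀ hv : v ∈ cone M,
      ∃ hF : F v ≠ 0, Projectivization.mk ℂ (F v) hF = f (cone.toProj ⟨v, hv⟩)

/-- Bijections that are holomorphic in both directions. -/
def IsBiholomorphic {M M' : Set (ℙ ℂ V)} (f : M ≃ M') : Prop :=
  IsHolomorphic (fun x => (f x : ℙ ℂ V)) ∧ IsHolomorphic (fun y => (f.symm y : ℙ ℂ V))

variable [FiniteDimensional ℂ V]

/-- The second fundamental forms of `M` and `M'` are nonsingular pencils everywhere, and
`μ^M = μ^{M'} ∘ f`. -/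
def PreservesModuli (n : ℕ) {M M' : Set (ℙ ℂ V)} (f : M ≃ M') : Prop :=
  ∃ (hM : M ⊆ moduliDomain n M) (hM' : M' ⊆ moduliDomain n M'),
    ∀ x : M, moduliMap n M ⟨x, hM x.2⟩ = moduliMap n M' ⟨f x, hM' (f x).2⟩

end Varieties

end

end QuadricPencils

/-!
Everything is computed in diagonal coordinates. A nonsingular intersection `X ⊂ ℙ^{n+2}` of two
quadrics has, in suitable linear coordinates, the equations `∑ xⱼ² = 0` and `∑ λⱼ xⱼ² = 0` with
`n + 3` distinct nodes `λⱼ` (`IsNonsingularIntersection.exists_diagonalPresentation`). Likewise a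
nonsingular pencil on `ℂⁿ` is spanned by `∑ yᵢ²` and `∑ tᵢ yᵢ²` with distinct eigenvalues `tᵢ`
(`exists_eq_diagClass`), and its class does not change when all the eigenvalues are translated
(`diagClass_add`).

Differentiating `q (c t) = 0` along arcs of the affine cone shows that the second fundamental form
of `X` at a point `[v]` is spanned by the restrictions of the two quadratic forms to `v^⊥ / v`
(`mem_moduliDomain_iff`, `moduliMap_eq`). Frames of `v^⊥ / v` can locally be chosen to depend polynomially
on `v` (`Presents.exists_frame`), so that the moduli map lifts to a polynomial map to pairs of quadratic
forms. Nonsingularity is an open condition on pairs, by a discriminant (`exists_isOpen_nonsingular`).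
Hence the domain of the moduli map is Zariski open and the moduli map is a morphism
(`Presents.isOpen_moduliDomain`, `Presents.isMorphism_moduliMap`).

By Lagrange interpolation, the two equations say that `xⱼ² = P(λⱼ) / ω'(λⱼ)` for a polynomial `P` of
degree at most `n`, where `ω = ∏ (z - λⱼ)`. If `P` is monic of degree `n` with distinct roots `tᵢ` that
are not nodes, then the second fundamental form is the diagonal pencil with eigenvalues `tᵢ`: the
vectors with coordinates `xⱼ / (λⱼ - tᵢ)` diagonalize it (`DiagonalPresentation.mem_moduliDomain`).
Since every class is given by eigenvalues that avoid the nodes, the moduli map is even surjective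
(`DiagonalPresentation.surjective_moduliMap`).

The lower coefficients of `P` are local holomorphic coordinates on `X`, with inverse
`xⱼ = √(P(λⱼ) / ω'(λⱼ))` (`DiagonalPresentation.exists_projChart`). Two intersections of quadrics are
therefore locally identified by the equality of the polynomials `P`, and this identification
preserves the moduli (`exists_preservesModuli`).

If the nodes of the two intersections agree except for one, `λ₀ ≠ μ`, then this identification is
not projective near a generic `P₀`. Otherwise the branches of the functions `√(P(λⱼ) / P₀(λⱼ))`, with
`λ₀` replaced by `μ`, would be, up to a common factor, linear combinations of those with the nodes
`λⱼ`. On the line `P₀ + s Q` the functions are `√(1 + s Q(λⱼ) / P₀(λⱼ))`, and such functions with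
distinct slopes are linearly independent (`eq_zero_of_sum_sqrt_eq_zero`). Taking
`Q = (z - λₖ)(z - λₗ)`, which has degree less than `n` because `n ≥ 3`, and then `Q = 1`, one finds that
the common factor is constant and then that it vanishes (`false_of_proportional`).
-/

namespace QuadricPencils

noncomputable section

/-! ### Polynomial functions and discriminants -/

section PolynomialFunctions

variable {E F : Type*} [AddCommGroup E] [Module ℂ E] [AddCommGroup F] [Module ℂ F]

theorem dual_mem_polynomialFunctions (l : Module.Dual ℂ E) :
    (fun v => l v) ∈ polynomialFunctions E :=
  Algebra.subset_adjoin ⟨l, rfl⟩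

theorem const_mem_polynomialFunctions (c : ℂ) : (fun _ : E => c) ∈ polynomialFunctions E :=
  (polynomialFunctions E).algebraMap_mem c

/-- Maps between vector spaces whose composition with every linear form is a polynomial function. -/
def IsPolynomialMap (p : E → F) : Prop :=
  ∀ l : Module.Dual ℂ F, (fun v => l (p v)) ∈ polynomialFunctions E

theorem IsPolynomialMap.comp_mem {p : E → F} (hp : IsPolynomialMap p) {P : F → ℂ}
    (hP : P ∈ polynomialFunctions F) : (fun v => P (p v)) ∈ polynomialFunctions E := by
  induction hP using Algebra.adjoin_induction with
  | mem x hx =>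
    obtain ⟨l, rfl⟩ := hx
    exact hp l
  | algebraMap r => exact const_mem_polynomialFunctions r
  | add x y _ _ hx hy => exact add_mem hx hy
  | mul x y _ _ hx hy => exact mul_mem hx hy

theorem IsPolynomialMap.isOpen_preimage {p : E → F} (hp : IsPolynomialMap p) {U : Set F}
    (hU : IsOpen[zariski F] U) : IsOpen[zariski E] (p ⁻¹' U) := by
  have : @Continuous E F (zariski E) (zariski F) p := by
    let := zariski E
    refine continuous_generateFrom_iff.2 ?_
    rintro _ ⟨P, hP, rfl⟩
    exact TopologicalSpace.isOpen_generateFrom_of_mem ⟨_, hp.comp_mem hP, rfl⟩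
  exact @Continuous.isOpen_preimage _ _ (zariski E) (zariski F) _ this _ hU

theorem LinearMap.isPolynomialMap (f : E →ₗ[ℂ] F) : IsPolynomialMap f := fun l =>
  dual_mem_polynomialFunctions (l ∘ₗ f)

theorem isOpen_ne_zero {P : E → ℂ} (hP : P ∈ polynomialFunctions E) :
    IsOpen[zariski E] {v | P v ≠ 0} :=
  TopologicalSpace.isOpen_generateFrom_of_mem ⟨P, hP, rfl⟩

/-- Evaluation of polynomial functions at a point, as a ring homomorphism. -/
def evalAt (e : E) : polynomialFunctions E →+* ℂ :=
  (Pi.evalRingHom (fun _ : E => ℂ) e).comp (polynomialFunctions E).toSubring.subtype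

/-- Having `n` distinct roots is an open condition on the polynomials of degree at most `n`:
the witness `H` is the product of the leading coefficient and the discriminant. -/
theorem exists_discriminant {n : ℕ} (p : Polynomial (polynomialFunctions E)) (hp : p.natDegree ≤ n) :
    ∃ H ∈ polynomialFunctions E, ∀ e : E, H e ≠ 0 ↔
      ((p.map (evalAt e)).natDegree = n ∧ (p.map (evalAt e)).Separable) := by
  refine ⟨(p.coeff n * Polynomial.resultant p p.derivative n (n - 1) : polynomialFunctions E),
    Subtype.prop _, fun e => ?_⟩
  have h1 : ((p.coeff n * Polynomial.resultant p p.derivative n (n - 1) :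
      polynomialFunctions E) : E → ℂ) e = (p.map (evalAt e)).coeff n *
      Polynomial.resultant (p.map (evalAt e)) (p.map (evalAt e)).derivative n (n - 1) := by
    rw [Polynomial.derivative_map, Polynomial.resultant_map_map, Polynomial.coeff_map, ← map_mul]
    rfl
  rw [h1]
  set q := p.map (evalAt e) with hq
  have hqn : q.natDegree ≤ n := Polynomial.natDegree_map_le.trans hp
  have key : q.natDegree = n → (Polynomial.resultant q q.derivative n (n - 1) ≠ 0 ↔
      (q = 0 ∧ q.derivative = 0) ∨ q.Separable) := by
    intro h
    have h2 : q.derivative.natDegree = n - 1 := by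
      rw [← h]
      exact Polynomial.natDegree_derivative q
    have h3 := Polynomial.resultant_eq_zero_iff (f := q) (g := q.derivative)
    rw [h, h2] at h3
    rw [Ne, h3, Polynomial.Separable]
    tauto
  constructor
  · intro h
    obtain ⟨ha, hb⟩ := mul_ne_zero_iff.1 h
    have hn : q.natDegree = n := le_antisymm hqn (Polynomial.le_natDegree_of_ne_zero ha)
    refine ⟨hn, ?_⟩
    rcases (key hn).1 hb with ⟨h0, -⟩ | h0
    · rw [h0] at ha; simp at ha
    · exact h0
  · rintro ⟨hn, hs⟩
    refine mul_ne_zero ?_ ((key hn).2 (Or.inr hs))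
    rw [← hn]
    exact fun h => hs.ne_zero (Polynomial.leadingCoeff_eq_zero.1 h)

/-- The roots of a separable polynomial of degree `n`, indexed by `Fin n`. -/
theorem exists_roots_of_separable {n : ℕ} {p : Polynomial ℂ} (hn : p.natDegree = n)
    (hs : p.Separable) : ∃ t : Fin n → ℂ, Function.Injective t ∧
      p = Polynomial.C p.leadingCoeff * ∏ i, (Polynomial.X - Polynomial.C (t i)) := by
  have hsp := IsAlgClosed.splits p
  have hcard : p.roots.toFinset.card = n := by
    rw [Multiset.toFinset_card_of_nodup (Polynomial.nodup_roots hs), ← hn,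
      hsp.natDegree_eq_card_roots]
  let e := (p.roots.toFinset.equivFin.trans (finCongr hcard)).symm
  refine ⟨fun i => e i, fun i j h => e.injective (Subtype.ext h), ?_⟩
  conv_lhs => rw [hsp.eq_prod_roots]
  congr 1
  rw [e.prod_comp (fun x : p.roots.toFinset => Polynomial.X - Polynomial.C (x : ℂ)),
    Finset.prod_coe_sort p.roots.toFinset (fun x => Polynomial.X - Polynomial.C x),
    Finset.prod_eq_multiset_prod, Multiset.toFinset_val,
    Multiset.Nodup.dedup (Polynomial.nodup_roots hs)]

theorem separable_prod_X_sub_C {n : ℕ} {t : Fin n → ℂ} (ht : Function.Injective t) :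
    (∏ i, (Polynomial.X - Polynomial.C (t i))).Separable :=
  Polynomial.separable_prod_X_sub_C_iff.2 ht

end PolynomialFunctions

/-! ### Simultaneous diagonalization of nonsingular pencils -/

section DiagonalPencils

variable {W : Type*} [AddCommGroup W] [Module ℂ W]

theorem polar_self (q : QuadraticForm ℂ W) (v : W) : QuadraticMap.polar q v v = 2 * q v := by
  rw [QuadraticMap.polar_self, two_smul, two_mul]

theorem quadraticForm_ext_polar {p q : QuadraticForm ℂ W}
    (h : ∀ u v, QuadraticMap.polar p u v = QuadraticMap.polar q u v) : p = q := by
  ext v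
  have := h v v
  rw [polar_self, polar_self] at this
  exact mul_left_cancel₀ two_ne_zero this

theorem quadraticForm_ext_single {n : ℕ} {p q : QuadraticForm ℂ (Fin n → ℂ)}
    (h : ∀ i j, QuadraticMap.polar p (Pi.single i 1) (Pi.single j 1)
      = QuadraticMap.polar q (Pi.single i 1) (Pi.single j 1)) : p = q := by
  have : p.polarBilin = q.polarBilin := by
    refine (Pi.basisFun ℂ (Fin n)).ext fun i => (Pi.basisFun ℂ (Fin n)).ext fun j => ?_
    simpa using h i j
  exact quadraticForm_ext_polar fun u v => congrArg (fun b => b u v) this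

theorem polar_comp_linear {W' : Type*} [AddCommGroup W'] [Module ℂ W'] (q : QuadraticForm ℂ W)
    (f : W' →ₗ[ℂ] W) (u v : W') :
    QuadraticMap.polar (pullback f q) u v = QuadraticMap.polar q (f u) (f v) := by
  simp [QuadraticMap.polar, pullback_apply]

theorem polar_sub_smul (φ ψ : QuadraticForm ℂ W) (t : ℂ) (u v : W) :
    QuadraticMap.polar (ψ - t • φ) u v = QuadraticMap.polar ψ u v - t * QuadraticMap.polar φ u v := by
  simp only [QuadraticMap.polar, sub_apply, smul_apply, smul_eq_mul]
  ring

/-- The diagonal quadratic form `∑ aᵢ yᵢ²`. -/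
def diagForm {n : ℕ} (a : Fin n → ℂ) : QuadraticForm ℂ (Fin n → ℂ) :=
  QuadraticMap.weightedSumSquares ℂ a

theorem diagForm_apply {n : ℕ} (a y : Fin n → ℂ) : diagForm a y = ∑ i, a i * y i ^ 2 := by
  simp [diagForm, QuadraticMap.weightedSumSquares_apply, sq]

theorem polar_diagForm {n : ℕ} (a u v : Fin n → ℂ) :
    QuadraticMap.polar (diagForm a) u v = 2 * ∑ i, a i * (u i * v i) := by
  simp only [QuadraticMap.polar, diagForm_apply, ← Finset.sum_sub_distrib, Finset.mul_sum,
    Pi.add_apply]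
  exact Finset.sum_congr rfl fun i _ => by ring

theorem isDegenerate_diagForm {n : ℕ} {a : Fin n → ℂ} : IsDegenerate (diagForm a) ↔ ∃ i, a i = 0 := by
  constructor
  · rintro ⟨u, hu, h⟩
    obtain ⟨i, hi⟩ := Function.ne_iff.1 hu
    refine ⟨i, ?_⟩
    have := h (Pi.single i 1)
    rw [polar_diagForm, Finset.sum_eq_single i (by intro j _ hj; simp [hj]) (by simp)] at this
    simpa [show u i ≠ 0 from hi] using this
  · rintro ⟨i, hi⟩
    refine ⟨Pi.single i 1, by simp, fun v => ?_⟩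
    rw [polar_diagForm, Finset.sum_eq_single i (by intro j _ hj; simp [hj]) (by simp), hi]
    simp

theorem diagForm_sub_smul {n : ℕ} (a b : Fin n → ℂ) (c : ℂ) :
    diagForm b - c • diagForm a = diagForm (b - c • a) := by
  ext v
  simp only [sub_apply, smul_apply, diagForm_apply, smul_eq_mul, Finset.mul_sum,
    ← Finset.sum_sub_distrib, Pi.sub_apply, Pi.smul_apply]
  exact Finset.sum_congr rfl fun i _ => by ring

theorem not_isDegenerate_zero_iff : ¬ IsDegenerate (0 : QuadraticForm ℂ W) ↔ Subsingleton W := by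
  rw [subsingleton_iff_forall_eq 0]
  simp [IsDegenerate, QuadraticMap.polar]

theorem finrank_span_pair {φ ψ : QuadraticForm ℂ W} (hli : LinearIndependent ℂ ![φ, ψ]) :
    Module.finrank ℂ (Submodule.span ℂ {φ, ψ}) = 2 := by
  have := finrank_span_eq_card hli
  rwa [Matrix.range_cons_cons_empty, Fintype.card_fin] at this

/-- If `φ` is nondegenerate, the pencil spanned by `φ` and `ψ` is nonsingular if and only if
`ψ - t φ` is degenerate for exactly `dim W` values of `t`. -/
theorem isNonsingularPencil_span_iff {φ ψ : QuadraticForm ℂ W} (hφ : ¬ IsDegenerate φ)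
    (hli : LinearIndependent ℂ ![φ, ψ]) :
    IsNonsingularPencil (Submodule.span ℂ {φ, ψ}) ↔
      {t : ℂ | IsDegenerate (ψ - t • φ)}.ncard = Module.finrank ℂ W := by
  have hne : ∀ t : ℂ, ψ - t • φ ≠ 0 := fun t h => by
    have := LinearIndependent.pair_iff.1 hli (-t) 1 (by rw [← h]; module)
    exact one_ne_zero this.2
  let g : ℂ → ℙ ℂ (QuadraticForm ℂ W) := fun t => Projectivization.mk ℂ _ (hne t)
  have hg : Function.Injective g := by
    intro s t h
    obtain ⟨a, ha⟩ := (Projectivization.mk_eq_mk_iff' _ _ _ _ _).1 h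
    have := LinearIndependent.pair_iff.1 hli (s - a * t) (a - 1) (by
      rw [← sub_eq_zero] at ha
      rw [← ha]; module)
    have h1 : a = 1 := sub_eq_zero.1 this.2
    have h2 := this.1
    rw [h1, one_mul, sub_eq_zero] at h2
    exact h2
  have himg : {p : ℙ ℂ (QuadraticForm ℂ W) | p.rep ∈ Submodule.span ℂ {φ, ψ} ∧ IsDegenerate p.rep}
      = g '' {t : ℂ | IsDegenerate (ψ - t • φ)} := by
    ext p
    constructor
    · rintro ⟨hp, hd⟩
      obtain ⟨a, b, hab⟩ := Submodule.mem_span_pair.1 hp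
      have hb : b ≠ 0 := by
        rintro rfl
        rw [zero_smul, add_zero] at hab
        have ha : a ≠ 0 := by
          rintro rfl
          exact p.rep_nonzero (by rw [← hab, zero_smul])
        rw [← hab] at hd
        exact hφ ((isDegenerate_smul_iff (Units.mk0 a ha) φ).1 hd)
      have hrep : b • (ψ - (-a / b) • φ) = p.rep := by
        rw [← hab, smul_sub, smul_smul, mul_div_cancel₀ _ hb]; module
      refine ⟨-a / b, ?_, ?_⟩
      · rw [← hrep] at hd
        exact (isDegenerate_smul_iff (Units.mk0 b hb) _).1 hd
      · conv_rhs => rw [← p.mk_rep]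
        refine (Projectivization.mk_eq_mk_iff' _ _ _ _ _).2 ⟨b⁻¹, ?_⟩
        rw [← hrep, smul_smul, inv_mul_cancel₀ hb, one_smul]
    · rintro ⟨t, ht, rfl⟩
      obtain ⟨a, ha⟩ := Projectivization.exists_smul_eq_mk_rep ℂ _ (hne t)
      change (Projectivization.mk ℂ _ (hne t)).rep ∈ _ ∧ IsDegenerate (Projectivization.mk ℂ _ (hne t)).rep
      rw [← ha, isDegenerate_smul_iff]
      refine ⟨Submodule.smul_of_tower_mem _ _ (sub_mem (Submodule.subset_span (by simp))
        (Submodule.smul_mem _ _ (Submodule.subset_span (by simp)))), ht⟩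
  constructor
  · intro h
    rw [← h.ncard_degenerate, himg, Set.ncard_image_of_injective _ hg]
  · intro h
    refine ⟨?_, ⟨φ, Submodule.subset_span (by simp), hφ⟩, ?_⟩
    · exact finrank_span_pair hli
    · rw [himg, Set.ncard_image_of_injective _ hg, h]

/-- A nonsingular pencil has a basis of which the first member is nondegenerate. -/
theorem IsNonsingularPencil.exists_basis {Φ : Submodule ℂ (QuadraticForm ℂ W)}
    (h : IsNonsingularPencil Φ) : ∃ φ ψ : QuadraticForm ℂ W, ¬ IsDegenerate φ ∧
      LinearIndependent ℂ ![φ, ψ] ∧ Φ = Submodule.span ℂ {φ, ψ} := by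
  obtain ⟨φ, hφ, hd⟩ := h.nondegenerate
  have hfin : FiniteDimensional ℂ Φ := FiniteDimensional.of_finrank_pos (by rw [h.finrank_eq]; norm_num)
  obtain ⟨ψ, hψ, hn⟩ : ∃ ψ ∈ Φ, ψ ∉ Submodule.span ℂ {φ} := by
    by_contra! hc
    have h1 := Submodule.finrank_mono (s := Φ) (t := Submodule.span ℂ {φ}) hc
    have h2 := finrank_span_le_card (R := ℂ) ({φ} : Set (QuadraticForm ℂ W))
    rw [h.finrank_eq] at h1
    simp at h2
    omega
  have hφ0 : φ ≠ 0 := by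
    rintro rfl
    have := not_isDegenerate_zero_iff.1 hd
    refine hn ?_
    have : ψ = 0 := by ext v; rw [Subsingleton.elim v 0]; simp
    simp [this]
  have hli : LinearIndependent ℂ ![φ, ψ] := by
    refine LinearIndependent.pair_iff.2 fun a b hab => ?_
    have hb : b = 0 := by
      by_contra hb
      refine hn (Submodule.mem_span_singleton.2 ⟨-a / b, ?_⟩)
      have : b • ψ = b • ((-a / b) • φ) := by
        rw [smul_smul, mul_div_cancel₀ _ hb, ← sub_eq_zero, ← hab]; module
      exact (smul_right_injective _ hb this).symm
    subst hb
    simpa [hφ0] using hab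
  refine ⟨φ, ψ, hd, hli, (Submodule.eq_of_le_of_finrank_eq ?_ ?_).symm⟩
  · rw [Submodule.span_le]
    rintro x (rfl | rfl) <;> assumption
  · rw [h.finrank_eq]
    exact finrank_span_pair hli

theorem IsNonsingularPencil.map_iff {W' : Type*} [AddCommGroup W'] [Module ℂ W']
    {Φ : Submodule ℂ (QuadraticForm ℂ W)} (e : W' ≃ₗ[ℂ] W) :
    IsNonsingularPencil (Φ.map (pullback (e : W' →ₗ[ℂ] W))) ↔ IsNonsingularPencil Φ := by
  refine ⟨fun h => ?_, fun h => h.map_pullback e⟩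
  have := h.map_pullback e.symm
  rwa [map_pullback_map_pullback, LinearEquiv.comp_coe, LinearEquiv.symm_trans_self,
    LinearEquiv.refl_toLinearMap, map_pullback_id] at this

theorem map_pullback_span_pair {W' : Type*} [AddCommGroup W'] [Module ℂ W']
    (T : W' →ₗ[ℂ] W) (φ ψ : QuadraticForm ℂ W) :
    (Submodule.span ℂ {φ, ψ}).map (pullback T) = Submodule.span ℂ {pullback T φ, pullback T ψ} := by
  rw [Submodule.map_span, Set.image_pair]

variable [FiniteDimensional ℂ W]

/-- The endomorphism that represents `ψ` with respect to a nondegenerate form `φ`. -/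
theorem exists_endomorphism {φ : QuadraticForm ℂ W} (hφ : ¬ IsDegenerate φ)
    (ψ : QuadraticForm ℂ W) :
    ∃ A : Module.End ℂ W, ∀ u v, QuadraticMap.polar ψ u v = QuadraticMap.polar φ (A u) v := by
  have hinj : Function.Injective φ.polarBilin := by
    rw [injective_iff_map_eq_zero]
    intro u hu
    by_contra h0
    exact hφ ⟨u, h0, fun v => congrArg (fun b => b v) hu⟩
  let f : W ≃ₗ[ℂ] Module.Dual ℂ W :=
    LinearMap.linearEquivOfInjective φ.polarBilin hinj Subspace.dual_finrank_eq.symm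
  refine ⟨f.symm.toLinearMap ∘ₗ ψ.polarBilin, fun u v => ?_⟩
  have : f (f.symm (ψ.polarBilin u)) = ψ.polarBilin u := f.apply_symm_apply _
  exact (congrArg (fun b => b v) this).symm

/-- Simultaneous diagonalization: if `φ` is nondegenerate and `ψ - t φ` is degenerate for `dim W`
values of `t`, then the kernels of these forms are orthogonal for `φ` and `ψ` and span `W`. -/
theorem exists_simultaneous_diagonalization {n : ℕ} (hn : Module.finrank ℂ W = n)
    {φ ψ : QuadraticForm ℂ W} (hφ : ¬ IsDegenerate φ) {t : Fin n → ℂ} (ht : Function.Injective t)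
    (hd : ∀ i, IsDegenerate (ψ - t i • φ)) :
    ∃ e : (Fin n → ℂ) ≃ₗ[ℂ] W, pullback (e : (Fin n → ℂ) →ₗ[ℂ] W) φ = diagForm 1 ∧
      pullback (e : (Fin n → ℂ) →ₗ[ℂ] W) ψ = diagForm t := by
  obtain ⟨A, hA⟩ := exists_endomorphism hφ ψ
  choose u hu0 hu using hd
  have hu' : ∀ i v, QuadraticMap.polar ψ (u i) v = t i * QuadraticMap.polar φ (u i) v := fun i v => by
    have := hu i v
    rwa [polar_sub_smul, sub_eq_zero] at this
  have hev : ∀ i, A (u i) = t i • u i := fun i => by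
    by_contra hne
    refine hφ ⟨A (u i) - t i • u i, sub_ne_zero.2 hne, fun v => ?_⟩
    rw [QuadraticMap.polar_sub_left, QuadraticMap.polar_smul_left, ← hA, hu', smul_eq_mul, sub_self]
  have hli : LinearIndependent ℂ u :=
    A.eigenvectors_linearIndependent' t ht u fun i =>
      ⟨Module.End.mem_eigenspace_iff.2 (hev i), hu0 i⟩
  have horth : ∀ i j, i ≠ j → QuadraticMap.polar φ (u i) (u j) = 0 := fun i j hij => by
    have h1 := hu' i (u j)
    have h2 := hu' j (u i)
    rw [QuadraticMap.polar_comm, QuadraticMap.polar_comm φ] at h2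
    have h3 : (t i - t j) * QuadraticMap.polar φ (u i) (u j) = 0 := by
      rw [sub_mul, ← h1, ← h2, sub_self]
    exact (mul_eq_zero.1 h3).resolve_left (sub_ne_zero.2 (ht.ne hij))
  let b := basisOfLinearIndependentOfCardEqFinrank' u hli (by simp [hn])
  have hb : ∀ i, b i = u i := fun i => by simp [b]
  have hne : ∀ i, φ (u i) ≠ 0 := fun i h0 => by
    refine hφ ⟨u i, hu0 i, fun v => ?_⟩
    have : φ.polarBilin (u i) = 0 := b.ext fun j => by
      rw [hb]
      by_cases hij : i = j
      · subst hij
        simp [h0]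
      · simpa using horth i j hij
    exact congrArg (fun b => b v) this
  choose r hr using fun i => IsAlgClosed.exists_pow_nat_eq (φ (u i)) (n := 2) two_pos
  have hr0 : ∀ i, r i ≠ 0 := fun i h => hne i (by rw [← hr, h]; simp)
  let b' := b.unitsSMul fun i => (Units.mk0 (r i) (hr0 i))⁻¹
  have hb' : ∀ i, b' i = (r i)⁻¹ • u i := fun i => by
    simp only [b', Module.Basis.unitsSMul_apply, hb]
    rfl
  have he : ∀ i, b'.equivFun.symm (Pi.single i 1) = (r i)⁻¹ • u i := fun i => by
    rw [← hb', Module.Basis.equivFun_symm_apply, Finset.sum_eq_single i (by intro j _ hj; simp [hj]) (by simp)]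
    simp
  have hpol : ∀ i j, QuadraticMap.polar φ ((r i)⁻¹ • u i) ((r j)⁻¹ • u j) = if i = j then 2 else 0 := by
    intro i j
    rw [QuadraticMap.polar_smul_left, QuadraticMap.polar_smul_right, smul_eq_mul, smul_eq_mul]
    split_ifs with hij
    · subst hij
      rw [polar_self, ← hr]
      have := hr0 i
      field_simp
    · rw [horth i j hij, mul_zero, mul_zero]
  refine ⟨b'.equivFun.symm, quadraticForm_ext_single fun i j => ?_,
    quadraticForm_ext_single fun i j => ?_⟩
  · rw [polar_comp_linear, polar_diagForm, LinearEquiv.coe_coe, he, he, hpol,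
      Finset.sum_eq_single i (by intro k _ hk; simp [hk]) (by simp)]
    simp [Pi.single_apply]
  · rw [polar_comp_linear, polar_diagForm, LinearEquiv.coe_coe, he, he,
      QuadraticMap.polar_smul_left, hu', smul_eq_mul, mul_left_comm, ← smul_eq_mul (r i)⁻¹,
      ← QuadraticMap.polar_smul_left, hpol,
      Finset.sum_eq_single i (by intro k _ hk; simp [hk]) (by simp)]
    simp [Pi.single_apply, mul_comm]

end DiagonalPencils

/-! ### Diagonal representatives of moduli classes -/

section DiagonalClasses

theorem linearIndependent_diagForm {n : ℕ} (hn : 2 ≤ n) {t : Fin n → ℂ} (ht : Function.Injective t) :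
    LinearIndependent ℂ ![diagForm 1, diagForm t] := by
  refine LinearIndependent.pair_iff.2 fun a b h => ?_
  have key : ∀ i, a + b * t i = 0 := fun i => by
    have := DFunLike.congr_fun h (Pi.single i 1)
    simp only [add_apply, smul_apply, diagForm_apply, smul_eq_mul, zero_apply] at this
    rw [Finset.sum_eq_single i (by intro k _ hk; simp [hk]) (by simp),
      Finset.sum_eq_single i (by intro k _ hk; simp [hk]) (by simp)] at this
    simpa using this
  have h0 := key ⟨0, by omega⟩
  have h1 := key ⟨1, by omega⟩
  have hne : t ⟨0, by omega⟩ - t ⟨1, by omega⟩ ≠ 0 := sub_ne_zero.2 (ht.ne (by simp))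
  have hb : b = 0 := by
    have : b * (t ⟨0, by omega⟩ - t ⟨1, by omega⟩) = 0 := by linear_combination h0 - h1
    exact (mul_eq_zero.1 this).resolve_right hne
  subst hb
  exact ⟨by simpa using h0, rfl⟩

theorem not_isDegenerate_diagForm_one {n : ℕ} : ¬ IsDegenerate (diagForm (1 : Fin n → ℂ)) := by
  rw [isDegenerate_diagForm]
  simp

/-- A diagonal pencil with distinct eigenvalues is nonsingular. -/
theorem isNonsingularPencil_diagForm {n : ℕ} (hn : 2 ≤ n) {t : Fin n → ℂ}
    (ht : Function.Injective t) :
    IsNonsingularPencil (Submodule.span ℂ {diagForm 1, diagForm t}) := by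
  rw [isNonsingularPencil_span_iff not_isDegenerate_diagForm_one (linearIndependent_diagForm hn ht)]
  have : {c : ℂ | IsDegenerate (diagForm t - c • diagForm 1)} = Set.range t := by
    ext c
    simp [diagForm_sub_smul, isDegenerate_diagForm, sub_eq_zero]
  rw [this, ← Set.image_univ, Set.ncard_image_of_injective _ ht, Set.ncard_univ]
  simp

variable {W : Type*} [AddCommGroup W] [Module ℂ W]

/-- If `φ` is nondegenerate and `ψ - t φ` is degenerate for `dim W ≥ 2` values of `t`, then `φ` and
`ψ` span a nonsingular pencil. -/
theorem isNonsingularPencil_of_injective [FiniteDimensional ℂ W] {n : ℕ} (hn : 2 ≤ n) (hW : Module.finrank ℂ W = n)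
    {φ ψ : QuadraticForm ℂ W} (hφ : ¬ IsDegenerate φ) {t : Fin n → ℂ} (ht : Function.Injective t)
    (hd : ∀ i, IsDegenerate (ψ - t i • φ)) : IsNonsingularPencil (Submodule.span ℂ {φ, ψ}) := by
  obtain ⟨e, h1, h2⟩ := exists_simultaneous_diagonalization hW hφ ht hd
  rw [← IsNonsingularPencil.map_iff e, map_pullback_span_pair, h1, h2]
  exact isNonsingularPencil_diagForm hn ht

theorem IsNonsingularPencil.exists_eigenvalues {n : ℕ} (hW : Module.finrank ℂ W = n)
    {Φ : Submodule ℂ (QuadraticForm ℂ W)} (h : IsNonsingularPencil Φ) :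
    ∃ φ ψ : QuadraticForm ℂ W, ¬ IsDegenerate φ ∧ Φ = Submodule.span ℂ {φ, ψ} ∧
      ∃ t : Fin n → ℂ, Function.Injective t ∧ ∀ i, IsDegenerate (ψ - t i • φ) := by
  obtain ⟨φ, ψ, hd, hli, rfl⟩ := h.exists_basis
  refine ⟨φ, ψ, hd, rfl, ?_⟩
  have hcard := (isNonsingularPencil_span_iff hd hli).1 h
  rw [hW] at hcard
  rcases Nat.eq_zero_or_pos n with rfl | hpos
  · exact ⟨Fin.elim0, fun i => i.elim0, fun i => i.elim0⟩
  · have hfin := Set.finite_of_ncard_pos (hcard.symm ▸ hpos)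
    rw [Set.ncard_eq_toFinset_card _ hfin] at hcard
    let e := (hfin.toFinset.equivFin.trans (finCongr hcard)).symm
    exact ⟨fun i => e i, fun i j hij => e.injective (Subtype.ext hij), fun i =>
      hfin.mem_toFinset.1 (e i).2⟩

/-- The class of the diagonal pencil with eigenvalues `tᵢ`. -/
def diagClass {n : ℕ} (hn : 2 ≤ n) (t : Fin n → ℂ) (ht : Function.Injective t) : PQ n :=
  Quotient.mk (pencilSetoid n) ⟨_, isNonsingularPencil_diagForm hn ht⟩

theorem exists_eq_diagClass {n : ℕ} (hn : 2 ≤ n) (c : PQ n) :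
    ∃ t : Fin n → ℂ, ∃ ht : Function.Injective t, c = diagClass hn t ht := by
  obtain ⟨⟨Φ, hΦ⟩, rfl⟩ := Quotient.exists_rep c
  obtain ⟨φ, ψ, hd, hspan, t, ht, hdeg⟩ := hΦ.exists_eigenvalues (n := n) (by simp)
  obtain ⟨e, h1, h2⟩ := exists_simultaneous_diagonalization (by simp) hd ht hdeg
  refine ⟨t, ht, Quotient.sound ⟨e, ?_⟩⟩
  change _ = Φ.map _
  rw [hspan, map_pullback_span_pair, h1, h2]

/-- A translation of the eigenvalues changes the basis of the pencil only. -/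
theorem diagClass_add {n : ℕ} (hn : 2 ≤ n) (t : Fin n → ℂ) (ht : Function.Injective t) (c : ℂ)
    (ht' : Function.Injective fun i => t i + c) :
    diagClass hn (fun i => t i + c) ht' = diagClass hn t ht := by
  have : diagForm (fun i => t i + c) = diagForm t + c • diagForm 1 := by
    ext v
    simp only [add_apply, smul_apply, diagForm_apply, smul_eq_mul, Finset.mul_sum,
      ← Finset.sum_add_distrib]
    exact Finset.sum_congr rfl fun i _ => by simp; ring
  unfold diagClass
  congr 2
  rw [this]
  refine le_antisymm (Submodule.span_le.2 ?_) (Submodule.span_le.2 ?_)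
  · rintro x (rfl | rfl)
    · exact Submodule.subset_span (by simp)
    · exact Submodule.mem_span_pair.2 ⟨c, 1, by module⟩
  · rintro x (rfl | rfl)
    · exact Submodule.subset_span (by simp)
    · exact Submodule.mem_span_pair.2 ⟨-c, 1, by module⟩

end DiagonalClasses

/-! ### Openness of nonsingularity -/

section Openness

variable {n : ℕ}

/-- The Gram matrix of the polar form in the standard basis. -/
def gram (φ : QuadraticForm ℂ (Fin n → ℂ)) : Matrix (Fin n) (Fin n) ℂ :=
  fun i j => QuadraticMap.polar φ (Pi.single i 1) (Pi.single j 1)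

theorem gram_sub_smul (φ ψ : QuadraticForm ℂ (Fin n → ℂ)) (t : ℂ) :
    gram (ψ - t • φ) = gram ψ - t • gram φ := by
  ext i j
  exact polar_sub_smul φ ψ t _ _

theorem isDegenerate_iff_det (φ : QuadraticForm ℂ (Fin n → ℂ)) :
    IsDegenerate φ ↔ (gram φ).det = 0 := by
  rw [← Matrix.exists_vecMul_eq_zero_iff]
  refine exists_congr fun u => and_congr_right fun _ => ?_
  have h1 : ∀ j, (Matrix.vecMul u (gram φ)) j = φ.polarBilin u (Pi.single j 1) := fun j => by
    conv_rhs => rw [← Finset.univ_sum_single u]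
    simp only [map_sum, LinearMap.sum_apply, Matrix.vecMul, dotProduct, gram]
    refine Finset.sum_congr rfl fun i _ => ?_
    have : Pi.single i (u i) = u i • (Pi.single i 1 : Fin n → ℂ) := by
      rw [← Pi.single_smul, smul_eq_mul, mul_one]
    rw [this, map_smul]
    simp
  constructor
  · intro h
    ext j
    rw [h1]
    exact h _
  · intro h v
    have : φ.polarBilin u = 0 := (Pi.basisFun ℂ (Fin n)).ext fun j => by
      rw [Pi.basisFun_apply, ← h1, h]; rfl
    exact congrArg (fun b => b v) this

theorem map_evalAt_det {E : Type*} [AddCommGroup E] [Module ℂ E]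
    (A : Matrix (Fin n) (Fin n) (Polynomial (polynomialFunctions E))) (e : E) :
    A.det.map (evalAt e) = (A.map (Polynomial.map (evalAt e))).det :=
  RingHom.map_det (Polynomial.mapRingHom (evalAt e)) A

/-- The spanning pairs of nonsingular pencils form a Zariski open set.  On it, for some basis
`(φ, ψ)` of the pencil, `det (t φ - ψ)` is a polynomial in `t` with `n` distinct roots. -/
theorem exists_isOpen_nonsingular (hn : 2 ≤ n) :
    ∃ Ω : Set (QuadraticForm ℂ (Fin n → ℂ) × QuadraticForm ℂ (Fin n → ℂ)),
      IsOpen[zariski _] Ω ∧ ∀ p, p ∈ Ω ↔ IsNonsingularPencil (Submodule.span ℂ {p.1, p.2}) := by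
  classical
  let Q2 := QuadraticForm ℂ (Fin n → ℂ) × QuadraticForm ℂ (Fin n → ℂ)
  let polarAt : Fin n → Fin n → (QuadraticForm ℂ (Fin n → ℂ) →ₗ[ℂ] ℂ) := fun i j =>
    { toFun := fun φ => gram φ i j
      map_add' := fun φ ψ => by simp [gram, QuadraticMap.polar_add]
      map_smul' := fun c φ => by simp [gram, QuadraticMap.polar_smul] }
  let A : Matrix (Fin n) (Fin n) (polynomialFunctions Q2) := fun i j =>
    ⟨_, dual_mem_polynomialFunctions (polarAt i j ∘ₗ LinearMap.fst ℂ _ _)⟩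
  let B : Matrix (Fin n) (Fin n) (polynomialFunctions Q2) := fun i j =>
    ⟨_, dual_mem_polynomialFunctions (-(polarAt i j ∘ₗ LinearMap.snd ℂ _ _))⟩
  let p : Polynomial (polynomialFunctions Q2) :=
    ((Polynomial.X : Polynomial (polynomialFunctions Q2)) • A.map Polynomial.C + B.map Polynomial.C).det
  obtain ⟨H, hH, hdisc⟩ := exists_discriminant (n := n) p
    (by simpa using Polynomial.natDegree_det_X_add_C_le A B)
  have hmap : ∀ e : Q2, p.map (evalAt e) = ((Polynomial.X : Polynomial ℂ) • (gram e.1).map Polynomial.C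
      + (-gram e.2).map Polynomial.C).det := fun e => by
    refine (map_evalAt_det _ _).trans ?_
    congr 1
    ext1 i j
    have hA : evalAt e (A i j) = gram e.1 i j := rfl
    have hB : evalAt e (B i j) = -gram e.2 i j := rfl
    simp [hA, hB]
  have heval : ∀ (e : Q2) (t : ℂ), (p.map (evalAt e)).eval t = 0 ↔ IsDegenerate (e.2 - t • e.1) :=
    fun e t => by
      rw [hmap, isDegenerate_iff_det, gram_sub_smul, ← Polynomial.coe_evalRingHom, RingHom.map_det]
      have : (Polynomial.evalRingHom t).mapMatrix
          ((Polynomial.X : Polynomial ℂ) • (gram e.1).map Polynomial.C + (-gram e.2).map Polynomial.C)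
          = -(gram e.2 - t • gram e.1) := by
        ext1 i j
        simp
        ring
      rw [this, Matrix.det_neg]
      simp
  have hcoeff : ∀ e : Q2, (p.map (evalAt e)).coeff n = (gram e.1).det := fun e => by
    rw [hmap]
    simpa using Polynomial.coeff_det_X_add_C_card (gram e.1) (-gram e.2)
  have hnonsing : ∀ e : Q2, H e ≠ 0 → IsNonsingularPencil (Submodule.span ℂ {e.1, e.2}) := by
    intro e he
    obtain ⟨hdeg, hsep⟩ := (hdisc e).1 he
    obtain ⟨t, ht, hprod⟩ := exists_roots_of_separable hdeg hsep
    refine isNonsingularPencil_of_injective hn (by simp) ?_ ht fun i => ?_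
    · rw [isDegenerate_iff_det, ← hcoeff]
      have := Polynomial.leadingCoeff_eq_zero.not.2 hsep.ne_zero
      rwa [Polynomial.leadingCoeff, hdeg] at this
    · rw [← heval, hprod, Polynomial.eval_mul, Polynomial.eval_prod,
        Finset.prod_eq_zero (Finset.mem_univ i) (by simp), mul_zero]
  have hconv : ∀ e : Q2, ¬ IsDegenerate e.1 → (∃ t : Fin n → ℂ, Function.Injective t ∧
      ∀ i, IsDegenerate (e.2 - t i • e.1)) → H e ≠ 0 := by
    rintro e hd ⟨t, ht, hdeg⟩
    rw [isDegenerate_iff_det, ← hcoeff] at hd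
    have hne : p.map (evalAt e) ≠ 0 := by
      rintro h
      rw [h] at hd
      simp at hd
    have hdeg' : (p.map (evalAt e)).natDegree = n := le_antisymm
      (Polynomial.natDegree_map_le.trans (by simpa using Polynomial.natDegree_det_X_add_C_le A B))
      (Polynomial.le_natDegree_of_ne_zero hd)
    refine (hdisc e).2 ⟨hdeg', ?_⟩
    have hsub : Finset.univ.image t ⊆ (p.map (evalAt e)).roots.toFinset := by
      intro x hx
      obtain ⟨i, -, rfl⟩ := Finset.mem_image.1 hx
      rw [Multiset.mem_toFinset, Polynomial.mem_roots hne]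
      exact (heval e (t i)).2 (hdeg i)
    have hle := Finset.card_le_card hsub
    rw [Finset.card_image_of_injective _ ht, Finset.card_univ, Fintype.card_fin] at hle
    have hroots := Polynomial.card_roots' (p.map (evalAt e))
    have hnodup : (p.map (evalAt e)).roots.Nodup := by
      rw [← Multiset.toFinset_card_eq_card_iff_nodup]
      exact le_antisymm (Multiset.toFinset_card_le _) (hroots.trans (hdeg'.le.trans hle))
    exact (Polynomial.nodup_roots_iff_of_splits hne (IsAlgClosed.splits _)).1 hnodup
  let change : ℂ → ℂ → ℂ → ℂ → (Q2 →ₗ[ℂ] Q2) := fun a b c d =>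
    LinearMap.prod (a • LinearMap.fst ℂ _ _ + b • LinearMap.snd ℂ _ _)
      (c • LinearMap.fst ℂ _ _ + d • LinearMap.snd ℂ _ _)
  refine ⟨⋃ (a : ℂ) (b : ℂ) (c : ℂ) (d : ℂ), {e | H (change a b c d e) ≠ 0}, ?_, fun e => ?_⟩
  · let := zariski Q2
    refine isOpen_iUnion fun a => isOpen_iUnion fun b => isOpen_iUnion fun c => isOpen_iUnion fun d => ?_
    exact isOpen_ne_zero ((LinearMap.isPolynomialMap (change a b c d)).comp_mem hH)
  · simp only [Set.mem_iUnion, Set.mem_ofPred_eq]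
    constructor
    · rintro ⟨a, b, c, d, h⟩
      have h1 := hnonsing _ h
      have hle : Submodule.span ℂ {(change a b c d e).1, (change a b c d e).2}
          ≤ Submodule.span ℂ {e.1, e.2} := by
        rw [Submodule.span_le]
        rintro x (rfl | rfl)
        · exact Submodule.mem_span_pair.2 ⟨a, b, rfl⟩
        · exact Submodule.mem_span_pair.2 ⟨c, d, rfl⟩
      have hfin : FiniteDimensional ℂ (Submodule.span ℂ {e.1, e.2}) :=
        FiniteDimensional.span_of_finite ℂ (by simp)
      rwa [Submodule.eq_of_le_of_finrank_le hle] at h1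
      rw [h1.finrank_eq]
      refine (finrank_span_le_card _).trans ?_
      rw [← Set.ncard_eq_toFinset_card']
      exact (Set.ncard_insert_le _ _).trans (by simp)
    · intro h
      obtain ⟨φ, ψ, hd, hspan, ht⟩ := h.exists_eigenvalues (n := n) (by simp)
      have hφ : φ ∈ Submodule.span ℂ {e.1, e.2} := hspan ▸ Submodule.subset_span (by simp)
      have hψ : ψ ∈ Submodule.span ℂ {e.1, e.2} := hspan ▸ Submodule.subset_span (by simp)
      obtain ⟨a, b, rfl⟩ := Submodule.mem_span_pair.1 hφ
      obtain ⟨c, d, rfl⟩ := Submodule.mem_span_pair.1 hψ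
      exact ⟨a, b, c, d, hconv _ hd ht⟩

end Openness

/-! ### Arcs in the cone over an intersection of quadrics -/

section Arcs

variable {V : Type*} [NormedAddCommGroup V] [NormedSpace ℂ V]

/-- The quadratic forms `q₁`, `q₂` present `X` as a nonsingular intersection of two quadrics. -/
structure Presents (q₁ q₂ : QuadraticForm ℂ V) (X : Set (ℙ ℂ V)) : Prop where
  eq : X = {x | q₁ x.rep = 0 ∧ q₂ x.rep = 0}
  smooth : ∀ x ∈ X, LinearIndependent ℂ ![q₁.polarBilin x.rep, q₂.polarBilin x.rep]

theorem map_smul_eq_zero_iff (q : QuadraticForm ℂ V) (a : ℂˣ) (v : V) : q (a • v) = 0 ↔ q v = 0 := by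
  rw [Units.smul_def, QuadraticMap.map_smul]
  simp

theorem mem_cone_rep {S : Set (ℙ ℂ V)} {x : ℙ ℂ V} (hx : x ∈ S) : x.rep ∈ cone S :=
  ⟨x.rep_nonzero, by rwa [x.mk_rep]⟩

theorem cone_mono {S T : Set (ℙ ℂ V)} (h : S ⊆ T) : cone S ⊆ cone T :=
  fun _ hv => ⟨hv.fst, h hv.snd⟩

variable {q₁ q₂ : QuadraticForm ℂ V} {X : Set (ℙ ℂ V)}

theorem Presents.mem_cone_iff (h : Presents q₁ q₂ X) {v : V} :
    v ∈ cone X ↔ v ≠ 0 ∧ q₁ v = 0 ∧ q₂ v = 0 := by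
  have key : ∀ hv : v ≠ 0, Projectivization.mk ℂ v hv ∈ X ↔ q₁ v = 0 ∧ q₂ v = 0 := fun hv => by
    obtain ⟨a, ha⟩ := Projectivization.exists_smul_eq_mk_rep ℂ v hv
    rw [h.eq, Set.mem_ofPred_eq, ← ha, map_smul_eq_zero_iff, map_smul_eq_zero_iff]
  exact ⟨fun ⟨hv, hm⟩ => ⟨hv, (key hv).1 hm⟩, fun ⟨hv, hm⟩ => ⟨hv, (key hv).2 hm⟩⟩

theorem Presents.linearIndependent (h : Presents q₁ q₂ X) {v : V} (hv : v ∈ cone X) :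
    LinearIndependent ℂ ![q₁.polarBilin v, q₂.polarBilin v] := by
  obtain ⟨hv, hm⟩ := hv
  obtain ⟨a, ha⟩ := Projectivization.exists_smul_eq_mk_rep ℂ v hv
  have := h.smooth _ hm
  rw [← ha] at this
  rw [LinearIndependent.pair_iff] at this ⊢
  intro s t hst
  refine this s t ?_
  rw [Units.smul_def, map_smul, map_smul, smul_comm s, smul_comm t, ← smul_add, hst, smul_zero]

theorem exists_dual_pair {f g : V →ₗ[ℂ] ℂ} (h : LinearIndependent ℂ ![f, g]) :
    ∃ a b : V, f a = 1 ∧ g a = 0 ∧ f b = 0 ∧ g b = 1 := by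
  have key : ∀ {f g : V →ₗ[ℂ] ℂ}, LinearIndependent ℂ ![f, g] → ∃ a, f a = 1 ∧ g a = 0 := by
    intro f g h
    by_contra! hc
    have hle : ⨅ _ : Unit, LinearMap.ker g ≤ LinearMap.ker f := by
      intro a ha
      simp only [ciInf_const, LinearMap.mem_ker] at ha ⊢
      by_contra hfa
      refine hc ((f a)⁻¹ • a) ?_ ?_
      · simp [hfa]
      · simp [ha]
    have hmem := mem_span_of_iInf_ker_le_ker (L := fun _ : Unit => g) hle
    rw [Set.range_const, Submodule.mem_span_singleton] at hmem
    obtain ⟨c, hc⟩ := hmem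
    have := LinearIndependent.pair_iff.1 h 1 (-c) (by rw [← hc]; module)
    exact one_ne_zero this.1
  obtain ⟨a, ha, ha'⟩ := key h
  obtain ⟨b, hb, hb'⟩ := key (LinearIndependent.pair_symm_iff.1 h)
  exact ⟨a, b, ha, ha', hb', hb⟩

theorem isOpen_cone {U : Set (ℙ ℂ V)} (hU : IsOpen U) : IsOpen (cone U) := by
  have h1 : IsOpen ((Projectivization.mk' ℂ : {v : V // v ≠ 0} → ℙ ℂ V) ⁻¹' U) := hU
  have h2 : cone U = Subtype.val '' ((Projectivization.mk' ℂ : {v : V // v ≠ 0} → ℙ ℂ V) ⁻¹' U) := by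
    ext v
    constructor
    · rintro ⟨hv, hm⟩
      exact ⟨⟨v, hv⟩, hm, rfl⟩
    · rintro ⟨⟨v, hv⟩, hm, rfl⟩
      exact ⟨hv, hm⟩
  rw [h2]
  exact (isOpen_ne.isOpenEmbedding_subtypeVal).isOpenMap _ h1

theorem mem_cone_inter {S T : Set (ℙ ℂ V)} {v : V} : v ∈ cone (S ∩ T) ↔ v ∈ cone S ∧ v ∈ cone T :=
  ⟨fun h => ⟨⟨h.fst, h.snd.1⟩, ⟨h.fst, h.snd.2⟩⟩, fun h => ⟨h.1.fst, h.1.snd, h.2.snd⟩⟩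

variable [FiniteDimensional ℂ V]

/-- The polar form as a continuous bilinear map. -/
def polarCLM (q : QuadraticForm ℂ V) : V →L[ℂ] V →L[ℂ] ℂ :=
  LinearMap.toContinuousLinearMap
    ((LinearMap.toContinuousLinearMap : (V →ₗ[ℂ] ℂ) ≃ₗ[ℂ] (V →L[ℂ] ℂ)).toLinearMap ∘ₗ q.polarBilin)

theorem polarCLM_apply (q : QuadraticForm ℂ V) (u v : V) :
    polarCLM q u v = QuadraticMap.polar q u v := rfl

theorem quadraticForm_eq_polarCLM (q : QuadraticForm ℂ V) :
    (q : V → ℂ) = fun v => (1 / 2 : ℂ) * polarCLM q v v := by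
  ext v
  rw [polarCLM_apply, polar_self]
  ring

theorem contDiff_quadraticForm (q : QuadraticForm ℂ V) {n : WithTop ℕ∞} :
    ContDiff ℂ n (q : V → ℂ) := by
  rw [quadraticForm_eq_polarCLM]
  fun_prop

theorem hasFDerivAt_quadraticForm (q : QuadraticForm ℂ V) (v : V) :
    HasFDerivAt (q : V → ℂ) (polarCLM q v) v := by
  rw [quadraticForm_eq_polarCLM]
  have h := ((polarCLM q).hasFDerivAt_of_bilinear (hasFDerivAt_id v) (hasFDerivAt_id v)).const_mul
    (1 / 2 : ℂ)
  refine h.congr_fderiv ?_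
  ext u
  simp only [smul_apply, add_apply, ContinuousLinearMap.precompR_apply,
    ContinuousLinearMap.precompL_apply, ContinuousLinearMap.compL_apply,
    ContinuousLinearMap.comp_apply, ContinuousLinearMap.id_apply, id, polarCLM_apply, smul_eq_mul]
  rw [QuadraticMap.polar_comm q u v]
  ring

theorem hasDerivAt_quadraticForm_comp (q : QuadraticForm ℂ V) {c : ℂ → V} {u : V} {t : ℂ}
    (hc : HasDerivAt c u t) : HasDerivAt (fun s => q (c s)) (QuadraticMap.polar q (c t) u) t :=
  (hasFDerivAt_quadraticForm q (c t)).comp_hasDerivAt t hc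

theorem hasDerivAt_polar (q : QuadraticForm ℂ V) {c w : ℂ → V} {u z : V} {t : ℂ}
    (hc : HasDerivAt c u t) (hw : HasDerivAt w z t) :
    HasDerivAt (fun s => QuadraticMap.polar q (c s) (w s))
      (QuadraticMap.polar q (c t) z + QuadraticMap.polar q u (w t)) t := by
  have := ((polarCLM q).hasFDerivAt_of_bilinear hc.hasFDerivAt hw.hasFDerivAt).hasDerivAt
  refine this.congr_deriv ?_
  simp [polarCLM_apply]

/-- Every vector annihilated by the differentials of both quadratic forms is the velocity of a
holomorphic arc.  The arc `v + t u + α(t) a + β(t) b`, with `a`, `b` dual to the differentials,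
comes from the inverse function theorem. -/
theorem exists_isArc (h : Presents q₁ q₂ X) {U : Set (ℙ ℂ V)} (hU : IsOpen U) {v u : V}
    (hv : v ∈ cone (X ∩ U)) (h₁ : QuadraticMap.polar q₁ v u = 0) (h₂ : QuadraticMap.polar q₂ v u = 0) :
    ∃ c : ℂ → V, IsArc (X ∩ U) c ∧ c 0 = v ∧ HasDerivAt c u 0 := by
  obtain ⟨hvX, hvU⟩ := mem_cone_inter.1 hv
  obtain ⟨-, hv₁, hv₂⟩ := h.mem_cone_iff.1 hvX
  obtain ⟨a, b, ha₁, ha₂, hb₁, hb₂⟩ := exists_dual_pair (h.linearIndependent hvX)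
  simp only [QuadraticMap.polarBilin_apply_apply] at ha₁ ha₂ hb₁ hb₂
  let L : ℂ × (ℂ × ℂ) →L[ℂ] V :=
    (ContinuousLinearMap.fst ℂ ℂ (ℂ × ℂ)).smulRight u +
    (((ContinuousLinearMap.fst ℂ ℂ ℂ).comp (ContinuousLinearMap.snd ℂ ℂ (ℂ × ℂ))).smulRight a +
      ((ContinuousLinearMap.snd ℂ ℂ ℂ).comp (ContinuousLinearMap.snd ℂ ℂ (ℂ × ℂ))).smulRight b)
  let w : ℂ × (ℂ × ℂ) → V := fun p => v + L p
  have hw : ∀ p, HasFDerivAt w L p := fun p => L.hasFDerivAt.const_add v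
  have hw0 : w 0 = v := by simp [w]
  let g : ℂ × (ℂ × ℂ) → ℂ × (ℂ × ℂ) := fun p => (p.1, (q₁ (w p), q₂ (w p)))
  have hgc : ContDiff ℂ ⊤ g := by
    have hwc : ContDiff ℂ ⊤ w := contDiff_const.add L.contDiff
    exact contDiff_fst.prodMk (((contDiff_quadraticForm q₁).comp hwc).prodMk
      ((contDiff_quadraticForm q₂).comp hwc))
  have hg' : HasFDerivAt g ((ContinuousLinearEquiv.refl ℂ (ℂ × (ℂ × ℂ)) :
      ℂ × (ℂ × ℂ) →L[ℂ] ℂ × (ℂ × ℂ))) 0 := by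
    have e₁ := (hasFDerivAt_quadraticForm q₁ (w 0)).comp 0 (hw 0)
    have e₂ := (hasFDerivAt_quadraticForm q₂ (w 0)).comp 0 (hw 0)
    have e₃ : HasFDerivAt (fun p : ℂ × (ℂ × ℂ) => p.1) (ContinuousLinearMap.fst ℂ ℂ (ℂ × ℂ)) 0 :=
      hasFDerivAt_fst
    refine (e₃.prodMk (e₁.prodMk e₂)).congr_fderiv ?_
    rw [hw0]
    ext <;> simp [L, polarCLM_apply, h₁, h₂, ha₁, ha₂, hb₁, hb₂]
  have hstrict := hgc.contDiffAt.hasStrictFDerivAt' hg' (by simp)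
  have hg0 : g 0 = 0 := by simp [g, hw0, hv₁, hv₂]
  let k := hgc.contDiffAt.localInverse hg' (by simp)
  have hk0 : k 0 = 0 := by
    have := hgc.contDiffAt.localInverse_apply_image hg' (by simp)
    rwa [hg0] at this
  have hkc : ContDiffAt ℂ ⊤ k 0 := by
    have := hgc.contDiffAt.to_localInverse hg' (by simp)
    rwa [hg0] at this
  have hk' : HasFDerivAt k (ContinuousLinearMap.id ℂ (ℂ × (ℂ × ℂ))) 0 := by
    have := hstrict.to_localInverse.hasFDerivAt
    rw [hg0] at this
    exact this
  have hinv : ∀ᶠ y in 𝓝 (0 : ℂ × (ℂ × ℂ)), g (k y) = y := by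
    have := hstrict.eventually_right_inverse
    rwa [hg0] at this
  let j : ℂ →L[ℂ] ℂ × (ℂ × ℂ) := ContinuousLinearMap.inl ℂ ℂ (ℂ × ℂ)
  have hj0 : j 0 = 0 := map_zero j
  let c : ℂ → V := fun t => w (k (j t))
  have hc0 : c 0 = v := by simp only [c, hj0, hk0, hw0]
  have hcd : HasDerivAt c u 0 := by
    have e₁ : HasFDerivAt k (ContinuousLinearMap.id ℂ (ℂ × (ℂ × ℂ))) (j 0) := hj0.symm ▸ hk'
    have := ((hw (k (j 0))).comp (0 : ℂ) (e₁.comp (0 : ℂ) j.hasFDerivAt)).hasDerivAt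
    refine this.congr_deriv ?_
    simp [L, j]
  have hcc : ContDiffAt ℂ ⊤ c 0 := by
    have hwc : ContDiff ℂ ⊤ w := contDiff_const.add L.contDiff
    refine hwc.contDiffAt.comp (0 : ℂ) ?_
    exact ContDiffAt.comp (0 : ℂ) (hj0.symm ▸ hkc) j.contDiff.contDiffAt
  refine ⟨c, ⟨hcc.analyticAt, ?_⟩, hc0, hcd⟩
  have hev : ∀ᶠ t in 𝓝 (0 : ℂ), g (k (j t)) = j t :=
    (j.continuous.tendsto' 0 0 hj0).eventually hinv
  have hcU : ∀ᶠ t in 𝓝 (0 : ℂ), c t ∈ cone U := by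
    refine hcd.continuousAt.eventually ?_
    rw [hc0]
    exact (isOpen_cone hU).mem_nhds hvU
  filter_upwards [hev, hcU] with t ht htU
  have h2 := congrArg Prod.snd ht
  refine mem_cone_inter.2 ⟨h.mem_cone_iff.2 ⟨htU.fst, ?_, ?_⟩, htU⟩
  · exact congrArg Prod.fst h2
  · exact congrArg Prod.snd h2

end Arcs

/-! ### The second fundamental form of an intersection of quadrics -/

section SecondFundamentalForm

variable {V : Type*} [NormedAddCommGroup V] [NormedSpace ℂ V]

/-- The common kernel of the differentials of two quadratic forms at `v`. -/
def tangentKer (q₁ q₂ : QuadraticForm ℂ V) (v : V) : Submodule ℂ V :=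
  LinearMap.ker (q₁.polarBilin v) ⊓ LinearMap.ker (q₂.polarBilin v)

theorem mem_tangentKer {q₁ q₂ : QuadraticForm ℂ V} {v u : V} :
    u ∈ tangentKer q₁ q₂ v ↔ QuadraticMap.polar q₁ v u = 0 ∧ QuadraticMap.polar q₂ v u = 0 :=
  Iff.rfl

variable {q₁ q₂ : QuadraticForm ℂ V} {X : Set (ℙ ℂ V)}

theorem Presents.arc_eventually (h : Presents q₁ q₂ X) {M : Set (ℙ ℂ V)} (hM : M ⊆ X) {c : ℂ → V}
    (hc : IsArc M c) : ∀ᶠ t in 𝓝 (0 : ℂ), q₁ (c t) = 0 ∧ q₂ (c t) = 0 := by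
  filter_upwards [hc.mem_cone] with t ht
  exact (h.mem_cone_iff.1 (cone_mono hM ht)).2

theorem deriv_eq_zero_of_eventually {f : ℂ → ℂ} {a : ℂ} (hf : HasDerivAt f a 0)
    (h : ∀ᶠ t in 𝓝 (0 : ℂ), f t = 0) : a = 0 := by
  have h1 : HasDerivAt (fun _ : ℂ => (0 : ℂ)) a 0 := hf.congr_of_eventuallyEq
    (h.mono fun t ht => ht.symm)
  exact h1.unique (hasDerivAt_const _ _)

theorem self_mem_tangentKer {v : V} (h₁ : q₁ v = 0) (h₂ : q₂ v = 0) : v ∈ tangentKer q₁ q₂ v := by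
  rw [mem_tangentKer, polar_self, polar_self, h₁, h₂]
  simp

variable [FiniteDimensional ℂ V]

/-- The affine tangent space of a relatively open subset of a nonsingular intersection. -/
theorem affineTangent_eq (h : Presents q₁ q₂ X) {U : Set (ℙ ℂ V)} (hU : IsOpen U) {v : V}
    (hv : v ∈ cone (X ∩ U)) : affineTangent (X ∩ U) v = tangentKer q₁ q₂ v := by
  refine le_antisymm (Submodule.span_le.2 ?_) fun u hu => ?_
  · rintro u ⟨c, hc, rfl, rfl⟩
    have hev := h.arc_eventually Set.inter_subset_left hc
    have hd := hc.analyticAt.differentiableAt.hasDerivAt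
    exact ⟨deriv_eq_zero_of_eventually (hasDerivAt_quadraticForm_comp q₁ hd) (hev.mono fun _ ht => ht.1),
      deriv_eq_zero_of_eventually (hasDerivAt_quadraticForm_comp q₂ hd) (hev.mono fun _ ht => ht.2)⟩
  · obtain ⟨c, hc, h0, hd⟩ := exists_isArc h hU hv hu.1 hu.2
    exact Submodule.subset_span ⟨c, hc, h0, hd.deriv⟩

theorem finrank_tangentKer {v : V}
    (hli : LinearIndependent ℂ ![q₁.polarBilin v, q₂.polarBilin v]) :
    Module.finrank ℂ (tangentKer q₁ q₂ v) + 2 = Module.finrank ℂ V := by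
  obtain ⟨a, b, ha₁, ha₂, hb₁, hb₂⟩ := exists_dual_pair hli
  have hsurj : Function.Surjective ((q₁.polarBilin v).prod (q₂.polarBilin v)) := by
    rintro ⟨s, t⟩
    refine ⟨s • a + t • b, ?_⟩
    refine Prod.ext ?_ ?_
    · change q₁.polarBilin v (s • a + t • b) = s
      rw [map_add, map_smul, map_smul, ha₁, hb₁]
      simp
    · change q₂.polarBilin v (s • a + t • b) = t
      rw [map_add, map_smul, map_smul, ha₂, hb₂]
      simp
  have := LinearMap.finrank_range_add_finrank_ker ((q₁.polarBilin v).prod (q₂.polarBilin v))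
  rw [LinearMap.range_eq_top.2 hsurj, finrank_top, Module.finrank_prod, Module.finrank_self,
    LinearMap.ker_prod] at this
  rw [tangentKer, ← this]
  ring

theorem finrank_tangentSpace (h : Presents q₁ q₂ X) {U : Set (ℙ ℂ V)} (hU : IsOpen U) {x : ℙ ℂ V}
    (hx : x ∈ X ∩ U) : Module.finrank ℂ (TangentSpace (X ∩ U) x) + 3 = Module.finrank ℂ V := by
  have hcone := mem_cone_rep hx
  have hX := (mem_cone_inter.1 hcone).1
  obtain ⟨-, h₁, h₂⟩ := h.mem_cone_iff.1 hX
  have hle : x.submodule ≤ affineTangent (X ∩ U) x.rep := by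
    rw [affineTangent_eq h hU hcone, Projectivization.submodule_eq, Submodule.span_singleton_le_iff_mem]
    exact self_mem_tangentKer h₁ h₂
  have e₁ := Submodule.finrank_quotient_add_finrank
    (x.submodule.comap (affineTangent (X ∩ U) x.rep).subtype)
  rw [(Submodule.comapSubtypeEquivOfLe hle).finrank_eq, Projectivization.finrank_submodule] at e₁
  change Module.finrank ℂ (TangentSpace (X ∩ U) x) + 1 = _ at e₁
  have e₂ := finrank_tangentKer (h.linearIndependent hX)
  rw [← affineTangent_eq h hU hcone] at e₂
  omega

/-- The second fundamental form of (an open subset of) a nonsingular intersection of two quadrics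
consists of the quadratic forms induced by the pencil of quadrics on the tangent space. -/
theorem mem_secondForm_iff (h : Presents q₁ q₂ X) {U : Set (ℙ ℂ V)} (hU : IsOpen U) {x : ℙ ℂ V}
    (hx : x ∈ X ∩ U) (φ : QuadraticForm ℂ (TangentSpace (X ∩ U) x)) :
    φ ∈ secondForm (X ∩ U) x ↔ ∃ a b : ℂ, ∀ u : affineTangent (X ∩ U) x.rep,
      φ (Submodule.Quotient.mk u) = a * q₁ (u : V) + b * q₂ (u : V) := by
  have hcone := mem_cone_rep hx
  have hX := (mem_cone_inter.1 hcone).1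
  have htan := affineTangent_eq h hU hcone
  have hfield : ∀ {c w : ℂ → V}, IsArc (X ∩ U) c → IsTangentField (X ∩ U) c w → c 0 = x.rep →
      QuadraticMap.polar q₁ x.rep (deriv w 0) + QuadraticMap.polar q₁ (deriv c 0) (w 0) = 0 ∧
      QuadraticMap.polar q₂ x.rep (deriv w 0) + QuadraticMap.polar q₂ (deriv c 0) (w 0) = 0 := by
    intro c w hc hw h0
    have hev : ∀ᶠ t in 𝓝 (0 : ℂ), w t ∈ tangentKer q₁ q₂ (c t) := by
      filter_upwards [hc.mem_cone, hw.mem_tangent] with t ht htw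
      rwa [affineTangent_eq h hU ht] at htw
    have hcd := hc.analyticAt.differentiableAt.hasDerivAt
    have hwd := hw.analyticAt.differentiableAt.hasDerivAt
    rw [← h0]
    exact ⟨deriv_eq_zero_of_eventually (hasDerivAt_polar q₁ hcd hwd) (hev.mono fun _ ht => ht.1),
      deriv_eq_zero_of_eventually (hasDerivAt_polar q₂ hcd hwd) (hev.mono fun _ ht => ht.2)⟩
  constructor
  · rintro ⟨l, hl, hφ⟩
    have hspan : l ∈ Submodule.span ℂ (Set.range ![q₁.polarBilin x.rep, q₂.polarBilin x.rep]) := by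
      refine mem_span_of_iInf_ker_le_ker fun u hu => ?_
      rw [Submodule.mem_iInf] at hu
      refine hl u ?_
      rw [htan]
      exact ⟨hu 0, hu 1⟩
    rw [Matrix.range_cons_cons_empty] at hspan
    obtain ⟨a, b, rfl⟩ := Submodule.mem_span_pair.1 hspan
    refine ⟨-(2 * a), -(2 * b), fun u => ?_⟩
    have hu : (u : V) ∈ tangentKer q₁ q₂ x.rep := htan ▸ u.2
    obtain ⟨c, hc, h0, hd⟩ := exists_isArc h hU hcone hu.1 hu.2
    -- The velocity field of the arc is a tangent field along the arc.
    have hw : IsTangentField (X ∩ U) c (deriv c) := by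
      refine ⟨hc.analyticAt.deriv, ?_⟩
      filter_upwards [hc.analyticAt.eventually_analyticAt, hc.mem_cone.eventually_nhds,
        hc.mem_cone] with t ht hev hmem
      rw [affineTangent_eq h hU hmem]
      have key : ∀ q : QuadraticForm ℂ V, (∀ s, c s ∈ cone (X ∩ U) → q (c s) = 0) →
          QuadraticMap.polar q (c t) (deriv c t) = 0 := fun q hq => by
        have h1 := hasDerivAt_quadraticForm_comp q ht.differentiableAt.hasDerivAt
        have h2 : HasDerivAt (fun _ : ℂ => (0 : ℂ)) _ t := h1.congr_of_eventuallyEq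
          (hev.mono fun s hs => (hq s hs).symm)
        exact h2.unique (hasDerivAt_const _ _)
      exact ⟨key q₁ fun s hs => (h.mem_cone_iff.1 (mem_cone_inter.1 hs).1).2.1,
        key q₂ fun s hs => (h.mem_cone_iff.1 (mem_cone_inter.1 hs).1).2.2⟩
    have e₁ := hφ c (deriv c) hc h0 hw u u hd.deriv.symm hd.deriv.symm
    obtain ⟨e₂, e₃⟩ := hfield hc hw h0
    rw [hd.deriv, polar_self] at e₂ e₃
    rw [polar_self] at e₁
    simp only [LinearMap.add_apply, LinearMap.smul_apply, QuadraticMap.polarBilin_apply_apply,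
      smul_eq_mul] at e₁
    linear_combination e₁ + a * e₂ + b * e₃
  · rintro ⟨a, b, hφ⟩
    refine ⟨-(a / 2) • q₁.polarBilin x.rep + -(b / 2) • q₂.polarBilin x.rep, fun u hu => ?_, ?_⟩
    · rw [htan] at hu
      have h₁ : q₁.polarBilin x.rep u = 0 := hu.1
      have h₂ : q₂.polarBilin x.rep u = 0 := hu.2
      simp only [LinearMap.add_apply, LinearMap.smul_apply, h₁, h₂, smul_zero, add_zero]
    · intro c w hc h0 hw u₀ w₀ hu hw₀
      obtain ⟨e₂, e₃⟩ := hfield hc hw h0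
      rw [← hu, ← hw₀] at e₂ e₃
      have e₁ : QuadraticMap.polar φ (Submodule.Quotient.mk u₀) (Submodule.Quotient.mk w₀)
          = a * QuadraticMap.polar q₁ (u₀ : V) (w₀ : V) + b * QuadraticMap.polar q₂ (u₀ : V) (w₀ : V) := by
        simp only [QuadraticMap.polar, ← Submodule.Quotient.mk_add, hφ, Submodule.coe_add]
        ring
      rw [e₁]
      simp only [LinearMap.add_apply, LinearMap.smul_apply, QuadraticMap.polarBilin_apply_apply,
        smul_eq_mul]
      linear_combination (a / 2) * e₂ + (b / 2) * e₃

/-- A linear map `ι` onto a complement of the line `v` in the affine tangent space at `v`. -/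
structure IsFrame (q₁ q₂ : QuadraticForm ℂ V) {n : ℕ} (v : V) (ι : (Fin n → ℂ) →ₗ[ℂ] V) : Prop where
  mem : ∀ y, ι y ∈ tangentKer q₁ q₂ v
  eq_zero : ∀ y, ι y ∈ Submodule.span ℂ {v} → y = 0

/-- In a frame, the second fundamental form is the pencil spanned by the pull-backs of the two
quadratic forms. -/
theorem exists_secondForm_equiv (h : Presents q₁ q₂ X) {U : Set (ℙ ℂ V)} (hU : IsOpen U) {n : ℕ}
    (hn : Module.finrank ℂ V = n + 3) {x : ℙ ℂ V} (hx : x ∈ X ∩ U) {v : V} (hv : v ≠ 0)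
    (hvx : Projectivization.mk ℂ v hv = x) {ι : (Fin n → ℂ) →ₗ[ℂ] V} (hι : IsFrame q₁ q₂ v ι) :
    ∃ e : (Fin n → ℂ) ≃ₗ[ℂ] TangentSpace (X ∩ U) x,
      (secondForm (X ∩ U) x).map (pullback (e : (Fin n → ℂ) →ₗ[ℂ] TangentSpace (X ∩ U) x))
        = Submodule.span ℂ {pullback ι q₁, pullback ι q₂} := by
  have hcone := mem_cone_rep hx
  have hX := (mem_cone_inter.1 hcone).1
  have htan := affineTangent_eq h hU hcone
  have hfr := finrank_tangentSpace h hU hx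
  obtain ⟨-, hr₁, hr₂⟩ := h.mem_cone_iff.1 hX
  obtain ⟨s, hs⟩ := Projectivization.exists_smul_eq_mk_rep ℂ v hv
  rw [hvx] at hs
  have hspan : Submodule.span ℂ {v} = x.submodule := by
    rw [← hvx, Projectivization.submodule_mk]
  have hmem : ∀ y, ι y ∈ affineTangent (X ∩ U) x.rep := fun y => by
    rw [htan, ← hs, mem_tangentKer, Units.smul_def, QuadraticMap.polar_smul_left,
      QuadraticMap.polar_smul_left, (mem_tangentKer.1 (hι.mem y)).1,
      (mem_tangentKer.1 (hι.mem y)).2]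
    simp
  let f : (Fin n → ℂ) →ₗ[ℂ] TangentSpace (X ∩ U) x :=
    Submodule.mkQ _ ∘ₗ ι.codRestrict (affineTangent (X ∩ U) x.rep) hmem
  have hinj : Function.Injective f := by
    rw [injective_iff_map_eq_zero]
    intro y hy
    refine hι.eq_zero y ?_
    rw [hspan]
    have hy' : (⟨ι y, hmem y⟩ : affineTangent (X ∩ U) x.rep) ∈
        x.submodule.comap (affineTangent (X ∩ U) x.rep).subtype :=
      (Submodule.Quotient.mk_eq_zero _).1 hy
    exact hy'
  let e := LinearMap.linearEquivOfInjective f hinj (by rw [Module.finrank_fin_fun]; omega)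
  have he : ∀ y, e y = Submodule.Quotient.mk ⟨ι y, hmem y⟩ := fun y => rfl
  refine ⟨e, le_antisymm ?_ ?_⟩
  · rintro _ ⟨φ, hφ, rfl⟩
    obtain ⟨a, b, hab⟩ := (mem_secondForm_iff h hU hx φ).1 hφ
    refine Submodule.mem_span_pair.2 ⟨a, b, ?_⟩
    ext y
    rw [pullback_apply, LinearEquiv.coe_coe, he, hab]
    rfl
  · have key : ∀ ψ ∈ Submodule.span ℂ {pullback ι q₁, pullback ι q₂},
        ψ ∈ (secondForm (X ∩ U) x).map (pullback (e : (Fin n → ℂ) →ₗ[ℂ] TangentSpace (X ∩ U) x)) := by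
      intro ψ hψ
      obtain ⟨a, b, rfl⟩ := Submodule.mem_span_pair.1 hψ
      refine ⟨pullback (e.symm : TangentSpace (X ∩ U) x →ₗ[ℂ] (Fin n → ℂ))
        (a • pullback ι q₁ + b • pullback ι q₂), ?_, ?_⟩
      · refine (mem_secondForm_iff h hU hx _).2 ⟨a, b, fun u => ?_⟩
        obtain ⟨y, hy⟩ := e.surjective (Submodule.Quotient.mk u)
        rw [pullback_apply, ← hy, LinearEquiv.coe_coe, LinearEquiv.symm_apply_apply]
        rw [he, Submodule.Quotient.eq, Submodule.mem_comap, Projectivization.submodule_eq,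
          Submodule.mem_span_singleton] at hy
        obtain ⟨r, hr⟩ := hy
        have hu : (u : V) = ι y - r • x.rep := by
          rw [hr]
          simp
        have hq : ∀ q : QuadraticForm ℂ V, q x.rep = 0 → QuadraticMap.polar q x.rep (ι y) = 0 →
            q (u : V) = q (ι y) := by
          intro q h0 hp
          rw [hu, sub_eq_add_neg, ← neg_smul]
          have e₂ : q (ι y + -r • x.rep) = q (ι y) + q (-r • x.rep)
              + QuadraticMap.polar q (ι y) (-r • x.rep) := by
            simp only [QuadraticMap.polar]; ring
          rw [e₂, QuadraticMap.map_smul, h0, QuadraticMap.polar_smul_right, QuadraticMap.polar_comm, hp]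
          simp
        have hy' : ι y ∈ tangentKer q₁ q₂ x.rep := htan ▸ hmem y
        rw [hq q₁ hr₁ hy'.1, hq q₂ hr₂ hy'.2]
        rfl
      · ext y
        rw [pullback_apply, pullback_apply, LinearEquiv.coe_coe, LinearEquiv.coe_coe,
          LinearEquiv.symm_apply_apply]
    exact key

/-- A point with a frame belongs to the moduli domain if and only if the pull-backs of the two
quadratic forms span a nonsingular pencil. -/
theorem mem_moduliDomain_iff (h : Presents q₁ q₂ X) {M : Set (ℙ ℂ V)} (hM : IsEuclideanOpenIn M X)
    {n : ℕ} (hn : Module.finrank ℂ V = n + 3) {x : ℙ ℂ V} (hx : x ∈ M) {v : V} (hv : v ≠ 0)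
    (hvx : Projectivization.mk ℂ v hv = x) {ι : (Fin n → ℂ) →ₗ[ℂ] V} (hι : IsFrame q₁ q₂ v ι) :
    x ∈ moduliDomain n M ↔
      IsNonsingularPencil (Submodule.span ℂ {pullback ι q₁, pullback ι q₂}) := by
  obtain ⟨U, hU, rfl⟩ := hM
  obtain ⟨e, he⟩ := exists_secondForm_equiv h hU hn hx hv hvx hι
  have hfr := finrank_tangentSpace h hU hx
  rw [← he, IsNonsingularPencil.map_iff e]
  exact ⟨fun h => h.2.2, fun h => ⟨hx, by omega, h⟩⟩

theorem moduliMap_eq (h : Presents q₁ q₂ X) {M : Set (ℙ ℂ V)} (hM : IsEuclideanOpenIn M X) {n : ℕ}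
    (hn : Module.finrank ℂ V = n + 3) {v : V} (hv : v ≠ 0) {ι : (Fin n → ℂ) →ₗ[ℂ] V}
    (hι : IsFrame q₁ q₂ v ι) (x : moduliDomain n M) (hvx : Projectivization.mk ℂ v hv = x)
    (hns : IsNonsingularPencil (Submodule.span ℂ {pullback ι q₁, pullback ι q₂})) :
    moduliMap n M x = Quotient.mk (pencilSetoid n) ⟨_, hns⟩ := by
  obtain ⟨U, hU, rfl⟩ := hM
  obtain ⟨e, he⟩ := exists_secondForm_equiv h hU hn x.2.1 hv hvx hι
  rw [moduliMap, pencilClass_eq _ _ _ e]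
  congr 2

end SecondFundamentalForm

/-! ### Polynomial frames of the tangent spaces -/

section Frames

variable {E F G : Type*} [AddCommGroup E] [Module ℂ E] [AddCommGroup F] [Module ℂ F]
  [AddCommGroup G] [Module ℂ G]

theorem IsPolynomialMap.prodMk {p : E → F} {r : E → G} (hp : IsPolynomialMap p)
    (hr : IsPolynomialMap r) : IsPolynomialMap fun v => (p v, r v) := fun l => by
  have : (fun v => l (p v, r v)) = (fun v => (l ∘ₗ LinearMap.inl ℂ F G) (p v)) +
      fun v => (l ∘ₗ LinearMap.inr ℂ F G) (r v) := by
    ext v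
    simp [← map_add]
  rw [this]
  exact add_mem (hp _) (hr _)

theorem IsPolynomialMap.polar_mem [FiniteDimensional ℂ F] {p r : E → F} (hp : IsPolynomialMap p)
    (hr : IsPolynomialMap r) (q : QuadraticForm ℂ F) :
    (fun v => QuadraticMap.polar q (p v) (r v)) ∈ polynomialFunctions E := by
  let b := Module.finBasis ℂ F
  have : (fun v => QuadraticMap.polar q (p v) (r v)) = ∑ i, ∑ j,
      (fun v => b.coord i (p v)) * (fun v => b.coord j (r v)) *
        fun _ => QuadraticMap.polar q (b i) (b j) := by
    ext v
    have h := LinearMap.sum_repr_mul_repr_mul b b (B := q.polarBilin) (p v) (r v)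
    rw [QuadraticMap.polarBilin_apply_apply] at h
    rw [← h, Finsupp.sum_fintype _ _ (by simp)]
    simp only [Finset.sum_apply, Pi.mul_apply]
    refine Finset.sum_congr rfl fun i _ => ?_
    rw [Finsupp.sum_fintype _ _ (by simp)]
    refine Finset.sum_congr rfl fun j _ => ?_
    simp
    ring
  rw [this]
  exact sum_mem fun i _ => sum_mem fun j _ =>
    mul_mem (mul_mem (hp _) (hr _)) (const_mem_polynomialFunctions _)

/-- A quadratic form in terms of its Gram matrix. -/
theorem quadraticForm_eq_sum {n : ℕ} (φ : QuadraticForm ℂ (Fin n → ℂ)) :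
    φ = ∑ i, ∑ j, (gram φ i j / 2) •
      QuadraticMap.linMulLin (LinearMap.proj i : (Fin n → ℂ) →ₗ[ℂ] ℂ) (LinearMap.proj j) := by
  ext v
  have h := LinearMap.sum_repr_mul_repr_mul (Pi.basisFun ℂ (Fin n)) (Pi.basisFun ℂ (Fin n))
    (B := φ.polarBilin) v v
  rw [QuadraticMap.polarBilin_apply_apply, polar_self] at h
  have h2 : φ v = (1 / 2) * (2 * φ v) := by ring
  rw [h2, ← h, Finsupp.sum_fintype _ _ (by simp), Finset.mul_sum, sum_apply]
  refine Finset.sum_congr rfl fun i _ => ?_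
  rw [Finsupp.sum_fintype _ _ (by simp), Finset.mul_sum, sum_apply]
  refine Finset.sum_congr rfl fun j _ => ?_
  simp [gram]
  ring

theorem isPolynomialMap_pullback [FiniteDimensional ℂ F] {n : ℕ} {ι : E → ((Fin n → ℂ) →ₗ[ℂ] F)}
    (hι : ∀ y, IsPolynomialMap fun v => ι v y) (q : QuadraticForm ℂ F) :
    IsPolynomialMap fun v => pullback (ι v) q := fun l => by
  have : (fun v => l (pullback (ι v) q)) = ∑ i, ∑ j,
      (fun v => QuadraticMap.polar q (ι v (Pi.single i 1)) (ι v (Pi.single j 1))) *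
        fun _ => l (QuadraticMap.linMulLin (LinearMap.proj i : (Fin n → ℂ) →ₗ[ℂ] ℂ)
          (LinearMap.proj j)) / 2 := by
    ext v
    rw [quadraticForm_eq_sum (pullback (ι v) q)]
    simp only [map_sum, map_smul, Finset.sum_apply, Pi.mul_apply, gram, polar_comp_linear, smul_eq_mul]
    exact Finset.sum_congr rfl fun i _ => Finset.sum_congr rfl fun j _ => by ring
  rw [this]
  exact sum_mem fun i _ => sum_mem fun j _ =>
    mul_mem ((hι _).polar_mem (hι _) q) (const_mem_polynomialFunctions _)

variable {V : Type*} [NormedAddCommGroup V] [NormedSpace ℂ V] {q₁ q₂ : QuadraticForm ℂ V}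
  {X : Set (ℙ ℂ V)} [FiniteDimensional ℂ V]

/-- Near every point there is an algebraic family of frames: a complement of the line `v₀` in the
tangent space at `v₀` is projected to the tangent space at `v` along the plane spanned by vectors
`a`, `b` dual to the differentials at `v₀`; Cramer's rule clears the denominators. -/
theorem Presents.exists_frame (h : Presents q₁ q₂ X) {n : ℕ} (hn : Module.finrank ℂ V = n + 3)
    {v₀ : V} (hv₀ : v₀ ∈ cone X) :
    ∃ D ∈ polynomialFunctions V, D v₀ ≠ 0 ∧ ∃ ι : V → ((Fin n → ℂ) →ₗ[ℂ] V),
      (∀ y, IsPolynomialMap fun v => ι v y) ∧ ∀ v, D v ≠ 0 → IsFrame q₁ q₂ v (ι v) := by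
  obtain ⟨hne, hz₁, hz₂⟩ := h.mem_cone_iff.1 hv₀
  obtain ⟨a, b, ha₁, ha₂, hb₁, hb₂⟩ := exists_dual_pair (h.linearIndependent hv₀)
  set B₁ := q₁.polarBilin with hB₁
  set B₂ := q₂.polarBilin with hB₂
  have hv₁ : B₁ v₀ v₀ = 0 := by rw [hB₁, QuadraticMap.polarBilin_apply_apply, polar_self, hz₁, mul_zero]
  have hv₂ : B₂ v₀ v₀ = 0 := by rw [hB₂, QuadraticMap.polarBilin_apply_apply, polar_self, hz₂, mul_zero]
  obtain ⟨l₀, hl₀⟩ : ∃ l₀ : Module.Dual ℂ V, l₀ v₀ = 1 := by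
    obtain ⟨l, hl⟩ := not_forall.1 ((Module.forall_dual_apply_eq_zero_iff ℂ v₀).not.2 hne)
    exact ⟨(l v₀)⁻¹ • l, by simp [hl]⟩
  let l : Module.Dual ℂ V := l₀ - l₀ a • B₁ v₀ - l₀ b • B₂ v₀
  have hlv : l v₀ = 1 := by simp [l, hl₀, hv₁, hv₂]
  have hla : l a = 0 := by simp [l, ha₁, ha₂]
  have hlb : l b = 0 := by simp [l, hb₁, hb₂]
  let f : V →ₗ[ℂ] ℂ × (ℂ × ℂ) := (B₁ v₀).prod ((B₂ v₀).prod l)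
  have hf : ∀ u, f u = (B₁ v₀ u, (B₂ v₀ u, l u)) := fun u => rfl
  have hsurj : LinearMap.range f = ⊤ := by
    refine LinearMap.range_eq_top.2 ?_
    rintro ⟨r, s, t⟩
    refine ⟨r • a + s • b + t • v₀, ?_⟩
    rw [hf]
    simp [ha₁, ha₂, hb₁, hb₂, hv₁, hv₂, hla, hlb, hlv]
  have hker : Module.finrank ℂ (LinearMap.ker f) = n := by
    have := LinearMap.finrank_range_add_finrank_ker f
    rw [hsurj, finrank_top, Module.finrank_prod, Module.finrank_prod, Module.finrank_self, hn] at this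
    omega
  let e := LinearEquiv.ofFinrankEq (Fin n → ℂ) (LinearMap.ker f) (by rw [hker, Module.finrank_fin_fun])
  let κ : (Fin n → ℂ) →ₗ[ℂ] V := (LinearMap.ker f).subtype ∘ₗ e.toLinearMap
  have hκ : ∀ y, B₁ v₀ (κ y) = 0 ∧ B₂ v₀ (κ y) = 0 ∧ l (κ y) = 0 := fun y => by
    have : f (κ y) = 0 := (e y).2
    rw [hf, Prod.mk_eq_zero, Prod.mk_eq_zero] at this
    exact this
  have hκ0 : ∀ y, κ y = 0 → y = 0 := fun y hy => by
    have : e y = 0 := Subtype.ext hy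
    simpa using this
  let g : V → ℂ := fun v => B₁ v a * B₂ v b - B₁ v b * B₂ v a
  let ι : V → ((Fin n → ℂ) →ₗ[ℂ] V) := fun v => g v • κ -
    ((B₂ v b • B₁ v - B₁ v b • B₂ v) ∘ₗ κ).smulRight a -
    ((B₁ v a • B₂ v - B₂ v a • B₁ v) ∘ₗ κ).smulRight b
  have hι : ∀ v y, ι v y = g v • κ y - (B₂ v b * B₁ v (κ y) - B₁ v b * B₂ v (κ y)) • a -
      (B₁ v a * B₂ v (κ y) - B₂ v a * B₁ v (κ y)) • b := fun v y => by simp [ι]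
  have hpoly : ∀ (q : QuadraticForm ℂ V) (u : V), (fun v => q.polarBilin v u) ∈ polynomialFunctions V :=
    fun q u => dual_mem_polynomialFunctions (q.polarBilin.flip u)
  have hg : g ∈ polynomialFunctions V :=
    sub_mem (mul_mem (hpoly _ _) (hpoly _ _)) (mul_mem (hpoly _ _) (hpoly _ _))
  refine ⟨fun v => g v * l v, mul_mem hg (dual_mem_polynomialFunctions l), ?_, ι, fun y m => ?_,
    fun v hv => ⟨fun y => ?_, fun y hy => ?_⟩⟩
  · simp [g, ha₁, ha₂, hb₁, hb₂, hlv]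
  · have : (fun v => m (ι v y)) = g * (fun _ => m (κ y)) -
        ((fun v => B₂ v b) * (fun v => B₁ v (κ y)) - (fun v => B₁ v b) * fun v => B₂ v (κ y)) *
          (fun _ => m a) -
        ((fun v => B₁ v a) * (fun v => B₂ v (κ y)) - (fun v => B₂ v a) * fun v => B₁ v (κ y)) *
          fun _ => m b := by
      ext v
      simp [hι]
    rw [this]
    exact sub_mem (sub_mem (mul_mem hg (const_mem_polynomialFunctions _))
      (mul_mem (sub_mem (mul_mem (hpoly _ _) (hpoly _ _)) (mul_mem (hpoly _ _) (hpoly _ _)))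
        (const_mem_polynomialFunctions _)))
      (mul_mem (sub_mem (mul_mem (hpoly _ _) (hpoly _ _)) (mul_mem (hpoly _ _) (hpoly _ _)))
        (const_mem_polynomialFunctions _))
  · constructor
    · change B₁ v (ι v y) = 0
      rw [hι]
      simp only [map_sub, map_smul, smul_eq_mul, g]
      ring
    · change B₂ v (ι v y) = 0
      rw [hι]
      simp only [map_sub, map_smul, smul_eq_mul, g]
      ring
  · obtain ⟨hgv, hlv'⟩ := mul_ne_zero_iff.1 hv
    obtain ⟨s, hs⟩ := Submodule.mem_span_singleton.1 hy
    have hs0 : s = 0 := by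
      have := congrArg l hs
      rw [hι] at this
      simpa [hla, hlb, (hκ y).2.2, hlv'] using this
    rw [hs0, zero_smul, hι] at hs
    have e₁ := congrArg (B₁ v₀) hs
    have e₂ := congrArg (B₂ v₀) hs
    simp only [map_zero, map_sub, map_smul, smul_eq_mul, (hκ y).1, (hκ y).2.1, ha₁, ha₂, hb₁, hb₂,
      mul_zero, mul_one, zero_sub, sub_zero] at e₁ e₂
    have e₃ := e₁.symm
    have e₄ := e₂.symm
    rw [neg_eq_zero] at e₃ e₄
    rw [e₃, e₄, zero_smul, zero_smul, sub_zero, sub_zero] at hs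
    exact hκ0 y ((smul_eq_zero.1 hs.symm).resolve_left hgv)

end Frames

/-! ### The moduli map is a morphism -/

section Morphism

/-- A subset of `A ⊆ ℙ(E)` whose affine cone is cut out by a Zariski open subset of `E` is Zariski
open in `A`; the open subset need not be a cone, and is replaced by the union of its multiples. -/
theorem exists_isOpen_zariskiProj {E : Type*} [AddCommGroup E] [Module ℂ E] {A : Set (ℙ ℂ E)}
    {S : Set (ℙ ℂ E)} {Ω : Set E} (hΩ : IsOpen[zariski E] Ω)
    (h : ∀ (v : E) (hv : v ≠ 0), Projectivization.mk ℂ v hv ∈ A →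
      (Projectivization.mk ℂ v hv ∈ S ↔ v ∈ Ω)) :
    ∃ U : Set (ℙ ℂ E), IsOpen[zariskiProj E] U ∧ ∀ x ∈ A, x ∈ S ↔ x ∈ U := by
  refine ⟨{x | ∃ (v : E) (hv : v ≠ 0), Projectivization.mk ℂ v hv = x ∧ v ∈ Ω}, ?_, fun x hx => ?_⟩
  · let := zariski E
    change IsOpen[TopologicalSpace.induced Subtype.val (zariski E)] (Projectivization.mk' ℂ ⁻¹' _)
    refine isOpen_induced_iff.2 ⟨⋃ c : ℂˣ, (fun v => (c : ℂ) • v) ⁻¹' Ω, ?_, ?_⟩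
    · exact isOpen_iUnion fun c =>
        (LinearMap.isPolynomialMap ((c : ℂ) • LinearMap.id)).isOpen_preimage hΩ
    · ext ⟨v, hv⟩
      simp only [Set.mem_preimage, Set.mem_iUnion]
      constructor
      · rintro ⟨c, hc⟩
        refine ⟨(c : ℂ) • v, smul_ne_zero c.ne_zero hv, ?_, hc⟩
        exact (Projectivization.mk_eq_mk_iff _ _ _ _ _).2 ⟨c, rfl⟩
      · rintro ⟨w, hw, hwv, hΩw⟩
        obtain ⟨c, hc⟩ := (Projectivization.mk_eq_mk_iff _ _ _ _ _).1 hwv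
        exact ⟨c, by change c • v ∈ Ω; rw [hc]; exact hΩw⟩
  · constructor
    · intro hS
      refine ⟨x.rep, x.rep_nonzero, x.mk_rep, (h _ x.rep_nonzero ?_).1 ?_⟩ <;> rwa [x.mk_rep]
    · rintro ⟨v, hv, rfl, hvΩ⟩
      exact (h v hv hx).2 hvΩ

theorem isEuclideanOpenIn_self {V : Type*} [NormedAddCommGroup V] [NormedSpace ℂ V]
    (X : Set (ℙ ℂ V)) : IsEuclideanOpenIn X X :=
  ⟨Set.univ, isOpen_univ, (Set.inter_univ X).symm⟩

variable {V : Type*} [NormedAddCommGroup V] [NormedSpace ℂ V] {q₁ q₂ : QuadraticForm ℂ V}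
  {X : Set (ℙ ℂ V)} [FiniteDimensional ℂ V]

/-- Locally on the cone over `X`, the second fundamental form lifts to a polynomial map to pairs of
quadratic forms. -/
theorem Presents.exists_lift (h : Presents q₁ q₂ X) {n : ℕ} (hn : Module.finrank ℂ V = n + 3)
    {v₀ : V} (hv₀ : v₀ ∈ cone X) :
    ∃ D ∈ polynomialFunctions V, D v₀ ≠ 0 ∧
      ∃ p : V → QuadraticForm ℂ (Fin n → ℂ) × QuadraticForm ℂ (Fin n → ℂ), IsPolynomialMap p ∧
        ∀ v ∈ cone X, D v ≠ 0 → ∀ x, (∃ hv : v ≠ 0, Projectivization.mk ℂ v hv = x) →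
          (x ∈ moduliDomain n X ↔ IsNonsingularPencil (Submodule.span ℂ {(p v).1, (p v).2})) ∧
          ∀ (hx : x ∈ moduliDomain n X)
            (hns : IsNonsingularPencil (Submodule.span ℂ {(p v).1, (p v).2})),
            moduliMap n X ⟨x, hx⟩ = pairClass n ⟨p v, hns⟩ := by
  obtain ⟨D, hD, hD0, ι, hι, hfr⟩ := h.exists_frame hn hv₀
  refine ⟨D, hD, hD0, fun v => (pullback (ι v) q₁, pullback (ι v) q₂),
    (isPolynomialMap_pullback hι q₁).prodMk (isPolynomialMap_pullback hι q₂), ?_⟩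
  rintro v hv hDv x ⟨hv0, rfl⟩
  exact ⟨mem_moduliDomain_iff h (isEuclideanOpenIn_self X) hn hv.snd hv0 rfl (hfr v hDv),
    fun hx hns => moduliMap_eq h (isEuclideanOpenIn_self X) hn hv0 (hfr v hDv) ⟨_, hx⟩ rfl hns⟩

theorem Presents.isOpen_moduliDomain (h : Presents q₁ q₂ X) {n : ℕ} (h2 : 2 ≤ n)
    (hn : Module.finrank ℂ V = n + 3) :
    ∃ U : Set (ℙ ℂ V), IsOpen[zariskiProj V] U ∧ moduliDomain n X = X ∩ U := by
  choose D hD hD0 p hp hlift using fun v₀ : cone X => h.exists_lift hn v₀.2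
  obtain ⟨Ω, hΩ, hmem⟩ := exists_isOpen_nonsingular h2
  obtain ⟨U, hU, hUX⟩ := exists_isOpen_zariskiProj (A := X) (S := moduliDomain n X)
    (Ω := ⋃ v₀ : cone X, {v | D v₀ v ≠ 0} ∩ p v₀ ⁻¹' Ω) (by
      let := zariski V
      exact isOpen_iUnion fun v₀ => (isOpen_ne_zero (hD v₀)).inter ((hp v₀).isOpen_preimage hΩ))
    (by
      intro v hv hvX
      simp only [Set.mem_iUnion]
      constructor
      · intro hx
        refine ⟨⟨v, hv, hvX⟩, hD0 _, ?_⟩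
        exact (hmem _).2 (((hlift ⟨v, hv, hvX⟩ v ⟨hv, hvX⟩ (hD0 _) _ ⟨hv, rfl⟩).1).1 hx)
      · rintro ⟨v₀, hDv, hpv⟩
        exact ((hlift v₀ v ⟨hv, hvX⟩ hDv _ ⟨hv, rfl⟩).1).2 ((hmem _).1 hpv))
  refine ⟨U, hU, ?_⟩
  ext x
  exact ⟨fun hx => ⟨hx.1, (hUX x hx.1).1 hx⟩, fun hx => (hUX x hx.1).2 hx.2⟩

theorem Presents.isMorphism_moduliMap (h : Presents q₁ q₂ X) {n : ℕ}
    (hn : Module.finrank ℂ V = n + 3) : IsMorphism (moduliMap n X) := by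
  choose D hD hD0 p hp hlift using fun v₀ : cone X => h.exists_lift hn v₀.2
  have hsub : moduliDomain n X ⊆ X := fun x hx => hx.1
  refine ⟨fun O hO => ?_, fun O g hO hg => ?_⟩
  · obtain ⟨Ω, hΩ, hmem⟩ := (@isOpen_induced_iff _ _
      (zariski (QuadraticForm ℂ (Fin n → ℂ) × QuadraticForm ℂ (Fin n → ℂ))) _ _).1
      (isOpen_coinduced.1 hO)
    obtain ⟨U, hU, hUX⟩ := exists_isOpen_zariskiProj (A := moduliDomain n X)
      (S := {x | ∃ hx : x ∈ moduliDomain n X, moduliMap n X ⟨x, hx⟩ ∈ O})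
      (Ω := ⋃ v₀ : cone X, {v | D v₀ v ≠ 0} ∩ p v₀ ⁻¹' Ω) (by
        let := zariski V
        exact isOpen_iUnion fun v₀ => (isOpen_ne_zero (hD v₀)).inter ((hp v₀).isOpen_preimage hΩ))
      (by
        intro v hv hvA
        have hvX := hsub hvA
        have key : ∀ v₀ : cone X, D v₀ v ≠ 0 →
            ((∃ hx : Projectivization.mk ℂ v hv ∈ moduliDomain n X, moduliMap n X ⟨_, hx⟩ ∈ O) ↔
              p v₀ v ∈ Ω) := by
          intro v₀ hDv
          obtain ⟨e₁, e₂⟩ := hlift v₀ v ⟨hv, hvX⟩ hDv _ ⟨hv, rfl⟩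
          have hns := e₁.1 hvA
          have e₃ := Set.ext_iff.1 hmem ⟨p v₀ v, hns⟩
          rw [Set.mem_preimage, Set.mem_preimage, ← e₂ hvA hns] at e₃
          rw [e₃]
          exact ⟨fun hx => hx.2, fun hx => ⟨hvA, hx⟩⟩
        simp only [Set.mem_iUnion]
        constructor
        · intro hx
          exact ⟨⟨v, hv, hvX⟩, hD0 _, (key ⟨v, hv, hvX⟩ (hD0 _)).1 hx⟩
        · rintro ⟨v₀, hDv, hpv⟩
          exact (key v₀ hDv).2 hpv)
    refine ⟨U, hU, ?_⟩
    ext ⟨x, hx⟩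
    exact (show _ ↔ _ from ⟨fun hO => ⟨hx, hO⟩, fun hO => hO.2⟩).trans (hUX x hx)
  · intro v₀ hv₀
    have hv₀X : (v₀ : V) ∈ cone X := cone_mono hsub v₀.2
    obtain ⟨e₁, e₂⟩ := hlift ⟨v₀, hv₀X⟩ v₀ hv₀X (hD0 _) _ ⟨v₀.2.fst, rfl⟩
    have hns := e₁.1 v₀.2.snd
    obtain ⟨P, hP, Q, hQ, hQ0, hPQ⟩ := hg ⟨p ⟨v₀, hv₀X⟩ v₀, hns⟩ (by
      change pairClass n _ ∈ O
      rw [← e₂ v₀.2.snd hns]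
      exact hv₀)
    refine ⟨_, mul_mem (hD ⟨v₀, hv₀X⟩) ((hp ⟨v₀, hv₀X⟩).comp_mem hP), _,
      mul_mem (hD ⟨v₀, hv₀X⟩) ((hp ⟨v₀, hv₀X⟩).comp_mem hQ), mul_ne_zero (hD0 _) hQ0, ?_⟩
    intro v hv hQv
    obtain ⟨hDv, hQv⟩ := mul_ne_zero_iff.1 hQv
    have hvX : (v : V) ∈ cone X := cone_mono hsub v.2
    obtain ⟨e₃, e₄⟩ := hlift ⟨v₀, hv₀X⟩ v hvX hDv _ ⟨v.2.fst, rfl⟩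
    have hns' := e₃.1 v.2.snd
    have e₅ := e₄ v.2.snd hns'
    have := hPQ ⟨p ⟨v₀, hv₀X⟩ v, hns'⟩ (by
      change pairClass n _ ∈ O
      rw [← e₅]
      exact hv) hQv
    rw [Pi.mul_apply, Pi.mul_apply, mul_div_mul_left _ _ hDv, ← this]
    exact congrArg g e₅

end Morphism

/-! ### Diagonal equations of nonsingular intersections -/

section Diagonalization

variable {V : Type*} [NormedAddCommGroup V] [NormedSpace ℂ V] {q₁ q₂ : QuadraticForm ℂ V}
  {X : Set (ℙ ℂ V)}

/-- A common isotropic vector of `q₁` and `q₂` is not a singular vector of any member. -/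
theorem Presents.eq_zero_of_polar (h : Presents q₁ q₂ X) {u : V} (hu : u ≠ 0) {a b : ℂ}
    (hab : ∀ v, a * QuadraticMap.polar q₁ u v + b * QuadraticMap.polar q₂ u v = 0)
    (h₁ : q₁ u = 0) (h₂ : q₂ u = 0) : a = 0 ∧ b = 0 := by
  refine LinearIndependent.pair_iff.1 (h.linearIndependent (h.mem_cone_iff.2 ⟨hu, h₁, h₂⟩)) a b ?_
  ext v
  simpa using hab v

theorem polar_add_smul (φ ψ : QuadraticForm ℂ V) (t : ℂ) (u v : V) :
    QuadraticMap.polar (φ + t • ψ) u v = QuadraticMap.polar φ u v + t * QuadraticMap.polar ψ u v := by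
  simp only [QuadraticMap.polar, add_apply, smul_apply, smul_eq_mul]
  ring

theorem Presents.add_smul (h : Presents q₁ q₂ X) (t : ℂ) : Presents (q₁ + t • q₂) q₂ X := by
  refine ⟨?_, fun x hx => ?_⟩
  · rw [h.eq]
    ext x
    simp only [Set.mem_ofPred_eq, add_apply, smul_apply, smul_eq_mul]
    constructor
    · rintro ⟨h₁, h₂⟩
      simp [h₁, h₂]
    · rintro ⟨h₁, h₂⟩
      rw [h₂, mul_zero, add_zero] at h₁
      exact ⟨h₁, h₂⟩
  · have hli := h.smooth x hx
    rw [LinearIndependent.pair_iff] at hli ⊢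
    intro a b hab
    have := hli a (a * t + b) (by
      rw [← hab]
      ext v
      simp only [LinearMap.add_apply, LinearMap.smul_apply, QuadraticMap.polarBilin_apply_apply,
        polar_add_smul, smul_eq_mul]
      ring)
    obtain ⟨rfl, h2⟩ := this
    exact ⟨rfl, by simpa using h2⟩

variable [FiniteDimensional ℂ V]

/-- The pencil of a nonsingular intersection has a nondegenerate member: otherwise the singular
vectors of its members would form an infinite family of nonisotropic vectors that are orthogonal
for `q₂`. -/
theorem Presents.exists_nondegenerate (h : Presents q₁ q₂ X) :
    ∃ t : ℂ, ¬ IsDegenerate (q₁ + t • q₂) := by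
  by_contra! hc
  choose u hu0 hu using hc
  simp only [polar_add_smul] at hu
  have hne : ∀ t, q₂ (u t) ≠ 0 := fun t h0 => by
    have h1 := hu t (u t)
    rw [polar_self, polar_self, h0] at h1
    have h2 : q₁ (u t) = 0 := by simpa using h1
    exact one_ne_zero (h.eq_zero_of_polar (hu0 t) (a := 1) (b := t) (by simpa using hu t) h2 h0).1
  have horth : ∀ s t, s ≠ t → QuadraticMap.polar q₂ (u s) (u t) = 0 := fun s t hst => by
    have h1 := hu s (u t)
    have h2 := hu t (u s)
    rw [QuadraticMap.polar_comm q₁, QuadraticMap.polar_comm q₂] at h2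
    have h3 : (s - t) * QuadraticMap.polar q₂ (u s) (u t) = 0 := by linear_combination h1 - h2
    exact (mul_eq_zero.1 h3).resolve_left (sub_ne_zero.2 hst)
  have hli : LinearIndependent ℂ u := by
    refine LinearMap.linearIndependent_of_isOrthoᵢ (B := q₂.polarBilin) ?_ fun t ht => ?_
    · exact fun s t hst => horth s t hst
    · have : QuadraticMap.polar q₂ (u t) (u t) = 0 := ht
      rw [polar_self] at this
      exact hne t (by simpa using this)
  have := hli.finite
  exact not_finite ℂ

/-- The endomorphism that represents `q₂` with respect to the nondegenerate form `q₁` has simple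
spectrum, because its eigenvectors are not isotropic for `q₁`. -/
theorem Presents.exists_eigenvalues (h : Presents q₁ q₂ X) (hd : ¬ IsDegenerate q₁) {N : ℕ}
    (hN : Module.finrank ℂ V = N) :
    ∃ lam : Fin N → ℂ, Function.Injective lam ∧ ∀ i, IsDegenerate (q₂ - lam i • q₁) := by
  obtain ⟨A, hA⟩ := exists_endomorphism hd q₂
  have hiso : ∀ (c : ℂ) (u : V), A u = c • u → q₁ u = 0 → u = 0 := by
    intro c u hu h1
    by_contra h0
    have hpol : ∀ v, QuadraticMap.polar q₂ u v = c * QuadraticMap.polar q₁ u v := fun v => by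
      rw [hA, hu, QuadraticMap.polar_smul_left, smul_eq_mul]
    have h2 : q₂ u = 0 := by
      have := hpol u
      rw [polar_self, polar_self, h1] at this
      simpa using this
    exact one_ne_zero (h.eq_zero_of_polar h0 (a := -c) (b := 1)
      (fun v => by rw [hpol]; ring) h1 h2).2
  have hself : ∀ u v, QuadraticMap.polar q₁ (A u) v = QuadraticMap.polar q₁ (A v) u := fun u v => by
    rw [← hA, ← hA, QuadraticMap.polar_comm]
  have hsq : ∀ (c : ℂ) (w : V), A (A w - c • w) = c • (A w - c • w) → A w = c • w := by
    intro c w hw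
    refine sub_eq_zero.1 (hiso c _ hw ?_)
    have : QuadraticMap.polar q₁ (A w - c • w) (A w - c • w) = 0 := by
      conv_lhs => rw [QuadraticMap.polar_sub_left, QuadraticMap.polar_smul_left, hself w]
      rw [hw, QuadraticMap.polar_smul_left, QuadraticMap.polar_comm q₁ w, sub_self]
    rw [polar_self] at this
    simpa using this
  have hgen : ∀ c : ℂ, A.maxGenEigenspace c ≤ A.eigenspace c := by
    intro c w hw
    obtain ⟨k, hk⟩ := (Module.End.mem_maxGenEigenspace A c w).1 hw
    rw [Module.End.mem_eigenspace_iff]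
    induction k with
    | zero =>
      have : w = 0 := by simpa using hk
      simp [this]
    | succ k ih =>
      rcases k with _ | k
      · rw [zero_add, pow_one] at hk
        simpa [sub_eq_zero] using hk
      · refine ih ?_
        set z := ((A - c • (1 : Module.End ℂ V)) ^ k) w with hz
        have e₁ : ((A - c • (1 : Module.End ℂ V)) ^ (k + 1)) w = A z - c • z := by
          rw [pow_succ', Module.End.mul_apply, ← hz]
          simp
        have e₂ : ((A - c • (1 : Module.End ℂ V)) ^ (k + 1 + 1)) w
            = A (A z - c • z) - c • (A z - c • z) := by
          rw [pow_succ', Module.End.mul_apply, e₁]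
          simp
        rw [e₂, sub_eq_zero] at hk
        rw [e₁, sub_eq_zero]
        exact hsq c z hk
  have hone : ∀ (c : ℂ) (u v : V), A u = c • u → A v = c • v → u ≠ 0 → v ∈ Submodule.span ℂ {u} := by
    intro c u v hu hv hu0
    have hne : q₁ u ≠ 0 := fun h0 => hu0 (hiso c u hu h0)
    set r := QuadraticMap.polar q₁ u v / (2 * q₁ u) with hr
    set v' := v - r • u with hv'
    have horth : QuadraticMap.polar q₁ u v' = 0 := by
      rw [hv', QuadraticMap.polar_sub_right, QuadraticMap.polar_smul_right, polar_self, hr, smul_eq_mul]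
      field_simp
      ring
    have hAv' : A v' = c • v' := by
      rw [hv', map_sub, map_smul, hu, hv, smul_sub, smul_comm]
    have hv0 : v' = 0 := by
      by_contra hv0
      have hne' : q₁ v' ≠ 0 := fun h0 => hv0 (hiso c v' hAv' h0)
      obtain ⟨s, hs⟩ := IsAlgClosed.exists_pow_nat_eq (-q₁ u / q₁ v') (n := 2) two_pos
      have e₁ : q₁ (u + s • v') = 0 := by
        have : q₁ (u + s • v') = q₁ u + q₁ (s • v') + QuadraticMap.polar q₁ u (s • v') := by
          simp only [QuadraticMap.polar]; ring
        rw [this, QuadraticMap.map_smul, QuadraticMap.polar_smul_right, horth, ← sq, hs, smul_eq_mul]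
        field_simp
        simp
      have e₂ := hiso c _ (by rw [map_add, map_smul, hu, hAv', smul_add, smul_comm]) e₁
      have e₃ := congrArg (QuadraticMap.polar q₁ u) e₂
      rw [QuadraticMap.polar_add_right, QuadraticMap.polar_smul_right, horth, polar_self,
        QuadraticMap.polar_zero_right] at e₃
      exact hne (by simpa using e₃)
    exact Submodule.mem_span_singleton.2 ⟨r, (sub_eq_zero.1 hv0).symm⟩
  choose u hu using fun c : {c // A.HasEigenvalue c} => c.2.exists_hasEigenvector
  have hli : LinearIndependent ℂ u :=
    A.eigenvectors_linearIndependent' _ Subtype.coe_injective u hu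
  have hspan : ⊤ ≤ Submodule.span ℂ (Set.range u) := by
    rw [← Module.End.iSup_maxGenEigenspace_eq_top A]
    refine iSup_le fun c => (hgen c).trans fun v hv => ?_
    by_cases hv0 : v = 0
    · rw [hv0]
      exact zero_mem _
    · have hc : A.HasEigenvalue c := Module.End.hasEigenvalue_of_hasEigenvector ⟨hv, hv0⟩
      have := hone c (u ⟨c, hc⟩) v (hu ⟨c, hc⟩).apply_eq_smul (Module.End.mem_eigenspace_iff.1 hv)
        (hu ⟨c, hc⟩).2
      exact Submodule.span_mono (by rintro _ rfl; exact ⟨_, rfl⟩) this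
  let b := Module.Basis.mk hli hspan
  have hfin : Finite {c // A.HasEigenvalue c} := hli.finite
  have : Fintype {c // A.HasEigenvalue c} := Fintype.ofFinite _
  have hcard := Module.finrank_eq_card_basis b
  rw [hN] at hcard
  let e := (Fintype.equivFinOfCardEq hcard.symm).symm
  refine ⟨fun i => e i, fun i j hij => e.injective (Subtype.ext hij), fun i =>
    ⟨u (e i), (hu (e i)).2, fun v => ?_⟩⟩
  rw [polar_sub_smul, hA, (hu (e i)).apply_eq_smul, QuadraticMap.polar_smul_left, smul_eq_mul, sub_self]

/-- `X` is the intersection of the quadrics `∑ yᵢ² = 0` and `∑ λᵢ yᵢ² = 0` in the linear coordinates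
given by `e`. -/
structure DiagonalPresentation {N : ℕ} (X : Set (ℙ ℂ V)) (e : (Fin N → ℂ) ≃ₗ[ℂ] V) (lam : Fin N → ℂ)
    (q₁ q₂ : QuadraticForm ℂ V) : Prop where
  presents : Presents q₁ q₂ X
  injective : Function.Injective lam
  pullback_fst : pullback (e : (Fin N → ℂ) →ₗ[ℂ] V) q₁ = diagForm 1
  pullback_snd : pullback (e : (Fin N → ℂ) →ₗ[ℂ] V) q₂ = diagForm lam

theorem IsNonsingularIntersection.exists_diagonalPresentation (h : IsNonsingularIntersection X)
    {N : ℕ} (hN : Module.finrank ℂ V = N) :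
    ∃ (e : (Fin N → ℂ) ≃ₗ[ℂ] V) (lam : Fin N → ℂ) (q₁ q₂ : QuadraticForm ℂ V),
      DiagonalPresentation X e lam q₁ q₂ := by
  obtain ⟨q₁, q₂, hX, hs⟩ := h
  have h0 : Presents q₁ q₂ X := ⟨hX, hs⟩
  obtain ⟨t, ht⟩ := h0.exists_nondegenerate
  have h1 := h0.add_smul t
  obtain ⟨lam, hinj, hdeg⟩ := h1.exists_eigenvalues ht hN
  obtain ⟨e, e₁, e₂⟩ := exists_simultaneous_diagonalization hN ht hinj hdeg
  exact ⟨e, lam, _, _, h1, hinj, e₁, e₂⟩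

end Diagonalization

/-! ### Lagrange interpolation at the nodes -/

section Nodes

open Polynomial

/-- The derivative at `λⱼ` of the polynomial with roots `λₖ`. -/
def nodeDeriv {N : ℕ} (lam : Fin N → ℂ) (j : Fin N) : ℂ := ∏ k ∈ Finset.univ.erase j, (lam j - lam k)

theorem nodeDeriv_ne_zero {N : ℕ} {lam : Fin N → ℂ} (h : Function.Injective lam) (j : Fin N) :
    nodeDeriv lam j ≠ 0 :=
  Finset.prod_ne_zero_iff.2 fun _ hk => sub_ne_zero.2 (h.ne (Finset.ne_of_mem_erase hk).symm)

/-- Lagrange interpolation: the divided difference of a polynomial of low degree vanishes. -/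
theorem sum_eval_div_nodeDeriv {N : ℕ} {lam : Fin N → ℂ} (h : Function.Injective lam) {p : ℂ[X]}
    (hp : p.natDegree + 1 < N) : ∑ j, p.eval (lam j) / nodeDeriv lam j = 0 := by
  have hcard : (Finset.univ : Finset (Fin N)).card = N := by simp
  have h1 := Lagrange.coeff_eq_sum (s := Finset.univ) (v := lam) h.injOn (P := p) (by
    rw [hcard]
    exact lt_of_le_of_lt degree_le_natDegree (by exact_mod_cast (by omega : p.natDegree < N)))
  rw [hcard, coeff_eq_zero_of_natDegree_lt (by omega)] at h1
  exact h1.symm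

theorem sum_inv_ne_zero {N : ℕ} (hN : 0 < N) {lam : Fin N → ℂ} (h : Function.Injective lam) {s : ℂ}
    (hs : ∀ j, s ≠ lam j) : ∑ j, 1 / ((lam j - s) * nodeDeriv lam j) ≠ 0 := by
  have : Nonempty (Fin N) := ⟨⟨0, hN⟩⟩
  have h1 := Lagrange.sum_nodalWeight_mul_inv_sub_ne_zero (s := Finset.univ) (v := lam) h.injOn
    (x := s) (fun i _ => hs i) Finset.univ_nonempty
  intro h0
  refine h1 ?_
  rw [← neg_eq_zero, ← Finset.sum_neg_distrib, ← h0]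
  refine Finset.sum_congr rfl fun j _ => ?_
  have h2 : Lagrange.nodalWeight Finset.univ lam j = (nodeDeriv lam j)⁻¹ := by
    rw [Lagrange.nodalWeight, nodeDeriv, Finset.prod_inv_distrib]
  have h3 := nodeDeriv_ne_zero h j
  have h4 : lam j - s ≠ 0 := sub_ne_zero.2 (hs j).symm
  have h5 : s - lam j ≠ 0 := sub_ne_zero.2 (hs j)
  rw [h2, ← neg_sub s]
  field_simp

theorem natDegree_prod_X_sub_C {ι : Type*} (s : Finset ι) (t : ι → ℂ) :
    (∏ i ∈ s, (X - C (t i))).natDegree = s.card := by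
  rw [natDegree_prod_of_monic _ _ fun i _ => monic_X_sub_C _]
  simp

variable {n : ℕ} {lam : Fin (n + 3) → ℂ} {t : Fin n → ℂ} {x : Fin (n + 3) → ℂ}

/-- The coordinates `xⱼ` satisfy `xⱼ² = P(λⱼ) / ω'(λⱼ)`, where `P` and `ω` are the monic
polynomials with roots `tᵢ` and `λⱼ`. -/
structure HasSpectrum (lam : Fin (n + 3) → ℂ) (t : Fin n → ℂ) (x : Fin (n + 3) → ℂ) : Prop where
  injective_nodes : Function.Injective lam
  injective : Function.Injective t
  ne : ∀ i j, t i ≠ lam j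
  sq_eq : ∀ j, x j ^ 2 = (∏ i, (lam j - t i)) / nodeDeriv lam j

namespace HasSpectrum

theorem ne_zero (h : HasSpectrum lam t x) (j : Fin (n + 3)) : x j ≠ 0 := fun h0 => by
  have := h.sq_eq j
  rw [h0, zero_pow two_ne_zero, eq_comm, div_eq_zero_iff] at this
  rcases this with h1 | h1
  · obtain ⟨i, -, hi⟩ := Finset.prod_eq_zero_iff.1 h1
    exact h.ne i j (sub_eq_zero.1 hi).symm
  · exact nodeDeriv_ne_zero h.injective_nodes j h1

theorem sum_sq (h : HasSpectrum lam t x) : ∑ j, x j ^ 2 = 0 := by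
  have := sum_eval_div_nodeDeriv h.injective_nodes (p := ∏ i, (X - C (t i)))
    (by rw [natDegree_prod_X_sub_C]; simp)
  rw [← this]
  exact Finset.sum_congr rfl fun j _ => by rw [h.sq_eq, eval_prod]; simp

theorem sum_mul_sq (h : HasSpectrum lam t x) : ∑ j, lam j * x j ^ 2 = 0 := by
  have := sum_eval_div_nodeDeriv h.injective_nodes (p := X * ∏ i, (X - C (t i)))
    (by rw [natDegree_X_mul (Monic.ne_zero (monic_prod_of_monic _ _ fun i _ => monic_X_sub_C _)),
          natDegree_prod_X_sub_C]; simp)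
  rw [← this]
  exact Finset.sum_congr rfl fun j _ => by
    rw [h.sq_eq, eval_mul, eval_prod, mul_div_assoc]; simp

theorem sum_sq_div (h : HasSpectrum lam t x) (i : Fin n) : ∑ j, x j ^ 2 / (lam j - t i) = 0 := by
  have := sum_eval_div_nodeDeriv h.injective_nodes (p := ∏ k ∈ Finset.univ.erase i, (X - C (t k)))
    (by rw [natDegree_prod_X_sub_C, Finset.card_erase_of_mem (Finset.mem_univ i)]; simp; omega)
  rw [← this]
  refine Finset.sum_congr rfl fun j _ => ?_
  have h1 : lam j - t i ≠ 0 := sub_ne_zero.2 (h.ne i j).symm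
  rw [h.sq_eq, eval_prod, ← Finset.mul_prod_erase _ _ (Finset.mem_univ i), mul_div_assoc,
    mul_div_cancel_left₀ _ h1]
  simp

/-- The sum is, up to a nonzero factor, the derivative at the simple root `tᵢ` of the rational
function `∑ xⱼ² / (λⱼ - z)`. -/
theorem sum_sq_div_sq_ne_zero (h : HasSpectrum lam t x) (i : Fin n) :
    ∑ j, x j ^ 2 / (lam j - t i) ^ 2 ≠ 0 := by
  set P : ℂ[X] := ∏ k ∈ Finset.univ.erase i, (X - C (t k)) with hP
  have hPdeg : P.natDegree + 1 = n := by
    rw [hP, natDegree_prod_X_sub_C, Finset.card_erase_of_mem (Finset.mem_univ i)]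
    have := i.pos
    simp
    omega
  obtain ⟨Q, hQ⟩ := X_sub_C_dvd_sub_C_eval (a := t i) (p := P)
  have hQdeg : Q.natDegree + 1 < n + 3 := by
    by_cases hQ0 : Q = 0
    · rw [hQ0]; simp
    · have h1 := congrArg natDegree hQ
      rw [natDegree_mul (X_sub_C_ne_zero _) hQ0, natDegree_X_sub_C, natDegree_sub_C] at h1
      omega
  have h1 := sum_eval_div_nodeDeriv h.injective_nodes hQdeg
  have h2 : ∑ j, x j ^ 2 / (lam j - t i) ^ 2
      = P.eval (t i) * ∑ j, 1 / ((lam j - t i) * nodeDeriv lam j) := by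
    rw [← sub_eq_zero, ← h1, Finset.mul_sum, ← Finset.sum_sub_distrib]
    refine Finset.sum_congr rfl fun j _ => ?_
    have h3 : lam j - t i ≠ 0 := sub_ne_zero.2 (h.ne i j).symm
    have h4 := nodeDeriv_ne_zero h.injective_nodes j
    have h5 := congrArg (eval (lam j)) hQ
    simp only [eval_sub, eval_mul, eval_X, eval_C] at h5
    have h6 : ∏ k, (lam j - t k) = (lam j - t i) * P.eval (lam j) := by
      rw [← Finset.mul_prod_erase _ _ (Finset.mem_univ i), hP, eval_prod]
      simp
    rw [h.sq_eq, h6]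
    field_simp
    linear_combination h5
  rw [h2]
  refine mul_ne_zero ?_ (sum_inv_ne_zero (by omega) h.injective_nodes fun j => h.ne i j)
  rw [hP, eval_prod]
  refine Finset.prod_ne_zero_iff.2 fun k hk => ?_
  simpa [sub_eq_zero] using h.injective.ne (Finset.ne_of_mem_erase hk).symm

end HasSpectrum

end Nodes

/-! ### Moduli of points with given spectrum -/

section Spectrum

variable {V : Type*} [NormedAddCommGroup V] [NormedSpace ℂ V]
  {q₁ q₂ : QuadraticForm ℂ V} {X : Set (ℙ ℂ V)} {n : ℕ} {e : (Fin (n + 3) → ℂ) ≃ₗ[ℂ] V}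
  {lam : Fin (n + 3) → ℂ} {t : Fin n → ℂ} {x : Fin (n + 3) → ℂ}

namespace DiagonalPresentation

theorem apply_fst (h : DiagonalPresentation X e lam q₁ q₂) (y : Fin (n + 3) → ℂ) :
    q₁ (e y) = ∑ j, y j ^ 2 := by
  have := DFunLike.congr_fun h.pullback_fst y
  simp only [diagForm_apply, Pi.one_apply, one_mul] at this
  exact this

theorem apply_snd (h : DiagonalPresentation X e lam q₁ q₂) (y : Fin (n + 3) → ℂ) :
    q₂ (e y) = ∑ j, lam j * y j ^ 2 := by
  have := DFunLike.congr_fun h.pullback_snd y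
  rw [diagForm_apply] at this
  exact this

theorem polar_fst (h : DiagonalPresentation X e lam q₁ q₂) (y z : Fin (n + 3) → ℂ) :
    QuadraticMap.polar q₁ (e y) (e z) = 2 * ∑ j, y j * z j := by
  have := polar_comp_linear q₁ (e : (Fin (n + 3) → ℂ) →ₗ[ℂ] V) y z
  rw [h.pullback_fst, polar_diagForm] at this
  simpa using this.symm

theorem polar_snd (h : DiagonalPresentation X e lam q₁ q₂) (y z : Fin (n + 3) → ℂ) :
    QuadraticMap.polar q₂ (e y) (e z) = 2 * ∑ j, lam j * (y j * z j) := by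
  have := polar_comp_linear q₂ (e : (Fin (n + 3) → ℂ) →ₗ[ℂ] V) y z
  rw [h.pullback_snd, polar_diagForm] at this
  exact this.symm

theorem mem_cone (h : DiagonalPresentation X e lam q₁ q₂) (hx : HasSpectrum lam t x) :
    e x ∈ cone X := by
  refine h.presents.mem_cone_iff.2 ⟨?_, ?_, ?_⟩
  · rw [Ne, LinearEquiv.map_eq_zero_iff]
    exact fun h0 => hx.ne_zero 0 (congrFun h0 0)
  · rw [h.apply_fst, hx.sum_sq]
  · rw [h.apply_snd, hx.sum_mul_sq]

/-- At a point whose coordinates have spectrum `tᵢ`, the vectors `(xⱼ / (λⱼ - tᵢ))ⱼ` of the affine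
tangent space are singular for the members `q₂ - tᵢ q₁` of the second fundamental form; suitably
scaled, they form a frame that diagonalizes it. -/
theorem exists_frame (h : DiagonalPresentation X e lam q₁ q₂) (hx : HasSpectrum lam t x) :
    ∃ ι : (Fin n → ℂ) →ₗ[ℂ] V, IsFrame q₁ q₂ (e x) ι ∧
      pullback ι q₁ = diagForm 1 ∧ pullback ι q₂ = diagForm t := by
  choose r hr using fun i => IsAlgClosed.exists_pow_nat_eq
    (∑ j, x j ^ 2 / (lam j - t i) ^ 2) (n := 2) two_pos
  have hr0 : ∀ i, r i ≠ 0 := fun i h0 => hx.sum_sq_div_sq_ne_zero i (by rw [← hr, h0]; simp)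
  have hne : ∀ i j, lam j - t i ≠ 0 := fun i j => sub_ne_zero.2 (hx.ne i j).symm
  let u : Fin n → (Fin (n + 3) → ℂ) := fun i j => x j / (lam j - t i)
  have hxu : ∀ i, ∑ j, x j * u i j = 0 := fun i => by
    rw [← hx.sum_sq_div i]
    exact Finset.sum_congr rfl fun j _ => by simp only [u]; ring
  have hlxu : ∀ i, ∑ j, lam j * (x j * u i j) = 0 := fun i => by
    have : ∑ j, lam j * (x j * u i j) = ∑ j, x j ^ 2 + t i * ∑ j, x j * u i j := by
      rw [Finset.mul_sum, ← Finset.sum_add_distrib]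
      refine Finset.sum_congr rfl fun j _ => ?_
      have := hne i j
      simp only [u]
      field_simp
      ring
    rw [this, hx.sum_sq, hxu, mul_zero, add_zero]
  have huu : ∀ i k, i ≠ k → ∑ j, u i j * u k j = 0 := fun i k hik => by
    have h0 : t i - t k ≠ 0 := sub_ne_zero.2 (hx.injective.ne hik)
    have : (t i - t k) * ∑ j, u i j * u k j = ∑ j, x j * u i j - ∑ j, x j * u k j := by
      rw [Finset.mul_sum, ← Finset.sum_sub_distrib]
      refine Finset.sum_congr rfl fun j _ => ?_
      have h1 := hne i j
      have h2 := hne k j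
      simp only [u]
      field_simp
      ring
    rw [hxu, hxu, sub_zero] at this
    exact (mul_eq_zero.1 this).resolve_left h0
  have hlu : ∀ i k, ∑ j, lam j * (u i j * u k j) = t i * ∑ j, u i j * u k j := fun i k => by
    have : ∑ j, lam j * (u i j * u k j) = ∑ j, x j * u k j + t i * ∑ j, u i j * u k j := by
      rw [Finset.mul_sum, ← Finset.sum_add_distrib]
      refine Finset.sum_congr rfl fun j _ => ?_
      have h1 := hne i j
      have h2 := hne k j
      simp only [u]
      field_simp
      ring
    rw [this, hxu, zero_add]
  have hself : ∀ i, ∑ j, u i j * u i j = r i ^ 2 := fun i => by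
    rw [hr]
    exact Finset.sum_congr rfl fun j _ => by rw [← sq, div_pow]
  let w : Fin n → V := fun i => (r i)⁻¹ • e (u i)
  have hw₁ : ∀ i k, QuadraticMap.polar q₁ (w i) (w k) = if i = k then 2 else 0 := fun i k => by
    simp only [w, QuadraticMap.polar_smul_left, QuadraticMap.polar_smul_right, h.polar_fst, smul_eq_mul]
    split_ifs with hik
    · subst hik
      have := hr0 i
      rw [hself]
      field_simp
    · rw [huu i k hik]
      simp
  have hw₂ : ∀ i k, QuadraticMap.polar q₂ (w i) (w k) = t i * QuadraticMap.polar q₁ (w i) (w k) :=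
    fun i k => by
      simp only [w, QuadraticMap.polar_smul_left, QuadraticMap.polar_smul_right, h.polar_fst,
        h.polar_snd, smul_eq_mul, hlu]
      ring
  have hxw₁ : ∀ i, QuadraticMap.polar q₁ (e x) (w i) = 0 := fun i => by
    simp [w, QuadraticMap.polar_smul_right, h.polar_fst, hxu]
  have hxw₂ : ∀ i, QuadraticMap.polar q₂ (e x) (w i) = 0 := fun i => by
    simp [w, QuadraticMap.polar_smul_right, h.polar_snd, hlxu]
  let ι : (Fin n → ℂ) →ₗ[ℂ] V := Fintype.linearCombination ℂ w
  have hι : ∀ y, ι y = ∑ i, y i • w i := fun y => Fintype.linearCombination_apply ℂ w y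
  have hsingle : ∀ i, ι (Pi.single i 1) = w i := fun i => by
    rw [Fintype.linearCombination_apply_single, one_smul]
  refine ⟨ι, ⟨fun y => ?_, fun y hy => ?_⟩, quadraticForm_ext_single fun i k => ?_,
    quadraticForm_ext_single fun i k => ?_⟩
  · rw [hι]
    exact sum_mem fun i _ => Submodule.smul_mem _ _ ⟨hxw₁ i, hxw₂ i⟩
  · obtain ⟨s, hs⟩ := Submodule.mem_span_singleton.1 hy
    ext k
    have h1 := congrArg (fun z => q₁.polarBilin z (w k)) hs
    simp only [map_smul, LinearMap.smul_apply, QuadraticMap.polarBilin_apply_apply, hxw₁,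
      hι, map_sum, LinearMap.sum_apply, hw₁, smul_eq_mul] at h1
    simpa using h1.symm
  · rw [polar_comp_linear, hsingle, hsingle, hw₁, polar_diagForm,
      Finset.sum_eq_single i (by intro k _ hk; simp [hk]) (by simp)]
    by_cases hik : i = k
    · simp [hik]
    · simp [hik]
  · rw [polar_comp_linear, hsingle, hsingle, hw₂, hw₁, polar_diagForm,
      Finset.sum_eq_single i (by intro k _ hk; simp [hk]) (by simp)]
    by_cases hik : i = k
    · subst hik
      simp [mul_comm]
    · simp [hik]

variable [FiniteDimensional ℂ V]

/-- At a point whose coordinates have spectrum `tᵢ`, the second fundamental form is the diagonal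
pencil with eigenvalues `tᵢ`. -/
theorem mem_moduliDomain (h : DiagonalPresentation X e lam q₁ q₂) (h2 : 2 ≤ n)
    (hx : HasSpectrum lam t x) {M : Set (ℙ ℂ V)} (hM : IsEuclideanOpenIn M X) (hv : e x ≠ 0)
    (hmem : Projectivization.mk ℂ (e x) hv ∈ M) :
    ∃ hd : Projectivization.mk ℂ (e x) hv ∈ moduliDomain n M,
      moduliMap n M ⟨_, hd⟩ = diagClass h2 t hx.injective := by
  obtain ⟨ι, hι, h₁, h₂⟩ := h.exists_frame hx
  have hn : Module.finrank ℂ V = n + 3 := by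
    rw [← e.finrank_eq, Module.finrank_fin_fun]
  have hns := isNonsingularPencil_diagForm h2 hx.injective
  rw [← h₁, ← h₂] at hns
  refine ⟨(mem_moduliDomain_iff h.presents hM hn hmem hv rfl hι).2 hns, ?_⟩
  rw [moduliMap_eq h.presents hM hn hv hι _ rfl hns]
  unfold diagClass
  congr 2
  rw [h₁, h₂]

theorem surjective_moduliMap (h : DiagonalPresentation X e lam q₁ q₂) (h2 : 2 ≤ n) :
    Function.Surjective (moduliMap n X) := by
  intro c
  obtain ⟨t, ht, rfl⟩ := exists_eq_diagClass h2 c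
  -- A translation of the eigenvalues makes them different from the `λⱼ`.
  obtain ⟨s, hs⟩ := (Set.finite_range fun p : Fin n × Fin (n + 3) => lam p.2 - t p.1).infinite_compl.nonempty
  have ht' : Function.Injective fun i => t i + s := fun i j hij => ht (add_right_cancel hij)
  choose x hx using fun j => IsAlgClosed.exists_pow_nat_eq
    ((∏ i, (lam j - (t i + s))) / nodeDeriv lam j) (n := 2) two_pos
  have hsp : HasSpectrum lam (fun i => t i + s) x :=
    ⟨h.injective, ht', fun i j hij => hs ⟨(i, j), by simp [← hij]⟩, hx⟩
  obtain ⟨hv, hm⟩ := h.mem_cone hsp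
  obtain ⟨hd, heq⟩ := h.mem_moduliDomain h2 hsp (isEuclideanOpenIn_self X) hv hm
  exact ⟨⟨_, hd⟩, by rw [heq, diagClass_add h2 t ht s]⟩

end DiagonalPresentation

end Spectrum

/-! ### Coefficients of polynomials as local parameters -/

section Charts

theorem sqrt_sq (z : ℂ) : Complex.sqrt z ^ 2 = z := by
  simp [Complex.sqrt]

theorem sqrt_re_pos {z : ℂ} (hz : z ∈ Complex.slitPlane) : 0 < (Complex.sqrt z).re := by
  rw [Complex.sqrt, Complex.cpow_inv_two_re]
  refine Real.sqrt_pos.2 (half_pos ?_)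
  rcases Complex.mem_slitPlane_iff.1 hz with h | h
  · have := norm_nonneg z
    linarith
  · have := (abs_lt.1 (Complex.abs_re_lt_norm.2 h)).1
    linarith

theorem sqrt_ne_zero {z : ℂ} (hz : z ∈ Complex.slitPlane) : Complex.sqrt z ≠ 0 := fun h => by
  have := sqrt_re_pos hz
  rw [h] at this
  simp at this

theorem eq_of_sq_eq_of_re_pos {z w : ℂ} (h : z ^ 2 = w ^ 2) (hz : 0 < z.re) (hw : 0 < w.re) :
    z = w := by
  rcases sq_eq_sq_iff_eq_or_eq_neg.1 h with h | h
  · exact h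
  · rw [h, Complex.neg_re] at hz
    linarith

theorem analyticAt_sqrt {z : ℂ} (hz : z ∈ Complex.slitPlane) : AnalyticAt ℂ Complex.sqrt z :=
  analyticAt_id.cpow analyticAt_const hz

/-- The value at `z` of the monic polynomial of degree `n` with lower coefficients `a`. -/
def monicEval {n : ℕ} (a : Fin n → ℂ) (z : ℂ) : ℂ := z ^ n + ∑ k, a k * z ^ (k : ℕ)

theorem analyticAt_monicEval {n : ℕ} (z : ℂ) (a : Fin n → ℂ) :
    AnalyticAt ℂ (fun a : Fin n → ℂ => monicEval a z) a := by
  refine analyticAt_const.add (Finset.analyticAt_fun_sum _ fun k _ => ?_)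
  exact ((ContinuousLinearMap.proj (R := ℂ) (φ := fun _ : Fin n => ℂ) k).analyticAt a).mul
    analyticAt_const

variable {n : ℕ}

/-- The parameters near `a₀` for which the values of the monic polynomial at the nodes have the
principal branch of the square root relative to those for `a₀`. -/
def branchDomain (lam : Fin (n + 3) → ℂ) (a₀ : Fin n → ℂ) : Set (Fin n → ℂ) :=
  {a | ∀ j, monicEval a (lam j) / monicEval a₀ (lam j) ∈ Complex.slitPlane}

/-- The branches with values `rⱼ` at `a₀` of the square roots of the normalized values
`P(λⱼ) / ω'(λⱼ)` of the monic polynomial `P` with lower coefficients `a`; here `rⱼ` is meant to be a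
square root of the normalized value for `a₀`. -/
def chart (lam : Fin (n + 3) → ℂ) (a₀ : Fin n → ℂ) (r : Fin (n + 3) → ℂ) (a : Fin n → ℂ) :
    Fin (n + 3) → ℂ :=
  fun j => r j * Complex.sqrt (monicEval a (lam j) / monicEval a₀ (lam j))

/-- Coefficients of polynomials of degree at most `n` are sent to the normalized values at the nodes. -/
def nodeValues (lam : Fin (n + 3) → ℂ) : (Fin (n + 1) → ℂ) →ₗ[ℂ] (Fin (n + 3) → ℂ) where
  toFun b j := (∑ k, b k * lam j ^ (k : ℕ)) / nodeDeriv lam j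
  map_add' b c := by
    ext j
    simp only [Pi.add_apply, add_mul, Finset.sum_add_distrib, add_div]
  map_smul' s b := by
    ext j
    simp only [Pi.smul_apply, smul_eq_mul, mul_assoc, ← Finset.mul_sum, mul_div_assoc, RingHom.id_apply]

theorem nodeValues_apply (lam : Fin (n + 3) → ℂ) (b : Fin (n + 1) → ℂ) (j : Fin (n + 3)) :
    nodeValues lam b j = (∑ k, b k * lam j ^ (k : ℕ)) / nodeDeriv lam j := rfl

theorem nodeValues_snoc (lam : Fin (n + 3) → ℂ) (a : Fin n → ℂ) (j : Fin (n + 3)) :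
    nodeValues lam (Fin.snoc a 1 : Fin (n + 1) → ℂ) j = monicEval a (lam j) / nodeDeriv lam j := by
  rw [nodeValues_apply, Fin.sum_univ_castSucc, monicEval, add_comm]
  simp

/-- The polynomial with coefficients `b`. -/
def polyOf (b : Fin (n + 1) → ℂ) : Polynomial ℂ := ∑ k, Polynomial.C (b k) * Polynomial.X ^ (k : ℕ)

theorem natDegree_polyOf (b : Fin (n + 1) → ℂ) : (polyOf b).natDegree ≤ n :=
  Polynomial.natDegree_sum_le_of_forall_le _ _ fun k _ =>
    (Polynomial.natDegree_C_mul_X_pow_le _ _).trans (by omega)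

theorem nodeValues_eq_eval (lam : Fin (n + 3) → ℂ) (b : Fin (n + 1) → ℂ) (j : Fin (n + 3)) :
    nodeValues lam b j = (polyOf b).eval (lam j) / nodeDeriv lam j := by
  simp [nodeValues_apply, polyOf, Polynomial.eval_finsetSum]

theorem nodeValues_injective {lam : Fin (n + 3) → ℂ} (h : Function.Injective lam) :
    Function.Injective (nodeValues lam) := by
  rw [injective_iff_map_eq_zero]
  intro b hb
  have hp : polyOf b = 0 := by
    refine Polynomial.eq_zero_of_natDegree_lt_card_of_eval_eq_zero _ h (fun j => ?_) ?_
    · have h1 := congrFun hb j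
      rw [nodeValues_eq_eval, Pi.zero_apply, div_eq_zero_iff] at h1
      exact h1.resolve_right (nodeDeriv_ne_zero h j)
    · have := natDegree_polyOf b
      rw [Fintype.card_fin]
      omega
  ext k
  have h1 := congrArg (fun q => Polynomial.coeff q k) hp
  simp only [polyOf, Polynomial.finsetSum_coeff, Polynomial.coeff_C_mul, Polynomial.coeff_X_pow,
    Polynomial.coeff_zero] at h1
  rw [Finset.sum_eq_single k (fun i _ hik => by
    rw [if_neg (fun h => hik (Fin.ext h.symm)), mul_zero]) (by simp)] at h1
  simpa using h1

theorem sum_nodeValues {lam : Fin (n + 3) → ℂ} (h : Function.Injective lam) (b : Fin (n + 1) → ℂ) :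
    ∑ j, nodeValues lam b j = 0 := by
  have hdeg := natDegree_polyOf b
  rw [← sum_eval_div_nodeDeriv h (p := polyOf b) (by omega)]
  exact Finset.sum_congr rfl fun j _ => nodeValues_eq_eval lam b j

theorem sum_mul_nodeValues {lam : Fin (n + 3) → ℂ} (h : Function.Injective lam)
    (b : Fin (n + 1) → ℂ) : ∑ j, lam j * nodeValues lam b j = 0 := by
  have hdeg := natDegree_polyOf b
  have hdeg' := Polynomial.natDegree_mul_le (p := Polynomial.X) (q := polyOf b)
  rw [Polynomial.natDegree_X] at hdeg'
  rw [← sum_eval_div_nodeDeriv h (p := Polynomial.X * polyOf b) (by omega)]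
  refine Finset.sum_congr rfl fun j _ => ?_
  rw [nodeValues_eq_eval, Polynomial.eval_mul, Polynomial.eval_X, mul_div_assoc]

/-- Lagrange interpolation: vectors with vanishing moments of order `0` and `1` come from
polynomials of degree at most `n`. -/
theorem exists_nodeValues_eq {lam : Fin (n + 3) → ℂ} (h : Function.Injective lam)
    {y : Fin (n + 3) → ℂ} (h0 : ∑ j, y j = 0) (h1 : ∑ j, lam j * y j = 0) :
    ∃ b, nodeValues lam b = y := by
  classical
  let p := Lagrange.interpolate Finset.univ lam (fun j => nodeDeriv lam j * y j)
  have hcard : (Finset.univ : Finset (Fin (n + 3))).card = n + 3 := by simp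
  have hev : ∀ j, p.eval (lam j) = nodeDeriv lam j * y j := fun j =>
    Lagrange.eval_interpolate_at_node _ h.injOn (Finset.mem_univ j)
  have hdeg : p.degree < ((n + 3 : ℕ) : WithBot ℕ) := by
    have := Lagrange.degree_interpolate_lt (s := Finset.univ) (v := lam)
      (fun j => nodeDeriv lam j * y j) h.injOn
    rwa [hcard] at this
  have hdeg3 : p.natDegree < n + 3 := by
    by_cases hp0 : p = 0
    · rw [hp0]; simp
    · exact (Polynomial.natDegree_lt_iff_degree_lt hp0).2 hdeg
  have hc2 : p.coeff (n + 2) = 0 := by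
    have := Lagrange.coeff_eq_sum (s := Finset.univ) (v := lam) h.injOn (P := p) (by rwa [hcard])
    rw [hcard] at this
    refine this.trans (h0 ▸ Finset.sum_congr rfl fun j _ => ?_)
    rw [hev]
    exact mul_div_cancel_left₀ _ (nodeDeriv_ne_zero h j)
  have hdeg2 : p.natDegree < n + 2 := by
    by_contra hc
    have : p.natDegree = n + 2 := by omega
    rw [← this] at hc2
    have hp0 : p = 0 := Polynomial.leadingCoeff_eq_zero.1 hc2
    rw [hp0] at this
    simp at this
  have hc1 : p.coeff (n + 1) = 0 := by
    have := Lagrange.coeff_eq_sum (s := Finset.univ) (v := lam) h.injOn (P := Polynomial.X * p) (by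
      rw [hcard]
      refine lt_of_le_of_lt Polynomial.degree_le_natDegree ?_
      have : (Polynomial.X * p).natDegree < n + 3 :=
        lt_of_le_of_lt Polynomial.natDegree_mul_le (by rw [Polynomial.natDegree_X]; omega)
      exact_mod_cast this)
    rw [hcard, show n + 3 - 1 = n + 1 + 1 from rfl, Polynomial.coeff_X_mul] at this
    refine this.trans (h1 ▸ Finset.sum_congr rfl fun j _ => ?_)
    rw [Polynomial.eval_mul, Polynomial.eval_X, hev, mul_left_comm]
    exact mul_div_cancel_left₀ _ (nodeDeriv_ne_zero h j)
  have hdeg1 : p.natDegree < n + 1 := by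
    by_contra hc
    have : p.natDegree = n + 1 := by omega
    rw [← this] at hc1
    have hp0 : p = 0 := Polynomial.leadingCoeff_eq_zero.1 hc1
    rw [hp0] at this
    simp at this
  refine ⟨fun k => p.coeff k, ?_⟩
  ext j
  rw [nodeValues_apply, div_eq_iff (nodeDeriv_ne_zero h j), mul_comm (y j), ← hev,
    Polynomial.eval_eq_sum_range' hdeg1, Finset.sum_range]

theorem exists_nodeValues_inverse {lam : Fin (n + 3) → ℂ} (h : Function.Injective lam) :
    ∃ R : (Fin (n + 3) → ℂ) →ₗ[ℂ] (Fin (n + 1) → ℂ), (∀ b, R (nodeValues lam b) = b) ∧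
      ∀ y, ∑ j, y j = 0 → ∑ j, lam j * y j = 0 → nodeValues lam (R y) = y := by
  obtain ⟨R, hR⟩ := (nodeValues lam).exists_leftInverse_of_injective
    (LinearMap.ker_eq_bot.2 (nodeValues_injective h))
  have hR' : ∀ b, R (nodeValues lam b) = b := fun b => LinearMap.congr_fun hR b
  refine ⟨R, hR', fun y h0 h1 => ?_⟩
  obtain ⟨b, rfl⟩ := exists_nodeValues_eq h h0 h1
  rw [hR']

variable {lam : Fin (n + 3) → ℂ} {a₀ : Fin n → ℂ} {r : Fin (n + 3) → ℂ} {a : Fin n → ℂ}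

theorem monicEval_ne_zero_of_mem (ha : a ∈ branchDomain lam a₀) (j : Fin (n + 3)) :
    monicEval a (lam j) ≠ 0 := fun h => by
  have := ha j
  rw [h, zero_div] at this
  exact Complex.zero_notMem_slitPlane this

theorem analyticAt_chart (ha : a ∈ branchDomain lam a₀) : AnalyticAt ℂ (chart lam a₀ r) a := by
  rw [analyticAt_pi_iff]
  intro j
  exact analyticAt_const.mul (AnalyticAt.fun_comp
    (f := fun a => monicEval a (lam j) / monicEval a₀ (lam j)) (analyticAt_sqrt (ha j))
    (analyticAt_monicEval (lam j) a).div_const)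

theorem isOpen_branchDomain : IsOpen (branchDomain lam a₀) := by
  have : branchDomain lam a₀ = ⋂ j, (fun a => monicEval a (lam j) / monicEval a₀ (lam j)) ⁻¹'
      Complex.slitPlane := by
    ext a
    simp [branchDomain]
  rw [this]
  refine isOpen_iInter_of_finite fun j => Complex.isOpen_slitPlane.preimage ?_
  exact continuous_iff_continuousAt.2 fun a => (analyticAt_monicEval (lam j) a).div_const.continuousAt

theorem self_mem_branchDomain (h : ∀ j, monicEval a₀ (lam j) ≠ 0) : a₀ ∈ branchDomain lam a₀ :=
  fun j => by
    rw [div_self (h j)]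
    exact Complex.one_mem_slitPlane

theorem chart_sq (h : ∀ j, monicEval a₀ (lam j) ≠ 0)
    (hr : ∀ j, r j ^ 2 = monicEval a₀ (lam j) / nodeDeriv lam j) (a : Fin n → ℂ) (j : Fin (n + 3)) :
    chart lam a₀ r a j ^ 2 = monicEval a (lam j) / nodeDeriv lam j := by
  have := h j
  rw [chart, mul_pow, sqrt_sq, hr]
  field_simp

end Charts

/-! ### Charts of subsets of projective space -/

section ProjectiveCharts

variable {A V : Type*} [NormedAddCommGroup A] [NormedSpace ℂ A] [NormedAddCommGroup V]
  [NormedSpace ℂ V]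

/-- The set of the lines spanned by the nonzero vectors `G a` with `a ∈ U`. -/
def projImage (G : A → V) (U : Set A) : Set (ℙ ℂ V) :=
  {x | ∃ a ∈ U, ∃ h : G a ≠ 0, Projectivization.mk ℂ (G a) h = x}

/-- The map `a ↦ [G a]` is an injective holomorphic map on `U` whose inverse is induced by the
holomorphic map `k` on the affine cone. -/
structure IsProjChart (G : A → V) (k : V → A) (U : Set A) : Prop where
  ne_zero : ∀ a ∈ U, G a ≠ 0
  analyticAt : ∀ a ∈ U, AnalyticAt ℂ G a
  analyticAt_inv : ∀ a ∈ U, ∀ s : ℂ, s ≠ 0 → AnalyticAt ℂ k (s • G a)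
  inv : ∀ a ∈ U, ∀ s : ℂ, s ≠ 0 → k (s • G a) = a

variable {G H : A → V} {k l : V → A} {U : Set A}

theorem IsProjChart.mk_mem (h : IsProjChart G k U) {a : A} (ha : a ∈ U) :
    Projectivization.mk ℂ (G a) (h.ne_zero a ha) ∈ projImage G U :=
  ⟨a, ha, h.ne_zero a ha, rfl⟩

theorem exists_smul_of_mk_eq {v w : V} {hv : v ≠ 0} {hw : w ≠ 0}
    (h : Projectivization.mk ℂ v hv = Projectivization.mk ℂ w hw) : ∃ s : ℂ, s ≠ 0 ∧ v = s • w := by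
  obtain ⟨s, hs⟩ := (Projectivization.mk_eq_mk_iff _ _ _ _ _).1 h
  exact ⟨s, s.ne_zero, hs.symm⟩

/-- The bijection between the parameters and the points of a chart. -/
def IsProjChart.equiv (h : IsProjChart G k U) : U ≃ projImage G U :=
  Equiv.ofBijective (fun a => ⟨Projectivization.mk ℂ (G a) (h.ne_zero a a.2), h.mk_mem a.2⟩) (by
    constructor
    · rintro ⟨a, ha⟩ ⟨b, hb⟩ hab
      obtain ⟨s, hs, hsab⟩ := exists_smul_of_mk_eq (congrArg Subtype.val hab)
      have h1 := h.inv a ha 1 one_ne_zero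
      simp only at hsab
      rw [one_smul, hsab, h.inv b hb s hs] at h1
      exact Subtype.ext h1.symm
    · rintro ⟨x, a, ha, h0, rfl⟩
      exact ⟨⟨a, ha⟩, rfl⟩)

theorem IsProjChart.equiv_coe (h : IsProjChart G k U) (a : U) :
    (h.equiv a : ℙ ℂ V) = Projectivization.mk ℂ (G a) (h.ne_zero a a.2) := rfl

/-- Points with the same parameter in two charts correspond to each other holomorphically. -/
theorem IsProjChart.isHolomorphic (h : IsProjChart G k U) (h' : IsProjChart H l U) :
    IsHolomorphic (fun x => (h'.equiv (h.equiv.symm x) : ℙ ℂ V)) := by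
  have key : ∀ v (hv : v ∈ cone (projImage G U)), ∃ a : U, ∃ s : ℂ, s ≠ 0 ∧ v = s • G a ∧
      h.equiv a = cone.toProj ⟨v, hv⟩ := by
    rintro v ⟨hv, a, ha, h0, hav⟩
    obtain ⟨s, hs, hsv⟩ := exists_smul_of_mk_eq hav.symm
    exact ⟨⟨a, ha⟩, s, hs, hsv, Subtype.ext hav⟩
  intro x
  obtain ⟨a, s, hs, hv, -⟩ := key x.1.rep (mem_cone_rep x.2)
  refine ⟨H ∘ k, ?_, Filter.Eventually.of_forall fun v hv => ?_⟩
  · refine AnalyticAt.comp ?_ (hv ▸ h.analyticAt_inv a a.2 s hs)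
    rw [hv, h.inv a a.2 s hs]
    exact h'.analyticAt a a.2
  · obtain ⟨b, s', hs', hv', hb⟩ := key v hv
    have hk : k v = b := by rw [hv', h.inv b b.2 s' hs']
    have hF : (H ∘ k) v = H b := congrArg H hk
    refine ⟨by rw [hF]; exact h'.ne_zero b b.2, ?_⟩
    dsimp only
    rw [← hb, Equiv.symm_apply_apply, h'.equiv_coe]
    congr 1

theorem IsProjChart.isBiholomorphic (h : IsProjChart G k U) (h' : IsProjChart H l U) :
    IsBiholomorphic (h.equiv.symm.trans h'.equiv) :=
  ⟨h.isHolomorphic h', h'.isHolomorphic h⟩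

theorem IsProjChart.isConnected (h : IsProjChart G k U) (hU : IsConnected U) :
    IsConnected (projImage G U) := by
  have : ConnectedSpace U := isConnected_iff_connectedSpace.1 hU
  have hcont : Continuous fun a : U => Projectivization.mk ℂ (G a) (h.ne_zero a a.2) := by
    have h1 : Continuous (Projectivization.mk' ℂ : {v : V // v ≠ 0} → ℙ ℂ V) := continuous_coinduced_rng
    have h2 : Continuous fun a : U => (⟨G a, h.ne_zero a a.2⟩ : {v : V // v ≠ 0}) := by
      refine Continuous.subtype_mk ?_ _
      exact continuous_iff_continuousAt.2 fun a =>
        (h.analyticAt a a.2).continuousAt.comp continuous_subtype_val.continuousAt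
    exact h1.comp h2
  convert isConnected_range hcont
  ext x
  constructor
  · rintro ⟨a, ha, h0, rfl⟩
    exact ⟨⟨a, ha⟩, rfl⟩
  · rintro ⟨a, rfl⟩
    exact h.mk_mem a.2

/-- The lines spanned by the nonzero vectors of an open set form an open set. -/
theorem isOpen_lines {Ω : Set V} (hΩ : IsOpen Ω) :
    IsOpen {x : ℙ ℂ V | ∃ (v : V) (hv : v ≠ 0), Projectivization.mk ℂ v hv = x ∧ v ∈ Ω} := by
  change IsOpen ((Projectivization.mk' ℂ : {v : V // v ≠ 0} → ℙ ℂ V) ⁻¹' _)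
  have : ((Projectivization.mk' ℂ : {v : V // v ≠ 0} → ℙ ℂ V) ⁻¹'
      {x : ℙ ℂ V | ∃ (v : V) (hv : v ≠ 0), Projectivization.mk ℂ v hv = x ∧ v ∈ Ω}) =
      ⋃ c : ℂˣ, (fun v : {v : V // v ≠ 0} => (c : ℂ) • (v : V)) ⁻¹' Ω := by
    ext ⟨v, hv⟩
    simp only [Set.mem_preimage, Set.mem_iUnion]
    constructor
    · rintro ⟨w, hw, hwv, hΩw⟩
      obtain ⟨c, hc⟩ := (Projectivization.mk_eq_mk_iff _ _ _ _ _).1 hwv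
      exact ⟨c, by change c • v ∈ Ω; rw [hc]; exact hΩw⟩
    · rintro ⟨c, hc⟩
      exact ⟨(c : ℂ) • v, smul_ne_zero c.ne_zero hv,
        (Projectivization.mk_eq_mk_iff _ _ _ _ _).2 ⟨c, rfl⟩, hc⟩
  rw [this]
  exact isOpen_iUnion fun c => hΩ.preimage (continuous_subtype_val.const_smul (c : ℂ))

end ProjectiveCharts

/-! ### Charts of intersections of quadrics -/

section QuadricCharts

variable {V : Type*} [NormedAddCommGroup V] [NormedSpace ℂ V] [FiniteDimensional ℂ V]
  {q₁ q₂ : QuadraticForm ℂ V} {X : Set (ℙ ℂ V)} {n : ℕ} {e : (Fin (n + 3) → ℂ) ≃ₗ[ℂ] V}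
  {lam : Fin (n + 3) → ℂ} {a₀ : Fin n → ℂ} {r : Fin (n + 3) → ℂ} {U : Set (Fin n → ℂ)}

theorem sq_smul_chart (h0 : ∀ j, monicEval a₀ (lam j) ≠ 0)
    (hr : ∀ j, r j ^ 2 = monicEval a₀ (lam j) / nodeDeriv lam j) (a : Fin n → ℂ) (s : ℂ) :
    (fun j => (s • chart lam a₀ r a) j ^ 2) =
      s ^ 2 • nodeValues lam (Fin.snoc a 1 : Fin (n + 1) → ℂ) := by
  ext j
  rw [Pi.smul_apply, Pi.smul_apply, smul_eq_mul, smul_eq_mul, mul_pow, chart_sq h0 hr, nodeValues_snoc]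

/-- The squares of the coordinates of a point of `X` determine, up to a scalar, a polynomial of
degree at most `n`; the points of `X` near a given one whose polynomial has degree `n` are
parametrized by the lower coefficients of the monic polynomial. -/
theorem DiagonalPresentation.exists_projChart (h : DiagonalPresentation X e lam q₁ q₂)
    (h0 : ∀ j, monicEval a₀ (lam j) ≠ 0)
    (hr : ∀ j, r j ^ 2 = monicEval a₀ (lam j) / nodeDeriv lam j) (hU : IsOpen U)
    (hUb : U ⊆ branchDomain lam a₀) :
    (∃ k, IsProjChart (fun a => e (chart lam a₀ r a)) k U) ∧
      IsEuclideanOpenIn (projImage (fun a => e (chart lam a₀ r a)) U) X := by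
  obtain ⟨R, hR, hR'⟩ := exists_nodeValues_inverse h.injective
  have hr0 : ∀ j, r j ≠ 0 := fun j hj => by
    have := hr j
    rw [hj, zero_pow two_ne_zero, eq_comm, div_eq_zero_iff] at this
    exact this.elim (h0 j) (nodeDeriv_ne_zero h.injective j)
  -- The coefficients of the polynomial determined by the squares of the coordinates of `v`.
  let b : V → (Fin (n + 1) → ℂ) := fun v => R fun j => (e.symm v j) ^ 2
  have hb : ∀ v, AnalyticAt ℂ b v := fun v => by
    refine ((LinearMap.toContinuousLinearMap R).analyticAt _).fun_comp ?_
    rw [analyticAt_pi_iff]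
    intro j
    exact (((ContinuousLinearMap.proj (R := ℂ) (φ := fun _ : Fin (n + 3) => ℂ) j).comp
      (LinearMap.toContinuousLinearMap (e.symm : V →ₗ[ℂ] (Fin (n + 3) → ℂ)))).analyticAt v).pow 2
  have hb' : ∀ i v, AnalyticAt ℂ (fun v => b v i) v := fun i v => analyticAt_pi_iff.1 (hb v) i
  let k : V → (Fin n → ℂ) := fun v i => b v i.castSucc / b v (Fin.last n)
  have hk : ∀ v, b v (Fin.last n) ≠ 0 → AnalyticAt ℂ k v := fun v hv => by
    rw [analyticAt_pi_iff]
    exact fun i => (hb' _ v).div (hb' _ v) hv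
  have hbG : ∀ a (s : ℂ), b (s • e (chart lam a₀ r a)) = s ^ 2 • (Fin.snoc a 1 : Fin (n + 1) → ℂ) :=
    fun a s => by
      simp only [b]
      rw [← map_smul e, LinearEquiv.symm_apply_apply,
        sq_smul_chart h0 hr, map_smul, hR]
  have hblast : ∀ a (s : ℂ), b (s • e (chart lam a₀ r a)) (Fin.last n) = s ^ 2 := fun a s => by
    rw [hbG]
    simp
  have hkG : ∀ a (s : ℂ), s ≠ 0 → k (s • e (chart lam a₀ r a)) = a := fun a s hs => by
    ext i
    simp only [k]
    rw [hblast, hbG]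
    simp [hs]
  have hre : ∀ a ∈ U, ∀ j, chart lam a₀ r a j / r j
      = Complex.sqrt (monicEval a (lam j) / monicEval a₀ (lam j)) := fun a ha j =>
    mul_div_cancel_left₀ _ (hr0 j)
  have hG0 : ∀ a ∈ U, e (chart lam a₀ r a) ≠ 0 := fun a ha => by
    rw [Ne, LinearEquiv.map_eq_zero_iff]
    intro hc
    have h1 := hre a ha 0
    rw [hc, Pi.zero_apply, zero_div] at h1
    exact sqrt_ne_zero (hUb ha 0) h1.symm
  refine ⟨⟨k, hG0, fun a ha => ?_, fun a _ s hs => ?_, fun a _ s hs => hkG a s hs⟩, ?_⟩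
  · exact ((LinearMap.toContinuousLinearMap (e : (Fin (n + 3) → ℂ) →ₗ[ℂ] V)).analyticAt _).fun_comp
      (analyticAt_chart (hUb ha))
  · refine hk _ ?_
    rw [hblast]
    exact pow_ne_zero 2 hs
  · let Ω : Set V := {v | b v (Fin.last n) ∈ Complex.slitPlane ∧ k v ∈ U ∧
      ∀ j, 0 < (e.symm v j / Complex.sqrt (b v (Fin.last n)) / r j).re}
    have hΩ : IsOpen Ω := by
      rw [isOpen_iff_mem_nhds]
      rintro v ⟨hv₁, hv₂, hv₃⟩
      have c₁ := (hb' (Fin.last n) v).continuousAt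
      have c₂ := (hk v (Complex.slitPlane_ne_zero hv₁)).continuousAt
      have c₃ : ∀ j, ContinuousAt (fun v => (e.symm v j / Complex.sqrt (b v (Fin.last n)) / r j).re) v := by
        intro j
        have c₄ : ContinuousAt (fun v => e.symm v j) v :=
          ((ContinuousLinearMap.proj (R := ℂ) (φ := fun _ : Fin (n + 3) => ℂ) j).comp
            (LinearMap.toContinuousLinearMap (e.symm : V →ₗ[ℂ] (Fin (n + 3) → ℂ)))).continuous.continuousAt
        have c₅ : ContinuousAt (fun v => Complex.sqrt (b v (Fin.last n))) v :=
          ContinuousAt.comp (f := fun v => b v (Fin.last n)) (analyticAt_sqrt hv₁).continuousAt c₁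
        exact Complex.continuous_re.continuousAt.comp ((c₄.div c₅ (sqrt_ne_zero hv₁)).div_const _)
      have ev₃ := Filter.eventually_all.2 fun j => (c₃ j).eventually (lt_mem_nhds (hv₃ j))
      filter_upwards [c₁.eventually (Complex.isOpen_slitPlane.mem_nhds hv₁),
        c₂.eventually (hU.mem_nhds hv₂), ev₃] with w h₁ h₂ h₃
      exact ⟨h₁, h₂, h₃⟩
    refine ⟨_, isOpen_lines hΩ, ?_⟩
    ext x
    constructor
    · rintro ⟨a, ha, hne, rfl⟩
      have hlast := hblast a 1
      have hka := hkG a 1 one_ne_zero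
      rw [one_smul, one_pow] at hlast
      rw [one_smul] at hka
      have hsq : ∀ j, chart lam a₀ r a j ^ 2 = nodeValues lam (Fin.snoc a 1 : Fin (n + 1) → ℂ) j :=
        fun j => by rw [chart_sq h0 hr, nodeValues_snoc]
      refine ⟨(h.presents.mem_cone_iff.2 ⟨hne, ?_, ?_⟩).snd, _, hne, rfl, ?_, ?_, fun j => ?_⟩
      · rw [h.apply_fst, ← sum_nodeValues h.injective (Fin.snoc a 1 : Fin (n + 1) → ℂ)]
        exact Finset.sum_congr rfl fun j _ => hsq j
      · rw [h.apply_snd, ← sum_mul_nodeValues h.injective (Fin.snoc a 1 : Fin (n + 1) → ℂ)]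
        exact Finset.sum_congr rfl fun j _ => by rw [hsq]
      · rw [hlast]
        exact Complex.one_mem_slitPlane
      · rw [hka]
        exact ha
      · rw [hlast, Complex.sqrt_one, div_one, LinearEquiv.symm_apply_apply, hre a ha]
        exact sqrt_re_pos (hUb ha j)
    · rintro ⟨hxX, v, hv, rfl, hv₁, hv₂, hv₃⟩
      obtain ⟨-, hz₁, hz₂⟩ := h.presents.mem_cone_iff.1 ⟨hv, hxX⟩
      obtain ⟨y, rfl⟩ := e.surjective v
      rw [h.apply_fst] at hz₁
      rw [h.apply_snd] at hz₂
      have hb₀ := Complex.slitPlane_ne_zero hv₁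
      set σ := Complex.sqrt (b (e y) (Fin.last n)) with hσ
      have hσ0 : σ ≠ 0 := sqrt_ne_zero hv₁
      have hσ2 : σ ^ 2 = b (e y) (Fin.last n) := sqrt_sq _
      have hval := hR' (fun j => y j ^ 2) hz₁ hz₂
      have hbk : b (e y) = b (e y) (Fin.last n) • (Fin.snoc (k (e y)) 1 : Fin (n + 1) → ℂ) := by
        ext i
        refine Fin.lastCases ?_ (fun i => ?_) i
        · simp
        · simp [k, mul_div_cancel₀ _ hb₀]
      have hby : b (e y) = R fun j => y j ^ 2 := by
        simp only [b, LinearEquiv.symm_apply_apply]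
      have hy : ∀ j, y j = σ * chart lam a₀ r (k (e y)) j := by
        intro j
        have h1 := congrFun hval j
        rw [← hby, hbk, map_smul, Pi.smul_apply, nodeValues_snoc, smul_eq_mul, ← hσ2,
          ← chart_sq h0 hr, ← mul_pow] at h1
        have h2 : y j / σ / r j = chart lam a₀ r (k (e y)) j / r j := by
          refine eq_of_sq_eq_of_re_pos ?_ ?_ ?_
          · rw [div_pow, div_pow, ← h1]
            field_simp
          · have := hv₃ j
            rwa [LinearEquiv.symm_apply_apply] at this
          · rw [hre _ hv₂]
            exact sqrt_re_pos (hUb hv₂ j)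
        have h3 := hr0 j
        field_simp at h2
        linear_combination h2
      refine ⟨k (e y), hv₂, hG0 _ hv₂, ?_⟩
      refine (Projectivization.mk_eq_mk_iff' _ _ _ _ _).2 ⟨σ⁻¹, ?_⟩
      rw [← map_smul]
      congr 1
      ext j
      rw [Pi.smul_apply, smul_eq_mul, hy j]
      field_simp

end QuadricCharts

/-! ### Monic polynomials with distinct roots -/

section Spectra

open Polynomial

variable {n : ℕ}

/-- The monic polynomial of degree `n` with lower coefficients `a`. -/
def monicPoly (a : Fin n → ℂ) : ℂ[X] := X ^ n + ∑ k, C (a k) * X ^ (k : ℕ)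

theorem eval_monicPoly (a : Fin n → ℂ) (z : ℂ) : (monicPoly a).eval z = monicEval a z := by
  simp [monicPoly, monicEval, eval_finsetSum]

theorem degree_sum_lt (a : Fin n → ℂ) : (∑ k, C (a k) * X ^ (k : ℕ) : ℂ[X]).degree < (n : WithBot ℕ) :=
  (degree_sum_le _ _).trans_lt ((Finset.sup_lt_iff (WithBot.bot_lt_coe n)).2 fun k _ =>
    (degree_C_mul_X_pow_le _ _).trans_lt (Nat.cast_lt.2 k.2))

theorem monic_monicPoly (a : Fin n → ℂ) : (monicPoly a).Monic := monic_X_pow_add (degree_sum_lt a)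

theorem natDegree_monicPoly (a : Fin n → ℂ) : (monicPoly a).natDegree = n := by
  refine natDegree_eq_of_degree_eq_some ?_
  rw [monicPoly, degree_add_eq_left_of_degree_lt (by rw [degree_X_pow]; exact degree_sum_lt a),
    degree_X_pow]

theorem exists_monicPoly_eq {p : ℂ[X]} (hp : p.Monic) (hn : p.natDegree = n) :
    ∃ a : Fin n → ℂ, monicPoly a = p := by
  refine ⟨fun k => p.coeff k, ?_⟩
  conv_rhs => rw [hp.as_sum, hn]
  rw [monicPoly, Finset.sum_range]

theorem exists_monicEval_eq (t : Fin n → ℂ) : ∃ a : Fin n → ℂ, ∀ z, monicEval a z = ∏ i, (z - t i) := by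
  obtain ⟨a, ha⟩ := exists_monicPoly_eq (monic_prod_of_monic Finset.univ _ fun i _ => monic_X_sub_C (t i))
    (by rw [natDegree_prod_X_sub_C]; simp : (∏ i, (X - C (t i))).natDegree = n)
  refine ⟨a, fun z => ?_⟩
  rw [← eval_monicPoly, ha, eval_prod]
  simp

theorem continuous_of_mem_polynomialFunctions {P : (Fin n → ℂ) → ℂ}
    (hP : P ∈ polynomialFunctions (Fin n → ℂ)) : Continuous P := by
  induction hP using Algebra.adjoin_induction with
  | mem x hx =>
    obtain ⟨l, rfl⟩ := hx
    exact LinearMap.continuous_of_finiteDimensional l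
  | algebraMap r => exact continuous_const
  | add x y _ _ hx hy => exact hx.add hy
  | mul x y _ _ hx hy => exact hx.mul hy

/-- The monic polynomials with distinct roots form an open set. -/
theorem isOpen_distinct_roots : IsOpen {a : Fin n → ℂ |
    ∃ t : Fin n → ℂ, Function.Injective t ∧ ∀ z, monicEval a z = ∏ i, (z - t i)} := by
  let c : Fin n → polynomialFunctions (Fin n → ℂ) := fun k =>
    ⟨_, dual_mem_polynomialFunctions (LinearMap.proj (R := ℂ) (φ := fun _ : Fin n => ℂ) k)⟩
  let p : Polynomial (polynomialFunctions (Fin n → ℂ)) := X ^ n + ∑ k, C (c k) * X ^ (k : ℕ)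
  have hpa : ∀ a, p.map (evalAt a) = monicPoly a := fun a => by
    simp only [p, Polynomial.map_add, Polynomial.map_pow, map_X, Polynomial.map_sum, Polynomial.map_mul,
      map_C, monicPoly]
    rfl
  have hp : p.natDegree ≤ n := by
    refine natDegree_add_le_of_degree_le (natDegree_X_pow_le _) ?_
    exact natDegree_sum_le_of_forall_le _ _ fun k _ =>
      (natDegree_C_mul_X_pow_le _ _).trans k.2.le
  obtain ⟨H, hH, hiff⟩ := exists_discriminant p hp
  have : {a : Fin n → ℂ | ∃ t : Fin n → ℂ, Function.Injective t ∧
      ∀ z, monicEval a z = ∏ i, (z - t i)} = {a | H a ≠ 0} := by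
    ext a
    simp only [Set.mem_ofPred_eq]
    rw [hiff, hpa]
    constructor
    · rintro ⟨t, ht, h⟩
      refine ⟨natDegree_monicPoly a, ?_⟩
      have : monicPoly a = ∏ i, (X - C (t i)) := by
        refine Polynomial.funext fun z => ?_
        rw [eval_monicPoly, h, eval_prod]
        simp
      rw [this]
      exact separable_prod_X_sub_C ht
    · rintro ⟨h1, h2⟩
      obtain ⟨t, ht, h⟩ := exists_roots_of_separable h1 h2
      refine ⟨t, ht, fun z => ?_⟩
      rw [← eval_monicPoly, h, monic_monicPoly a, eval_mul, eval_prod]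
      simp
  rw [this]
  exact isOpen_ne_fun (continuous_of_mem_polynomialFunctions hH) continuous_const

end Spectra

/-! ### Moduli-preserving biholomorphic maps -/

section Comparison

variable {V : Type*} [NormedAddCommGroup V] [NormedSpace ℂ V] [FiniteDimensional ℂ V]
  {n : ℕ} {X X' : Set (ℙ ℂ V)} {e e' : (Fin (n + 3) → ℂ) ≃ₗ[ℂ] V} {lam lam' : Fin (n + 3) → ℂ}
  {q₁ q₂ q₁' q₂' : QuadraticForm ℂ V} {a₀ : Fin n → ℂ} {r r' : Fin (n + 3) → ℂ}

/-- On a chart given by the coefficients of the monic polynomial, the moduli map sends a point to the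
class of the roots of its polynomial. -/
theorem DiagonalPresentation.moduliMap_chart (h : DiagonalPresentation X e lam q₁ q₂) (h2 : 2 ≤ n)
    (h0 : ∀ j, monicEval a₀ (lam j) ≠ 0)
    (hr : ∀ j, r j ^ 2 = monicEval a₀ (lam j) / nodeDeriv lam j) {U : Set (Fin n → ℂ)}
    (hU : IsOpen U) (hUb : U ⊆ branchDomain lam a₀) {a t : Fin n → ℂ} (ha : a ∈ U)
    (ht : Function.Injective t) (hat : ∀ z, monicEval a z = ∏ i, (z - t i))
    (hv : e (chart lam a₀ r a) ≠ 0) :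
    ∃ hd, moduliMap n (projImage (fun a => e (chart lam a₀ r a)) U)
      ⟨Projectivization.mk ℂ (e (chart lam a₀ r a)) hv, hd⟩ = diagClass h2 t ht := by
  refine h.mem_moduliDomain h2 (t := t) (x := chart lam a₀ r a)
    ⟨h.injective, ht, fun i j hij => monicEval_ne_zero_of_mem (hUb ha) j ?_, fun j => ?_⟩
    (h.exists_projChart h0 hr hU hUb).2 hv ⟨a, ha, hv, rfl⟩
  · rw [hat, ← hij]
    exact Finset.prod_eq_zero (Finset.mem_univ i) (sub_self _)
  · rw [chart_sq h0 hr, hat]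

theorem exists_sqrt_values (hlam : Function.Injective lam) (h0 : ∀ j, monicEval a₀ (lam j) ≠ 0) :
    ∃ r : Fin (n + 3) → ℂ, ∀ j, r j ≠ 0 ∧ r j ^ 2 = monicEval a₀ (lam j) / nodeDeriv lam j := by
  have : ∀ j, ∃ z : ℂ, z ≠ 0 ∧ z ^ 2 = monicEval a₀ (lam j) / nodeDeriv lam j := fun j => by
    obtain ⟨z, hz⟩ := IsAlgClosed.exists_pow_nat_eq (monicEval a₀ (lam j) / nodeDeriv lam j) two_pos
    refine ⟨z, fun h => ?_, hz⟩
    rw [h, zero_pow two_ne_zero, eq_comm] at hz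
    exact div_ne_zero (h0 j) (nodeDeriv_ne_zero hlam j) hz
  choose r hr using this
  exact ⟨r, hr⟩

/-- Points of two intersections of quadrics in diagonal form with the same polynomial correspond to
each other by a biholomorphic map of Euclidean open sets that preserves the moduli. -/
theorem exists_preservesModuli (h : DiagonalPresentation X e lam q₁ q₂)
    (h' : DiagonalPresentation X' e' lam' q₁' q₂') (h2 : 2 ≤ n)
    (h0 : ∀ j, monicEval a₀ (lam j) ≠ 0) (h0' : ∀ j, monicEval a₀ (lam' j) ≠ 0)
    (hr : ∀ j, r j ^ 2 = monicEval a₀ (lam j) / nodeDeriv lam j)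
    (hr' : ∀ j, r' j ^ 2 = monicEval a₀ (lam' j) / nodeDeriv lam' j)
    (hroots : ∃ t : Fin n → ℂ, Function.Injective t ∧ ∀ z, monicEval a₀ z = ∏ i, (z - t i)) :
    ∃ M M' : Set (ℙ ℂ V), IsConnected M ∧ IsConnected M' ∧ IsEuclideanOpenIn M X ∧
      IsEuclideanOpenIn M' X' ∧ ∃ f : M ≃ M', IsBiholomorphic f ∧ PreservesModuli n f ∧
        ∃ U : Set (Fin n → ℂ), IsOpen U ∧ a₀ ∈ U ∧
          U ⊆ branchDomain lam a₀ ∩ branchDomain lam' a₀ ∧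
          ∀ a ∈ U, ∃ (ha : e (chart lam a₀ r a) ≠ 0) (ha' : e' (chart lam' a₀ r' a) ≠ 0)
            (hM : Projectivization.mk ℂ _ ha ∈ M),
            (f ⟨_, hM⟩ : ℙ ℂ V) = Projectivization.mk ℂ _ ha' := by
  have hW : IsOpen ((branchDomain lam a₀ ∩ branchDomain lam' a₀) ∩ {a : Fin n → ℂ |
      ∃ t : Fin n → ℂ, Function.Injective t ∧ ∀ z, monicEval a z = ∏ i, (z - t i)}) :=
    (isOpen_branchDomain.inter isOpen_branchDomain).inter isOpen_distinct_roots
  obtain ⟨ε, hε, hball⟩ := Metric.isOpen_iff.1 hW a₀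
    ⟨⟨self_mem_branchDomain h0, self_mem_branchDomain h0'⟩, hroots⟩
  set U := Metric.ball a₀ ε with hUdef
  have hU : IsOpen U := Metric.isOpen_ball
  have hUc : IsConnected U := Metric.isConnected_ball hε
  have hUb : U ⊆ branchDomain lam a₀ := fun a ha => (hball ha).1.1
  have hUb' : U ⊆ branchDomain lam' a₀ := fun a ha => (hball ha).1.2
  obtain ⟨⟨k, hk⟩, hM⟩ := h.exists_projChart h0 hr hU hUb
  obtain ⟨⟨l, hl⟩, hM'⟩ := h'.exists_projChart h0' hr' hU hUb'
  have key : ∀ a : U, ∃ d d', moduliMap n (projImage (fun a => e (chart lam a₀ r a)) U)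
      ⟨hk.equiv a, d⟩ = moduliMap n (projImage (fun a => e' (chart lam' a₀ r' a)) U)
      ⟨hl.equiv a, d'⟩ := by
    rintro ⟨a, ha⟩
    obtain ⟨t, ht, hat⟩ := (hball ha).2
    obtain ⟨d, hd⟩ := h.moduliMap_chart h2 h0 hr hU hUb ha ht hat (hk.ne_zero a ha)
    obtain ⟨d', hd'⟩ := h'.moduliMap_chart h2 h0' hr' hU hUb' ha ht hat (hl.ne_zero a ha)
    exact ⟨d, d', hd.trans hd'.symm⟩
  refine ⟨_, _, hk.isConnected hUc, hl.isConnected hUc, hM, hM', hk.equiv.symm.trans hl.equiv,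
    hk.isBiholomorphic hl, ⟨fun x hx => ?_, fun x hx => ?_, fun x => ?_⟩, U, hU,
    Metric.mem_ball_self hε, fun a ha => ⟨hUb ha, hUb' ha⟩, fun a ha =>
    ⟨hk.ne_zero a ha, hl.ne_zero a ha, hk.mk_mem ha, ?_⟩⟩
  · obtain ⟨a, ha⟩ := hk.equiv.surjective ⟨x, hx⟩
    obtain ⟨d, -⟩ := key a
    rwa [ha] at d
  · obtain ⟨a, ha⟩ := hl.equiv.surjective ⟨x, hx⟩
    obtain ⟨-, d, -⟩ := key a
    rwa [ha] at d
  · obtain ⟨a, rfl⟩ := hk.equiv.surjective x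
    obtain ⟨d, d', hd⟩ := key a
    simp only [Equiv.trans_apply, Equiv.symm_apply_apply]
    exact hd
  · have : (⟨Projectivization.mk ℂ _ (hk.ne_zero a ha), hk.mk_mem ha⟩ :
        projImage (fun a => e (chart lam a₀ r a)) U) = hk.equiv ⟨a, ha⟩ := rfl
    rw [this, Equiv.trans_apply, Equiv.symm_apply_apply]
    rfl

/-- Distinct roots outside a finite set. -/
theorem exists_injective_forall_notMem (s : Set ℂ) (hs : s.Finite) (n : ℕ) :
    ∃ t : Fin n → ℂ, Function.Injective t ∧ ∀ i, t i ∉ s := by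
  have : Infinite (sᶜ : Set ℂ) := hs.infinite_compl.to_subtype
  let g := Infinite.natEmbedding (sᶜ : Set ℂ)
  exact ⟨fun i => g i, fun i j hij => Fin.ext (g.injective (Subtype.ext hij)), fun i => (g i).2⟩

theorem exists_biholomorphic_preservesModuli (h2 : 2 ≤ n) (hV : Module.finrank ℂ V = n + 3)
    (hX : IsNonsingularIntersection X) (hX' : IsNonsingularIntersection X') :
    ∃ M M' : Set (ℙ ℂ V), M.Nonempty ∧ M'.Nonempty ∧ IsEuclideanOpenIn M X ∧
      IsEuclideanOpenIn M' X' ∧ ∃ f : M ≃ M', IsBiholomorphic f ∧ PreservesModuli n f := by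
  obtain ⟨e, lam, q₁, q₂, h⟩ := hX.exists_diagonalPresentation hV
  obtain ⟨e', lam', q₁', q₂', h'⟩ := hX'.exists_diagonalPresentation hV
  obtain ⟨t, ht, hts⟩ := exists_injective_forall_notMem (Set.range lam ∪ Set.range lam')
    ((Set.finite_range _).union (Set.finite_range _)) n
  obtain ⟨a₀, ha₀⟩ := exists_monicEval_eq t
  have h0 : ∀ j, monicEval a₀ (lam j) ≠ 0 := fun j => by
    rw [ha₀, Finset.prod_ne_zero_iff]
    exact fun i _ hi => hts i (Or.inl ⟨j, sub_eq_zero.1 hi⟩)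
  have h0' : ∀ j, monicEval a₀ (lam' j) ≠ 0 := fun j => by
    rw [ha₀, Finset.prod_ne_zero_iff]
    exact fun i _ hi => hts i (Or.inr ⟨j, sub_eq_zero.1 hi⟩)
  obtain ⟨r, hr⟩ := exists_sqrt_values h.injective h0
  obtain ⟨r', hr'⟩ := exists_sqrt_values h'.injective h0'
  obtain ⟨M, M', hM, hM', hMX, hMX', f, hf, hf', -⟩ := exists_preservesModuli h h' h2 h0 h0'
    (fun j => (hr j).2) (fun j => (hr' j).2) ⟨t, ht, ha₀⟩
  exact ⟨M, M', hM.nonempty, hM'.nonempty, hMX, hMX', f, hf, hf'⟩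

end Comparison

/-! ### Linear independence of square roots -/

section SquareRoots

theorem eventually_mem_slitPlane {ι : Type*} [Fintype ι] (c : ι → ℂ) :
    ∀ᶠ s in 𝓝 (0 : ℂ), ∀ p, 1 + s * c p ∈ Complex.slitPlane := by
  refine Filter.eventually_all.2 fun p => ?_
  have : ContinuousAt (fun s : ℂ => 1 + s * c p) 0 := by fun_prop
  refine this.eventually (Complex.isOpen_slitPlane.mem_nhds ?_)
  simp

/-- In a linear relation between the functions `√(1 + c_p s)` near `s = 0`, the coefficient of a
function that occurs only once vanishes: the derivatives of the relation at `0` show that the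
power sums `∑ d_p c_p ^ m` vanish. -/
theorem eq_zero_of_sum_sqrt_eq_zero {ι : Type*} [Fintype ι] [DecidableEq ι] {c d : ι → ℂ}
    (h : ∀ᶠ s in 𝓝[≠] (0 : ℂ), ∑ p, d p * Complex.sqrt (1 + s * c p) = 0) {p : ι}
    (hp : ∀ q, q ≠ p → c q ≠ c p) : d p = 0 := by
  let g : ℕ → ℂ → ℂ := fun m s => ∑ p, d p * c p ^ m * (1 + s * c p) ^ (1 / 2 - m : ℂ)
  have hs := eventually_mem_slitPlane c
  have hderiv : ∀ m s, (∀ p, 1 + s * c p ∈ Complex.slitPlane) →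
      HasDerivAt (g m) ((1 / 2 - m) * g (m + 1) s) s := by
    intro m s hs
    have h1 : HasDerivAt (g m) (∑ p, d p * c p ^ m *
        ((1 / 2 - m) * (1 + s * c p) ^ (1 / 2 - m - 1 : ℂ) * c p)) s := by
      refine HasDerivAt.fun_sum fun p _ => HasDerivAt.const_mul _ ?_
      refine HasDerivAt.cpow_const ?_ (hs p)
      simpa using ((hasDerivAt_id s).mul_const (c p)).const_add 1
    convert h1 using 1
    rw [Finset.mul_sum]
    refine Finset.sum_congr rfl fun p _ => ?_
    rw [show (1 / 2 - m - 1 : ℂ) = 1 / 2 - (m + 1 : ℕ) by push_cast; ring]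
    ring
  have hzero : ∀ m, ∀ᶠ s in 𝓝 (0 : ℂ), g m s = 0 := by
    intro m
    induction m with
    | zero =>
      have han : AnalyticAt ℂ (g 0) 0 := by
        rw [Complex.analyticAt_iff_eventually_differentiableAt]
        filter_upwards [hs] with s hs
        exact (hderiv 0 s hs).differentiableAt
      refine han.frequently_zero_iff_eventually_zero.1 (Filter.Eventually.frequently ?_)
      filter_upwards [h] with s h
      rw [← h]
      refine Finset.sum_congr rfl fun p _ => ?_
      rw [Complex.sqrt]
      norm_num
    | succ m ih =>
      filter_upwards [ih.eventually_nhds, hs] with s h1 h2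
      have h3 := (hderiv m s h2).deriv
      have h4 : g m =ᶠ[𝓝 s] fun _ => 0 := h1
      rw [h4.deriv_eq, deriv_const, eq_comm, mul_eq_zero] at h3
      refine h3.resolve_left fun h5 => ?_
      have h6 : (1 : ℂ) = (2 * m : ℕ) := by
        push_cast
        linear_combination 2 * h5
      have h7 : 1 = 2 * m := by exact_mod_cast h6
      omega
  have hpow : ∀ m, ∑ p, d p * c p ^ m = 0 := fun m => by
    have := (hzero m).self_of_nhds
    simpa [g] using this
  have hpoly : ∀ f : Polynomial ℂ, ∑ p, d p * f.eval (c p) = 0 := fun f => by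
    simp only [Polynomial.eval_eq_sum_range, Finset.mul_sum]
    rw [Finset.sum_comm]
    refine Finset.sum_eq_zero fun m _ => ?_
    rw [← mul_zero (f.coeff m), ← hpow m, Finset.mul_sum]
    exact Finset.sum_congr rfl fun p _ => by ring
  have h1 := hpoly (∏ q ∈ Finset.univ.erase p, (Polynomial.X - Polynomial.C (c q)))
  rw [Finset.sum_eq_single p (fun q _ hq => by
    rw [Polynomial.eval_prod, Finset.prod_eq_zero (i := q) (by simp [hq]) (by simp), mul_zero])
    (by simp)] at h1
  refine (mul_eq_zero.1 h1).resolve_right ?_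
  rw [Polynomial.eval_prod, ← ne_eq, Finset.prod_ne_zero_iff]
  intro q hq h2
  simp only [Polynomial.eval_sub, Polynomial.eval_X, Polynomial.eval_C] at h2
  exact hp q (Finset.ne_of_mem_erase hq) (sub_eq_zero.1 h2).symm

end SquareRoots

/-! ### Square roots at different nodes are not proportional -/

section Rigidity

variable {n : ℕ}

/-- The branch at `a₀` of the square root of the ratio of the values at `z` of the monic polynomials
with lower coefficients `a` and `a₀`. -/
def sqrtRatio (a₀ : Fin n → ℂ) (z : ℂ) (a : Fin n → ℂ) : ℂ :=
  Complex.sqrt (monicEval a z / monicEval a₀ z)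

theorem chart_eq (lam : Fin (n + 3) → ℂ) (a₀ : Fin n → ℂ) (r : Fin (n + 3) → ℂ) (a : Fin n → ℂ)
    (j : Fin (n + 3)) : chart lam a₀ r a j = r j * sqrtRatio a₀ (lam j) a := rfl

theorem sqrtRatio_self {a₀ : Fin n → ℂ} {z : ℂ} (h : monicEval a₀ z ≠ 0) :
    sqrtRatio a₀ z a₀ = 1 := by
  rw [sqrtRatio, div_self h, Complex.sqrt_one]

/-- The pencil of monic polynomials through `a₀` in the direction of a polynomial `Q` of lower degree:
along it, the square roots of the ratios are square roots of affine functions. -/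
theorem exists_line (Q : Polynomial ℂ) (hQ : Q.natDegree < n) (a₀ : Fin n → ℂ) {U : Set (Fin n → ℂ)}
    (hU : IsOpen U) (ha₀ : a₀ ∈ U) :
    ∃ a : ℂ → Fin n → ℂ, (∀ᶠ s in 𝓝[≠] (0 : ℂ), s ≠ 0 ∧ a s ∈ U) ∧
      ∀ s z, monicEval a₀ z ≠ 0 →
        sqrtRatio a₀ z (a s) = Complex.sqrt (1 + s * (Q.eval z / monicEval a₀ z)) := by
  refine ⟨fun s => a₀ + s • fun k : Fin n => Q.coeff k, ?_, fun s z hz => ?_⟩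
  · have hc : ContinuousAt (fun s : ℂ => a₀ + s • fun k : Fin n => Q.coeff k) 0 := by fun_prop
    have h1 : ∀ᶠ s in 𝓝 (0 : ℂ), (a₀ + s • fun k : Fin n => Q.coeff k) ∈ U :=
      hc.eventually (hU.mem_nhds (by simpa using ha₀))
    filter_upwards [self_mem_nhdsWithin, nhdsWithin_le_nhds h1] with s h2 h3
    exact ⟨h2, h3⟩
  · have h1 : monicEval (a₀ + s • fun k : Fin n => Q.coeff k) z = monicEval a₀ z + s * Q.eval z := by
      rw [Polynomial.eval_eq_sum_range' hQ, Finset.sum_range]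
      simp only [monicEval, Pi.add_apply, Pi.smul_apply, smul_eq_mul, add_mul, Finset.sum_add_distrib,
        Finset.mul_sum, mul_assoc]
      ring
    rw [sqrtRatio, h1]
    congr 1
    field_simp

/-- The square roots at one node set are not, up to a common factor, linear combinations of the
square roots at a node set that differs from it in one node. -/
theorem false_of_proportional (hn : 3 ≤ n) {lam : Fin (n + 3) → ℂ} {mu : ℂ} {k l : Fin (n + 3)}
    {a₀ : Fin n → ℂ} (h0 : ∀ j, monicEval a₀ (lam j) ≠ 0) (hmu : monicEval a₀ mu ≠ 0)
    (hlam : Function.Injective lam) (hkl : k ≠ l)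
    (hval : Function.Injective fun j => monicEval a₀ (lam j))
    (hvalmu : ∀ j, monicEval a₀ (lam j) ≠ monicEval a₀ mu)
    (hQ : ∀ p q, p ≠ q → p ≠ k → p ≠ l → q ≠ k → q ≠ l →
      (lam p - lam k) * (lam p - lam l) * monicEval a₀ (lam q) ≠
        (lam q - lam k) * (lam q - lam l) * monicEval a₀ (lam p))
    {U : Set (Fin n → ℂ)} (hU : IsOpen U) (ha₀ : a₀ ∈ U) {α β γ : Fin (n + 3) → ℂ}
    {ρ : (Fin n → ℂ) → ℂ} (hρ : ∀ a ∈ U, ρ a ≠ 0)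
    (hα : ∀ a ∈ U, ∑ p, α p * sqrtRatio a₀ (lam p) a = ρ a * sqrtRatio a₀ (lam k) a)
    (hβ : ∀ a ∈ U, ∑ p, β p * sqrtRatio a₀ (lam p) a = ρ a * sqrtRatio a₀ (lam l) a)
    (hγ : ∀ a ∈ U, ∑ p, γ p * sqrtRatio a₀ (lam p) a = ρ a * sqrtRatio a₀ mu a) : False := by
  -- In the direction of `(z - λₖ)(z - λₗ)`, the square roots at `λₖ` and `λₗ` are constant.
  have hαβ : ∀ p, p ≠ k → p ≠ l → α p = β p := by
    obtain ⟨a, ha, hs⟩ := exists_line ((Polynomial.X - Polynomial.C (lam k)) *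
      (Polynomial.X - Polynomial.C (lam l))) (by
        refine lt_of_le_of_lt Polynomial.natDegree_mul_le ?_
        rw [Polynomial.natDegree_X_sub_C, Polynomial.natDegree_X_sub_C]
        omega) a₀ hU ha₀
    simp only [Polynomial.eval_mul, Polynomial.eval_sub, Polynomial.eval_X, Polynomial.eval_C] at hs
    intro p hpk hpl
    have hp0 : (lam p - lam k) * (lam p - lam l) ≠ 0 :=
      mul_ne_zero (sub_ne_zero.2 (hlam.ne hpk)) (sub_ne_zero.2 (hlam.ne hpl))
    refine sub_eq_zero.1 (eq_zero_of_sum_sqrt_eq_zero (d := fun p => α p - β p)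
      (c := fun p => (lam p - lam k) * (lam p - lam l) / monicEval a₀ (lam p)) ?_ (p := p) ?_)
    · filter_upwards [ha] with s ⟨_, hsU⟩
      have h1 := hα _ hsU
      have h2 := hβ _ hsU
      rw [hs s _ (h0 k), sub_self, zero_mul, zero_div, mul_zero, add_zero, Complex.sqrt_one] at h1
      rw [hs s _ (h0 l), sub_self, mul_zero, zero_div, mul_zero, add_zero, Complex.sqrt_one] at h2
      rw [← sub_eq_zero.2 (h1.trans h2.symm), ← Finset.sum_sub_distrib]
      refine Finset.sum_congr rfl fun p _ => ?_
      rw [hs s _ (h0 p)]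
      ring
    · intro q hq hqp
      rw [div_eq_div_iff (h0 q) (h0 p)] at hqp
      by_cases hqk : q = k
      · rw [hqk, sub_self, zero_mul, zero_mul, eq_comm] at hqp
        exact mul_ne_zero hp0 (h0 k) hqp
      by_cases hql : q = l
      · rw [hql, sub_self, mul_zero, zero_mul, eq_comm] at hqp
        exact mul_ne_zero hp0 (h0 l) hqp
      exact hQ q p hq hqk hql hpk hpl hqp
  set δ := β l - α l with hδ
  have hdiff : ∀ a ∈ U, (β k - α k) * sqrtRatio a₀ (lam k) a + δ * sqrtRatio a₀ (lam l) a =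
      ρ a * (sqrtRatio a₀ (lam l) a - sqrtRatio a₀ (lam k) a) := by
    intro a ha
    have h1 : ∑ p, (β p - α p) * sqrtRatio a₀ (lam p) a =
        (β k - α k) * sqrtRatio a₀ (lam k) a + δ * sqrtRatio a₀ (lam l) a :=
      Fintype.sum_eq_add k l hkl fun p ⟨hpk, hpl⟩ => by
        rw [hαβ p hpk hpl, sub_self, zero_mul]
    rw [← h1, mul_sub, ← hα a ha, ← hβ a ha, ← Finset.sum_sub_distrib]
    exact Finset.sum_congr rfl fun p _ => by ring
  have hk : β k - α k = -δ := by
    have := hdiff a₀ ha₀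
    rw [sqrtRatio_self (h0 k), sqrtRatio_self (h0 l)] at this
    linear_combination this
  -- In the direction of the constants, all the square roots are distinct, and the factor is `δ`.
  obtain ⟨a, ha, hs⟩ := exists_line 1 (by rw [Polynomial.natDegree_one]; omega) a₀ hU ha₀
  simp only [Polynomial.eval_one] at hs
  have hfac : ∀ᶠ s in 𝓝[≠] (0 : ℂ), ρ (a s) = δ := by
    filter_upwards [ha] with s ⟨hs0, hsU⟩
    have h1 := hdiff _ hsU
    rw [hk] at h1
    refine mul_right_cancel₀ (sub_ne_zero.2 fun h2 => ?_) (by rw [← h1]; ring :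
      ρ (a s) * (sqrtRatio a₀ (lam l) (a s) - sqrtRatio a₀ (lam k) (a s)) =
        δ * (sqrtRatio a₀ (lam l) (a s) - sqrtRatio a₀ (lam k) (a s)))
    have h3 : sqrtRatio a₀ (lam l) (a s) ^ 2 = sqrtRatio a₀ (lam k) (a s) ^ 2 := by rw [h2]
    rw [hs s _ (h0 l), hs s _ (h0 k), sqrt_sq, sqrt_sq, add_right_inj, mul_right_inj' hs0,
      one_div, one_div, inv_inj] at h3
    exact hkl (hval h3.symm)
  have hδ0 : δ = 0 := by
    refine neg_eq_zero.1 (eq_zero_of_sum_sqrt_eq_zero (ι := Option (Fin (n + 3)))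
      (d := fun o => o.elim (-δ) γ)
      (c := fun o => o.elim (1 / monicEval a₀ mu) fun p => 1 / monicEval a₀ (lam p))
      (p := none) ?_ ?_)
    · filter_upwards [ha, hfac] with s ⟨_, hsU⟩ hsδ
      have h1 := hγ _ hsU
      rw [hsδ, hs s _ hmu] at h1
      rw [Fintype.sum_option]
      simp only [Option.elim_none, Option.elim_some]
      rw [neg_mul, ← h1, neg_add_eq_zero]
      exact Finset.sum_congr rfl fun p _ => by rw [hs s _ (h0 p)]
    · rintro (_ | p) hp
      · exact absurd rfl hp
      · simp only [Option.elim_none, Option.elim_some, one_div]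
        rw [Ne, inv_inj]
        exact hvalmu p
  obtain ⟨s, hs1, -, hs2⟩ := (hfac.and ha).exists
  exact hρ _ hs2 (hs1.trans hδ0)

end Rigidity

/-! ### Generic monic polynomials -/

section GenericParameter

variable {n : ℕ}

theorem finite_linear_solutions {A B p q : ℂ} (hA : A ≠ 0) (hpq : p ≠ q) :
    {τ : ℂ | A * (p - τ) = B * (q - τ)}.Finite := by
  refine Set.Subsingleton.finite fun x hx y hy => ?_
  simp only [Set.mem_ofPred_eq] at hx hy
  by_contra hxy
  have h1 : (A - B) * (x - y) = 0 := by linear_combination hy - hx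
  have h2 : A = B := sub_eq_zero.1 ((mul_eq_zero.1 h1).resolve_right (sub_ne_zero.2 hxy))
  rw [← h2] at hx
  have h3 : A * (p - q) = 0 := by linear_combination hx
  exact mul_ne_zero hA (sub_ne_zero.2 hpq) h3

/-- A monic polynomial with distinct roots such that the ratios of its values at given nodes avoid
finitely many given ratios: one of the roots can be chosen freely, and the conditions are linear
in it. -/
theorem exists_generic_parameter {ι κ : Type*} [Finite ι] [Finite κ] (hn : 1 ≤ n) (nu : ι → ℂ)
    (hnu : Function.Injective nu) (u v : κ → ι) (A B : κ → ℂ) (huv : ∀ i, u i ≠ v i)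
    (hA : ∀ i, A i ≠ 0) :
    ∃ a₀ : Fin n → ℂ, (∃ t : Fin n → ℂ, Function.Injective t ∧ ∀ z, monicEval a₀ z = ∏ i, (z - t i)) ∧
      (∀ i, monicEval a₀ (nu i) ≠ 0) ∧
      ∀ i, A i * monicEval a₀ (nu (u i)) ≠ B i * monicEval a₀ (nu (v i)) := by
  obtain ⟨m, rfl⟩ : ∃ m, n = m + 1 := ⟨n - 1, by omega⟩
  obtain ⟨t, ht, hts⟩ := exists_injective_forall_notMem (Set.range nu) (Set.finite_range nu) m
  have hR : ∀ i, ∏ j, (nu i - t j) ≠ 0 := fun i => by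
    rw [Finset.prod_ne_zero_iff]
    exact fun j _ hj => hts j ⟨i, sub_eq_zero.1 hj⟩
  have hfin : (Set.range t ∪ Set.range nu ∪ ⋃ i, {τ : ℂ | (A i * ∏ j, (nu (u i) - t j)) * (nu (u i) - τ)
      = (B i * ∏ j, (nu (v i) - t j)) * (nu (v i) - τ)}).Finite := by
    refine ((Set.finite_range t).union (Set.finite_range nu)).union (Set.finite_iUnion fun i => ?_)
    exact finite_linear_solutions (mul_ne_zero (hA i) (hR _)) (hnu.ne (huv i))
  obtain ⟨τ, hτ⟩ := hfin.infinite_compl.nonempty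
  simp only [Set.mem_compl_iff, Set.mem_union, not_or, Set.mem_iUnion, not_exists,
    Set.mem_ofPred_eq] at hτ
  obtain ⟨⟨hτ₁, hτ₂⟩, hτ₃⟩ := hτ
  obtain ⟨a₀, ha₀⟩ := exists_monicEval_eq (Fin.cons τ t : Fin (m + 1) → ℂ)
  have hval : ∀ z, monicEval a₀ z = (z - τ) * ∏ j, (z - t j) := fun z => by
    rw [ha₀, Fin.prod_univ_succ]
    simp
  refine ⟨a₀, ⟨_, Fin.cons_injective_iff.2 ⟨hτ₁, ht⟩, ha₀⟩, fun i => ?_,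
    fun i h => hτ₃ i ?_⟩
  · rw [hval]
    exact mul_ne_zero (sub_ne_zero.2 fun h => hτ₂ ⟨i, h⟩) (hR i)
  · rw [hval, hval] at h
    linear_combination h

end GenericParameter

/-! ### A moduli-preserving map that is not projective -/

section DiagonalQuadrics

/-- The intersection of the quadrics `∑ xⱼ² = 0` and `∑ λⱼ xⱼ² = 0`. -/
def diagIntersection {N : ℕ} (lam : Fin N → ℂ) : Set (ℙ ℂ (Fin N → ℂ)) :=
  {x | diagForm 1 x.rep = 0 ∧ diagForm lam x.rep = 0}

/-- A nonzero isotropic vector has two nonzero coordinates, which makes the differentials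
of the two forms independent. -/
theorem diagonalPresentation_diagIntersection {N : ℕ} {lam : Fin N → ℂ}
    (hlam : Function.Injective lam) :
    DiagonalPresentation (diagIntersection lam) (LinearEquiv.refl ℂ (Fin N → ℂ)) lam (diagForm 1)
      (diagForm lam) := by
  refine ⟨⟨rfl, fun x hx => ?_⟩, hlam, ?_, ?_⟩
  · obtain ⟨i, hi⟩ := Function.ne_iff.1 x.rep_nonzero
    obtain ⟨j, hji, hj⟩ : ∃ j, j ≠ i ∧ x.rep j ≠ 0 := by
      by_contra! hc
      have h1 := hx.1
      rw [diagForm_apply, Finset.sum_eq_single i (fun j _ hj => by rw [hc j hj]; simp) (by simp)] at h1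
      exact hi (by simpa using h1)
    refine LinearIndependent.pair_iff.2 fun a b hab => ?_
    have key : ∀ k, x.rep k ≠ 0 → a + b * lam k = 0 := by
      intro k hk
      have h1 := LinearMap.congr_fun hab (Pi.single k 1)
      simp only [LinearMap.add_apply, LinearMap.smul_apply, QuadraticMap.polarBilin_apply_apply,
        polar_diagForm, LinearMap.zero_apply, smul_eq_mul] at h1
      rw [Finset.sum_eq_single k (by intro m _ hm; simp [hm]) (by simp),
        Finset.sum_eq_single k (by intro m _ hm; simp [hm]) (by simp)] at h1
      simp only [Pi.single_eq_same, Pi.one_apply] at h1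
      refine (mul_eq_zero.1 (?_ : 2 * x.rep k * (a + b * lam k) = 0)).resolve_left
        (mul_ne_zero two_ne_zero hk)
      linear_combination h1
    have h1 := key i hi
    have h2 := key j hj
    have hb : b = 0 := by
      have h3 : b * (lam i - lam j) = 0 := by linear_combination h1 - h2
      exact (mul_eq_zero.1 h3).resolve_right (sub_ne_zero.2 (hlam.ne hji.symm))
    rw [hb, zero_mul, add_zero] at h1
    exact ⟨h1, hb⟩
  · ext v
    rfl
  · ext v
    rfl

theorem DiagonalPresentation.isNonsingularIntersection {V : Type*} [NormedAddCommGroup V]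
    [NormedSpace ℂ V] {N : ℕ} {X : Set (ℙ ℂ V)} {e : (Fin N → ℂ) ≃ₗ[ℂ] V} {lam : Fin N → ℂ}
    {q₁ q₂ : QuadraticForm ℂ V} (h : DiagonalPresentation X e lam q₁ q₂) :
    IsNonsingularIntersection X :=
  ⟨q₁, q₂, h.presents.eq, h.presents.smooth⟩

variable {n : ℕ}

/-- Let `λ` and `λ'` differ in one node only. For a generic parameter, the map between the two
intersections of quadrics that preserves the polynomial is not induced by a linear map. -/
theorem exists_not_projective (hn : 3 ≤ n) {lam : Fin (n + 3) → ℂ} (hlam : Function.Injective lam)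
    {mu : ℂ} (hmu : ∀ j, lam j ≠ mu) :
    ∃ X X' M M' : Set (ℙ ℂ (Fin (n + 3) → ℂ)),
      IsNonsingularIntersection X ∧ IsNonsingularIntersection X' ∧
      IsConnected M ∧ IsConnected M' ∧ IsEuclideanOpenIn M X ∧ IsEuclideanOpenIn M' X' ∧
      ∃ f : M ≃ M', IsBiholomorphic f ∧ PreservesModuli n f ∧
        ¬ ∃ T : (Fin (n + 3) → ℂ) ≃ₗ[ℂ] (Fin (n + 3) → ℂ), ∀ x : M,
          (f x : ℙ ℂ (Fin (n + 3) → ℂ)) =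
            Projectivization.map (T : (Fin (n + 3) → ℂ) →ₗ[ℂ] (Fin (n + 3) → ℂ)) T.injective x := by
  let lam' := Function.update lam 0 mu
  have hlam'0 : lam' 0 = mu := Function.update_self _ _ _
  have hlam'1 : ∀ j, j ≠ 0 → lam' j = lam j := fun j hj => Function.update_of_ne hj _ _
  have hlam' : Function.Injective lam' := by
    intro i j hij
    by_cases hi : i = 0
    · by_cases hj : j = 0
      · rw [hi, hj]
      · rw [hi, hlam'0, hlam'1 j hj] at hij
        exact absurd hij.symm (hmu j)
    · by_cases hj : j = 0
      · rw [hj, hlam'0, hlam'1 i hi] at hij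
        exact absurd hij (hmu i)
      · rw [hlam'1 i hi, hlam'1 j hj] at hij
        exact hlam hij
  obtain ⟨k, l, hk, hl, hkl⟩ : ∃ k l : Fin (n + 3), k ≠ 0 ∧ l ≠ 0 ∧ k ≠ l :=
    ⟨⟨1, by omega⟩, ⟨2, by omega⟩, by simp, by simp [Fin.ext_iff], by simp⟩
  have hnu : Function.Injective fun o : Option (Fin (n + 3)) => o.elim mu lam := by
    rintro (_ | i) (_ | j) h
    · rfl
    · exact absurd h.symm (hmu j)
    · exact absurd h (hmu i)
    · exact congrArg some (hlam h)
  -- The first family of conditions makes the values at the nodes distinct, and the second one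
  -- their ratios to the values of `(z - λₖ)(z - λₗ)`.
  obtain ⟨a₀, hroots, hne, hgen⟩ := exists_generic_parameter (by omega : 1 ≤ n) _ hnu
    (κ := {x : Option (Fin (n + 3)) × Option (Fin (n + 3)) // x.1 ≠ x.2} ⊕
      {x : Fin (n + 3) × Fin (n + 3) // x.1 ≠ x.2 ∧ x.1 ≠ k ∧ x.1 ≠ l})
    (Sum.elim (fun x => x.1.1) fun x => some x.1.2) (Sum.elim (fun x => x.1.2) fun x => some x.1.1)
    (Sum.elim 1 fun x => (lam x.1.1 - lam k) * (lam x.1.1 - lam l))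
    (Sum.elim 1 fun x => (lam x.1.2 - lam k) * (lam x.1.2 - lam l))
    (by
      rintro (x | x)
      · exact x.2
      · exact fun h => x.2.1 (Option.some.inj h).symm)
    (by
      rintro (x | x)
      · exact one_ne_zero
      · exact mul_ne_zero (sub_ne_zero.2 (hlam.ne x.2.2.1)) (sub_ne_zero.2 (hlam.ne x.2.2.2)))
  have h0 : ∀ j, monicEval a₀ (lam j) ≠ 0 := fun j => hne (some j)
  have hmu0 : monicEval a₀ mu ≠ 0 := hne none
  have h0' : ∀ j, monicEval a₀ (lam' j) ≠ 0 := fun j => by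
    by_cases hj : j = 0
    · rw [hj, hlam'0]
      exact hmu0
    · rw [hlam'1 j hj]
      exact h0 j
  have hdist : ∀ x y : Option (Fin (n + 3)), x ≠ y →
      monicEval a₀ (x.elim mu lam) ≠ monicEval a₀ (y.elim mu lam) := fun x y hxy => by
    have := hgen (Sum.inl ⟨(x, y), hxy⟩)
    simpa using this
  obtain ⟨r, hr⟩ := exists_sqrt_values hlam h0
  obtain ⟨r', hr'⟩ := exists_sqrt_values hlam' h0'
  have hX := diagonalPresentation_diagIntersection hlam
  have hX' := diagonalPresentation_diagIntersection hlam'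
  obtain ⟨M, M', hM, hM', hMX, hMX', f, hf, hfm, U, hU, ha₀, -, hfU⟩ :=
    exists_preservesModuli hX hX' (by omega) h0 h0' (fun j => (hr j).2) (fun j => (hr' j).2) hroots
  refine ⟨_, _, M, M', hX.isNonsingularIntersection, hX'.isNonsingularIntersection, hM, hM', hMX,
    hMX', f, hf, hfm, ?_⟩
  rintro ⟨T, hT⟩
  have hρ : ∀ a : U, ∃ ρ : ℂ, ρ ≠ 0 ∧ T (chart lam a₀ r a) = ρ • chart lam' a₀ r' a := by
    rintro ⟨a, ha⟩
    obtain ⟨hG, hH, hGM, hfG⟩ := hfU a ha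
    rw [hT, Projectivization.map_mk] at hfG
    exact exists_smul_of_mk_eq hfG
  choose ρ hρ0 hρ using hρ
  classical
  let ρ' : (Fin n → ℂ) → ℂ := fun a => if ha : a ∈ U then ρ ⟨a, ha⟩ else 0
  have hρ' : ∀ a (ha : a ∈ U), ρ' a = ρ ⟨a, ha⟩ := fun a ha => dif_pos ha
  have hrow : ∀ j, ∀ a ∈ U, ∑ p, (T (Pi.single p 1) j * r p / r' j) * sqrtRatio a₀ (lam p) a =
      ρ' a * sqrtRatio a₀ (lam' j) a := by
    intro j a ha
    have h1 := congrFun (hρ ⟨a, ha⟩) j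
    have h2 := congrFun (LinearMap.pi_apply_eq_sum_univ
      (T : (Fin (n + 3) → ℂ) →ₗ[ℂ] (Fin (n + 3) → ℂ)) (chart lam a₀ r a)) j
    rw [LinearEquiv.coe_coe, h1, Finset.sum_apply, Pi.smul_apply, chart_eq, smul_eq_mul] at h2
    rw [hρ' a ha]
    have h3 := (hr' j).1
    refine mul_left_cancel₀ h3 ?_
    rw [mul_left_comm, h2, Finset.mul_sum]
    refine Finset.sum_congr rfl fun p _ => ?_
    have h4 : (fun i => if p = i then 1 else 0 : Fin (n + 3) → ℂ) = Pi.single p 1 := by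
      ext i
      simp [Pi.single_apply, eq_comm]
    rw [Pi.smul_apply, h4, chart_eq, smul_eq_mul]
    field_simp
  have hrk := hrow k
  have hrl := hrow l
  have hr0 := hrow 0
  rw [hlam'1 k hk] at hrk
  rw [hlam'1 l hl] at hrl
  rw [hlam'0] at hr0
  refine false_of_proportional hn h0 hmu0 hlam hkl (fun i j hij => ?_) (fun j => hdist (some j) none
    (by simp)) (fun p q hpq hpk hpl _ _ => hgen (Sum.inr ⟨(p, q), hpq, hpk, hpl⟩)) hU ha₀
    (fun a ha => (hρ' a ha).symm ▸ hρ0 _) hrk hrl hr0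
  by_contra hne
  exact hdist (some i) (some j) (fun h => hne (Option.some.inj h)) hij

end DiagonalQuadrics

end

end QuadricPencils

open QuadricPencils in
theorem theorem1 (n : ℕ) (hn : 3 ≤ n) :
    (∀ X : Set (ℙ ℂ (Fin (n + 3) → ℂ)), IsNonsingularIntersection X →
      (∃ U : Set (ℙ ℂ (Fin (n + 3) → ℂ)),
        IsOpen[zariskiProj (Fin (n + 3) → ℂ)] U ∧ moduliDomain n X = X ∩ U) ∧
      IsMorphism (moduliMap n X) ∧ DenseRange (moduliMap n X)) ∧
    (∀ X X' : Set (ℙ ℂ (Fin (n + 3) → ℂ)),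
      IsNonsingularIntersection X → IsNonsingularIntersection X' →
      ∃ M M' : Set (ℙ ℂ (Fin (n + 3) → ℂ)), M.Nonempty ∧ M'.Nonempty ∧
        IsEuclideanOpenIn M X ∧ IsEuclideanOpenIn M' X' ∧
        ∃ f : M ≃ M', IsBiholomorphic f ∧ PreservesModuli n f) ∧
    (∃ X X' M M' : Set (ℙ ℂ (Fin (n + 3) → ℂ)),
      IsNonsingularIntersection X ∧ IsNonsingularIntersection X' ∧
      IsConnected M ∧ IsConnected M' ∧ IsEuclideanOpenIn M X ∧ IsEuclideanOpenIn M' X' ∧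
      ∃ f : M ≃ M', IsBiholomorphic f ∧ PreservesModuli n f ∧
        ¬ ∃ T : (Fin (n + 3) → ℂ) ≃ₗ[ℂ] (Fin (n + 3) → ℂ), ∀ x : M,
          (f x : ℙ ℂ (Fin (n + 3) → ℂ)) =
            Projectivization.map (T : (Fin (n + 3) → ℂ) →ₗ[ℂ] (Fin (n + 3) → ℂ)) T.injective x) := by
  have hV : Module.finrank ℂ (Fin (n + 3) → ℂ) = n + 3 := Module.finrank_fin_fun ℂ
  refine ⟨fun X hX => ?_, fun X X' hX hX' =>
    exists_biholomorphic_preservesModuli (by omega) hV hX hX', ?_⟩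
  · obtain ⟨e, lam, q₁, q₂, h⟩ := hX.exists_diagonalPresentation hV
    exact ⟨h.presents.isOpen_moduliDomain (by omega) hV, h.presents.isMorphism_moduliMap hV,
      (h.surjective_moduliMap (by omega)).denseRange⟩
  · refine exists_not_projective hn (lam := fun j => (j : ℕ)) (mu := -1)
      (fun i j hij => Fin.ext (Nat.cast_injective hij)) fun j hj => ?_
    have h1 : (j : ℕ) + 1 = (0 : ℂ) := by linear_combination hj
    exact Nat.cast_add_one_ne_zero _ h1
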